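/- Let $n\ge 2$ be an integer, $\lambda\in(0,1]$ and $\delta=1-\lambda$. Let $g(s)=\sum_{i=0}^N a_i s^{\alpha_i}$ for $s\ge 0$, where $N\ge 1$, $a_0,\dots,a_N>0$ and the exponents are real numbers $0=\alpha_0<\alpha_1<\dots<\alpha_N$. For $\xi\ge 0$ let $K(\xi)=1/g(s(\xi))$, where $s(\xi)$ is the unique non-negative solution $s$ of $s\,g(s)=\xi$. Put $a=\frac{\alpha_N}{\alpha_N+1}\in(0,1)$ and assume $a>\delta$. Define $$\alpha_*=\frac{n(a-\delta)}{2-a},\qquad \kappa(\alpha)=1+\frac{2-a}{n}-\frac{a-\delta}{\alpha}.$$ For an open set $U\subset\mathbb R^n$ and $T>0$, a non-negative weak solution of $$\frac{\partial (u^\lambda)}{\partial t}=\nabla\cdot\big(K(|\nabla u|)\nabla u\big)\quad\text{in } U\times(0,T)$$ is a function $u\in L^1_{\rm loc}(U\times(0,T))$, $u\ge 0$ a.e., with weak spatial gradient $\nabla u\in L^{2-a}_{\rm loc}(U\times(0,T))$, such that for all $\phi\in C_c^\infty(U\times(0,T))$ $$\int_0^T\!\!\int_U u^\lambda\,\phi_t\,dx\,dt=\int_0^T\!\!\int_U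 K(|\nabla u|)\nabla u\cdot\nabla\phi\,dx\,dt .$$ (No initial or boundary condition is needed.) There is a constant $c_{10}\ge 1$, depending only on $n,\lambda,g$, such that the following holds. Let $\alpha_0$ now denote a real number (not the exponent of $g$) with $\alpha_0\ge 2-\delta$ and $\alpha_0>\alpha_*$, and set $\kappa_*=\kappa(\alpha_0)$. Then the infinite products $$\mu=\prod_{j=0}^\infty\frac{\alpha_0\kappa_*^j-2+\delta}{\alpha_0\kappa_*^j},\qquad \nu=\prod_{j=0}^\infty\frac{\alpha_0\kappa_*^j}{\alpha_0\kappa_*^j+\delta-a}$$ converge in $\mathbb R$ (with $\mu=0$ if $\alpha_0=2-\delta$), and there is $\omega>0$ depending only on $\alpha_0$ (and $n,\lambda,g$) such that for every open $U\subset\mathbb R^n$, every $T>0$ and $\sigma\in(0,1)$, every non-negative weak solution $u$ in $U\times(0,T)$, and every ball $B_R$ of radius $R>0$ with $\overline{B_R}\subset U$, $$\|u\|_{L^\infty(B_{R/2}\times(\sigma T,T))}\le \widehat{\mathcal C}_{R,T,\sigma}\,\max\Big\{\|u\|^{\mu}_{L^{\alpha_0}(B_R\times(0,T))},\ \|u\|^{\nu}_{L^{\alpha_0}(B_R\times(0,T))}\Big\},$$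 where $B_{R/2}$ is the concentric ball of radius $R/2$ and $$\widehat{\mathcal C}_{R,T,\sigma}=\Big[2^{11}c_{10}\,\alpha_0^{6-a}(1+R^{-1})^2(1+|B_R|T)^3\Big(1+\frac1{\sigma T}+\frac1{R^{2-a}}\Big)^2\Big]^{\omega}.$$ Here $y^0=1$ for all $y\in[0,\infty]$; if $\|u\|_{L^{\alpha_0}(B_R\times(0,T))}=\infty$, the right-hand side is $+\infty$. -/

import Mathlib

open MeasureTheory Set TopologicalSpace
open scoped NNReal ENNReal Distributions

namespace Forchheimer

/-- The data of a generalized Forchheimer polynomial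
`g(s) = a₀ s^{α₀} + a₁ s^{α₁} + ⋯ + a_N s^{α_N}`, with `N ≥ 1`, real exponents
`0 = α₀ < α₁ < ⋯ < α_N` and positive coefficients `a₀, …, a_N`. -/
structure GenPoly where
  N : ℕ
  one_le_N : 1 ≤ N
  coeff : Fin (N + 1) → ℝ
  expo : Fin (N + 1) → ℝ
  coeff_pos : ∀ i, 0 < coeff i
  expo_zero : expo 0 = 0
  expo_strictMono : StrictMono expo

namespace GenPoly

variable (g : GenPoly)

/-- The value `g(s)`; since `0 ^ 0 = 1` one has `g(0) = a₀`. -/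
noncomputable def eval (s : ℝ) : ℝ := ∑ i, g.coeff i * s ^ g.expo i

theorem expo_nonneg (i : Fin (g.N + 1)) : 0 ≤ g.expo i := by
  rw [← g.expo_zero]
  exact g.expo_strictMono.monotone (Fin.zero_le i)

theorem continuous_eval : Continuous g.eval := by
  unfold eval
  refine continuous_finsetSum _ fun i _ => continuous_const.mul ?_
  exact Real.continuous_rpow_const (g.expo_nonneg i)

theorem monotoneOn_eval : MonotoneOn g.eval (Ici 0) := by
  intro s hs t _ hst
  refine Finset.sum_le_sum fun i _ => mul_le_mul_of_nonneg_left ?_ (g.coeff_pos i).le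
  exact Real.rpow_le_rpow hs hst (g.expo_nonneg i)

theorem coeff_zero_le_eval {s : ℝ} (hs : 0 ≤ s) : g.coeff 0 ≤ g.eval s := by
  have h := Finset.single_le_sum (f := fun i => g.coeff i * s ^ g.expo i)
    (fun i _ => mul_nonneg (g.coeff_pos i).le (Real.rpow_nonneg hs _)) (Finset.mem_univ 0)
  simpa [eval, g.expo_zero] using h

theorem eval_pos {s : ℝ} (hs : 0 ≤ s) : 0 < g.eval s :=
  (g.coeff_pos 0).trans_le (g.coeff_zero_le_eval hs)

/-- For every `ξ ≥ 0` the equation `s g(s) = ξ` has a unique non-negative solution `s`. -/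
theorem existsUnique_mul_eval (ξ : ℝ≥0) : ∃! s : ℝ, 0 ≤ s ∧ s * g.eval s = ξ := by
  have ha := g.coeff_pos 0
  have hcont : ContinuousOn (fun s => s * g.eval s) (Icc 0 ((ξ : ℝ) / g.coeff 0)) :=
    (continuous_id.mul g.continuous_eval).continuousOn
  have hb : 0 ≤ (ξ : ℝ) / g.coeff 0 := div_nonneg ξ.2 ha.le
  have hmem : (ξ : ℝ) ∈ Icc ((0 : ℝ) * g.eval 0)
      ((ξ : ℝ) / g.coeff 0 * g.eval ((ξ : ℝ) / g.coeff 0)) := by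
    refine ⟨by simp, ?_⟩
    calc (ξ : ℝ) = (ξ : ℝ) / g.coeff 0 * g.coeff 0 := by field_simp
      _ ≤ _ := mul_le_mul_of_nonneg_left (g.coeff_zero_le_eval hb) hb
  obtain ⟨s, hs, hsξ⟩ := intermediate_value_Icc hb hcont hmem
  have key : ∀ x y : ℝ, 0 ≤ x → x < y → x * g.eval x < y * g.eval y := by
    intro x y hx hxy
    have hy : 0 ≤ y := hx.trans hxy.le
    calc x * g.eval x ≤ x * g.eval y :=
          mul_le_mul_of_nonneg_left (g.monotoneOn_eval hx hy hxy.le) hx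
      _ < y * g.eval y := mul_lt_mul_of_pos_right hxy (g.eval_pos hy)
  refine ⟨s, ⟨hs.1, hsξ⟩, ?_⟩
  rintro t ⟨ht, htξ⟩
  have hsξ' : s * g.eval s = ξ := hsξ
  rcases lt_trichotomy t s with h | h | h
  · exact absurd (htξ.trans hsξ'.symm) (key t s ht h).ne
  · exact h
  · exact absurd (hsξ'.trans htξ.symm) (key s t hs.1 h).ne

/-- `s(ξ)`: the unique non-negative solution `s` of `s g(s) = ξ`. -/
noncomputable def root (ξ : ℝ≥0) : ℝ := (g.existsUnique_mul_eval ξ).choose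

theorem root_nonneg (ξ : ℝ≥0) : 0 ≤ g.root ξ :=
  (g.existsUnique_mul_eval ξ).choose_spec.1.1

theorem root_mul_eval (ξ : ℝ≥0) : g.root ξ * g.eval (g.root ξ) = ξ :=
  (g.existsUnique_mul_eval ξ).choose_spec.1.2

/-- The conductivity function `K(ξ) = 1 / g(s(ξ))`, `ξ ≥ 0`. -/
noncomputable def K (ξ : ℝ≥0) : ℝ := 1 / g.eval (g.root ξ)

/-- The exponent `a = α_N / (α_N + 1)`. -/
noncomputable def a : ℝ := g.expo (Fin.last g.N) / (g.expo (Fin.last g.N) + 1)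

end GenPoly

/-- `ℝⁿ` with the Euclidean norm. -/
abbrev Space (n : ℕ) : Type := EuclideanSpace ℝ (Fin n)

/-- The open space-time cylinder `U × (0, T)`. -/
def cylinder {n : ℕ} (U : Opens (Space n)) (T : ℝ) : Opens (Space n × ℝ) :=
  ⟨(U : Set (Space n)) ×ˢ Ioo 0 T, U.isOpen.prod isOpen_Ioo⟩

/-- The spatial gradient `∇φ(x, t)` of a function of `(x, t)`. -/
noncomputable def spaceGrad {n : ℕ} (φ : Space n × ℝ → ℝ) (z : Space n × ℝ) : Space n :=
  gradient (fun y => φ (y, z.2)) z.1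

/-- The time derivative `∂φ/∂t (x, t)` of a function of `(x, t)`. -/
noncomputable def timeDeriv {n : ℕ} (φ : Space n × ℝ → ℝ) (z : Space n × ℝ) : ℝ :=
  deriv (fun s => φ (z.1, s)) z.2

/-- `G` is the weak (distributional) spatial gradient of `u` on the open space-time set `Q`. -/
def IsWeakSpaceGrad {n : ℕ} (Q : Opens (Space n × ℝ)) (u : Space n × ℝ → ℝ)
    (G : Space n × ℝ → Space n) : Prop :=
  ∀ φ : 𝓓(Q, ℝ), ∫ z in (Q : Set (Space n × ℝ)), u z • spaceGrad φ z
    = -∫ z in (Q : Set (Space n × ℝ)), φ z • G z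

/-- `u` is a non-negative (local, distributional) weak solution of
`∂(u^lam)/∂t = ∇ · (K(|∇u|) ∇u)` in the open space-time set `Q`: it is non-negative a.e. and
locally integrable, has a weak spatial gradient with locally integrable `(2 - a)`-th power,
and satisfies the equation when tested with smooth functions of compact support in `Q`. -/
def IsWeakSolution {n : ℕ} (g : GenPoly) (lam : ℝ) (Q : Opens (Space n × ℝ))
    (u : Space n × ℝ → ℝ) : Prop :=
  (∀ᵐ z ∂volume.restrict (Q : Set (Space n × ℝ)), 0 ≤ u z) ∧
  LocallyIntegrableOn u (Q : Set (Space n × ℝ)) ∧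
  ∃ G : Space n × ℝ → Space n,
    LocallyIntegrableOn G (Q : Set (Space n × ℝ)) ∧
    LocallyIntegrableOn (fun z => ‖G z‖ ^ (2 - g.a)) (Q : Set (Space n × ℝ)) ∧
    IsWeakSpaceGrad Q u G ∧
    ∀ φ : 𝓓(Q, ℝ), ∫ z in (Q : Set (Space n × ℝ)), u z ^ lam * timeDeriv φ z
      = ∫ z in (Q : Set (Space n × ℝ)), g.K ‖G z‖₊ * inner ℝ (G z) (spaceGrad φ z)

/-- `α_* = n (a - δ) / (2 - a)`. -/
noncomputable def alphaStar (n : ℕ) (a δ : ℝ) : ℝ := n * (a - δ) / (2 - a)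

/-- `κ(α) = 1 + (2 - a) / n - (a - δ) / α`. -/
noncomputable def kappa (n : ℕ) (a δ α : ℝ) : ℝ := 1 + (2 - a) / n - (a - δ) / α

/-- The `j`-th factor `(α₀ κ_*^j - 2 + δ) / (α₀ κ_*^j)` of `μ`, where `κ_* = κ(α₀)`. -/
noncomputable def muFactor (n : ℕ) (a δ α₀ : ℝ) (j : ℕ) : ℝ :=
  (α₀ * kappa n a δ α₀ ^ j - 2 + δ) / (α₀ * kappa n a δ α₀ ^ j)

/-- The `j`-th factor `α₀ κ_*^j / (α₀ κ_*^j + δ - a)` of `ν`, where `κ_* = κ(α₀)`. -/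
noncomputable def nuFactor (n : ℕ) (a δ α₀ : ℝ) (j : ℕ) : ℝ :=
  α₀ * kappa n a δ α₀ ^ j / (α₀ * kappa n a δ α₀ ^ j + δ - a)

/-- The constant
`[2¹¹ c α₀^{6-a} (1 + R⁻¹)² (1 + |B_R| T)³ (1 + 1/(σT) + 1/R^{2-a})²]^ω`,
where `|B_R|` is the volume of a ball of radius `R` in `ℝⁿ`. -/
noncomputable def Chat (n : ℕ) (a c α₀ ω R T σ : ℝ) : ℝ :=
  (2 ^ 11 * c * α₀ ^ (6 - a) * (1 + R⁻¹) ^ 2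
    * (1 + volume.real (Metric.ball (0 : Space n) R) * T) ^ 3
    * (1 + 1 / (σ * T) + 1 / R ^ (2 - a)) ^ 2) ^ ω

end Forchheimer

namespace Forchheimer

open Filter Topology
open scoped Convolution

/-! ### Mollification and translation in `L^p`. -/

section Mollification

variable {V E : Type*} [NormedAddCommGroup V] [NormedSpace ℝ V] [FiniteDimensional ℝ V]
  [MeasurableSpace V] [BorelSpace V] {μ : Measure V} [μ.IsAddHaarMeasure]
  [NormedAddCommGroup E]

/-! Notation: `p = 2 - a`, `β = p / n`, `D = a - δ = lam - 1 + a`, `S = 2 - δ = 1 + lam`, `α = α₀`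
and `e = α β - D`. The condition `α₀ > α_*` says exactly that `e > 0`, and `κ_* = 1 + e / α`.
Although the infinite products come from a Moser iteration over growing exponents, the proof is a De
Giorgi iteration: the exponent `α` stays fixed while the level `l` in `{u > l}` rises from `k / 2`
to `k` and the cylinders shrink.

Energy inequality. Formally one tests the equation with `f(u) η`, where `f` is a truncated `s ^ γ`
and `γ = α - lam`. Since `u` has no time derivative, the test function is built from mollifications
of `u` and shifted in time; convexity of the primitive of `f` in the variable `u ^ lam` turns the
difference quotient into an inequality (`IsMeasurableWeakSolution.tested_inequality`). Coercivity of
the flux (`GenPoly.coercivity_pointwise`) then gives `energy_tested`. Localizing the final time and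
removing the regularization yields a bound for almost every time slice, `energy_sup`, and one for
the gradient, `energy_grad`. The error terms carry powers of `u` below `α`; above a positive level
they are controlled by `u ^ α` at the price of a negative power of the level. This is why everything
is done on super-level sets.

Gain. Sobolev's inequality in space combined with Hölder's against the slice bound raises the
integrability from `α` to `α + e` (`exists_gain_const`). As `u ^ e ≥ (k / 2) ^ e` above the level,
this becomes a recursion `A (j + 1) ≤ K * 128 ^ j * A j ^ (1 + β)` for the level integrals
(`exists_step_const`). A small initial value forces `A j → 0`, hence `u ≤ k` on the inner cylinder
(`exists_level_const`).

Choice of the level. With `y` the `L^α` norm, smallness means `C (Θ (1 + k ^ (-S))) ^ (1 + β) k ^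
(-e) y ^ (α β) ≤ 1`, with `Θ = 1 + 1 / (σ T) + 1 / R ^ p`. For `k ≥ 1` this asks for `k` of size `y
^ (α β / e)`, for `k ≤ 1` of size `y ^ (α β / (e + S (1 + β)))`. Comparing products with geometric
sums gives `ν ≥ 1 + (D / α) κ_* / (κ_* - 1)` and `μ (1 + (S / α) κ_* / (κ_* - 1)) ≤ 1`, so `ν` is at
least the first exponent and `μ` at most the second (`le_nu_exponent`, `mu_exponent_le`). Therefore
`max (y ^ μ) (y ^ ν)` dominates both powers and `k = Chat * max (y ^ μ) (y ^ ν)` is admissible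
(`level_condition`). All multiplicative constants go into the exponent `ω`, because the base of
`Chat` is at least `2`. -/

theorem lintegral_rpow_le_of_isProbabilityMeasure {α : Type*} [MeasurableSpace α]
    (ν : Measure α) [IsProbabilityMeasure ν] {p : ℝ} (hp : 1 ≤ p) {F : α → ℝ≥0∞}
    (hF : AEMeasurable F ν) : (∫⁻ x, F x ∂ν) ^ p ≤ ∫⁻ x, F x ^ p ∂ν := by
  have hp0 : 0 < p := by linarith
  have h := eLpNorm_le_eLpNorm_of_exponent_le (μ := ν) (f := F) (p := 1) (q := ENNReal.ofReal p)
    (by simpa using hp) hF.aestronglyMeasurable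
  rw [eLpNorm_one_eq_lintegral_enorm, eLpNorm_eq_lintegral_rpow_enorm_toReal
    (by simpa using hp0) (by simp), ENNReal.toReal_ofReal hp0.le] at h
  simp only [enorm_eq_self] at h
  calc (∫⁻ x, F x ∂ν) ^ p ≤ ((∫⁻ x, F x ^ p ∂ν) ^ (1 / p)) ^ p := by gcongr
    _ = ∫⁻ x, F x ^ p ∂ν := by
      rw [← ENNReal.rpow_mul, one_div_mul_cancel hp0.ne', ENNReal.rpow_one]

theorem eLpNorm_ofReal_rpow {α : Type*} [MeasurableSpace α] {ν : Measure α} {p : ℝ} (hp : 0 < p)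
    {F : Type*} [NormedAddCommGroup F] (f : α → F) :
    eLpNorm f (ENNReal.ofReal p) ν ^ p = ∫⁻ x, ‖f x‖ₑ ^ p ∂ν := by
  rw [eLpNorm_eq_lintegral_rpow_enorm_toReal (by simpa using hp) (by simp),
    ENNReal.toReal_ofReal hp.le, ← ENNReal.rpow_mul, one_div_mul_cancel hp.ne', ENNReal.rpow_one]

/-- This is strong continuity of the translation action on `L^p`, rewritten as an integral so that
it can be used with extended non-negative numbers. -/
theorem tendsto_lintegral_translate_sub {p : ℝ} (hp : 1 ≤ p) {W : V → E}
    (hW : MemLp W (ENNReal.ofReal p) μ) :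
    Tendsto (fun y : V => ∫⁻ z, ‖W (y + z) - W z‖ₑ ^ p ∂μ) (𝓝 0) (𝓝 0) := by
  have hp0 : 0 < p := by linarith
  have : Fact (1 ≤ ENNReal.ofReal p) := ⟨by simpa using hp⟩
  have : Fact (ENNReal.ofReal p ≠ ⊤) := ⟨by simp⟩
  have hc : Continuous fun y : V => DomAddAct.mk y +ᵥ hW.toLp W := by
    have h1 : Continuous fun y : V => DomAddAct.mk y := DomAddAct.continuous_mk
    exact h1.vadd continuous_const
  have h2 := (hc.tendsto 0).sub_const (hW.toLp W)
  have h0 : DomAddAct.mk (0 : V) +ᵥ hW.toLp W = hW.toLp W := by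
    rw [DomAddAct.mk_zero, zero_vadd]
  rw [h0, sub_self] at h2
  have h3 := h2.enorm
  rw [enorm_zero] at h3
  have h4 := h3.ennrpow_const p
  rw [ENNReal.zero_rpow_of_pos hp0] at h4
  refine h4.congr fun y => ?_
  rw [DomAddAct.mk_vadd_toLp, ← MemLp.toLp_sub, Lp.enorm_toLp, eLpNorm_ofReal_rpow hp0]
  rfl

variable [NormedSpace ℝ E]

/-- By Jensen for the probability density of the bump, the `L^p` error is at most the average of the
translation errors `‖W(· - y) - W‖ ^ p` over the support of the bump. That support shrinks to the
origin, where the translation error is small. -/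
theorem tendsto_lintegral_convolution_sub [CompleteSpace E] {p : ℝ} (hp : 1 ≤ p) {W : V → E}
    (hWm : StronglyMeasurable W) (hW : MemLp W (ENNReal.ofReal p) μ)
    {φ : ℕ → ContDiffBump (0 : V)} (hφ : Tendsto (fun i => (φ i).rOut) atTop (𝓝 0)) :
    Tendsto (fun i => ∫⁻ z, ‖((φ i).normed μ ⋆[ContinuousLinearMap.lsmul ℝ ℝ, μ] W) z - W z‖ₑ ^ p ∂μ) atTop
      (𝓝 0) := by
  have hp0 : 0 < p := by linarith
  have hloc : LocallyIntegrable W μ := hW.locallyIntegrable (by simpa using hp)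
  have key : ∀ i, ∫⁻ z, ‖((φ i).normed μ ⋆[ContinuousLinearMap.lsmul ℝ ℝ, μ] W) z - W z‖ₑ ^ p ∂μ ≤
      ∫⁻ y, (∫⁻ z, ‖W (-y + z) - W z‖ₑ ^ p ∂μ)
        ∂(μ.withDensity fun y => ENNReal.ofReal ((φ i).normed μ y)) := by
    intro i
    set ρ := (φ i).normed μ with hρ
    have hρc : Continuous ρ := (φ i).continuous_normed
    have hρ0 : ∀ y, 0 ≤ ρ y := (φ i).nonneg_normed
    have hρi : Integrable ρ μ := (φ i).integrable_normed
    set ν := μ.withDensity fun y => ENNReal.ofReal (ρ y) with hν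
    have : IsProbabilityMeasure ν := by
      refine ⟨?_⟩
      rw [hν, withDensity_apply _ MeasurableSet.univ, Measure.restrict_univ,
        ← ofReal_integral_eq_lintegral_ofReal hρi (Eventually.of_forall hρ0),
        (φ i).integral_normed, ENNReal.ofReal_one]
    have hmeas : StronglyMeasurable fun q : V × V => W (-q.1 + q.2) - W q.2 := by
      refine (hWm.comp_measurable ?_).sub (hWm.comp_measurable measurable_snd)
      exact (measurable_fst.neg).add measurable_snd
    have hpt : ∀ z, ‖(ρ ⋆[ContinuousLinearMap.lsmul ℝ ℝ, μ] W) z - W z‖ₑ ^ p ≤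
        ∫⁻ y, ‖W (-y + z) - W z‖ₑ ^ p ∂ν := by
      intro z
      have hex : Integrable (fun y => ρ y • W (z - y)) μ :=
        ((φ i).hasCompactSupport_normed.convolutionExists_left (ContinuousLinearMap.lsmul ℝ ℝ) hρc hloc z).integrable
      have h1 : (ρ ⋆[ContinuousLinearMap.lsmul ℝ ℝ, μ] W) z - W z = ∫ y, ρ y • (W (-y + z) - W z) ∂μ := by
        have h2 : ∫ y, ρ y • W z ∂μ = W z := (φ i).integral_normed_smul μ (W z)
        rw [convolution_def]
        conv_lhs => rw [← h2]
        rw [← integral_sub]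
        · congr 1; ext y
          rw [smul_sub, neg_add_eq_sub]; rfl
        · exact hex
        · exact hρi.smul_const _
      have hmz : AEMeasurable (fun y => ‖W (-y + z) - W z‖ₑ) ν := by
        have := (hmeas.comp_measurable (measurable_id.prodMk (measurable_const (a := z)))).enorm
        exact this.aemeasurable
      have h3 : ‖(ρ ⋆[ContinuousLinearMap.lsmul ℝ ℝ, μ] W) z - W z‖ₑ ≤ ∫⁻ y, ‖W (-y + z) - W z‖ₑ ∂ν := by
        rw [h1]
        refine (enorm_integral_le_lintegral_enorm _).trans (le_of_eq ?_)
        rw [hν, lintegral_withDensity_eq_lintegral_mul₀' (by fun_prop) hmz]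
        refine lintegral_congr fun y => ?_
        rw [enorm_smul, Pi.mul_apply, Real.enorm_of_nonneg (hρ0 y)]
      calc _ ≤ (∫⁻ y, ‖W (-y + z) - W z‖ₑ ∂ν) ^ p := by gcongr
        _ ≤ _ := lintegral_rpow_le_of_isProbabilityMeasure ν hp hmz
    calc _ ≤ ∫⁻ z, ∫⁻ y, ‖W (-y + z) - W z‖ₑ ^ p ∂ν ∂μ := lintegral_mono hpt
      _ = _ := by
        rw [lintegral_lintegral_swap]
        have := hmeas.enorm.pow_const p
        exact (this.comp measurable_swap).aemeasurable
  have hT := tendsto_lintegral_translate_sub hp hW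
  have hT' : Tendsto (fun y : V => ∫⁻ z, ‖W (-y + z) - W z‖ₑ ^ p ∂μ) (𝓝 0) (𝓝 0) := by
    have : Tendsto (fun y : V => -y) (𝓝 0) (𝓝 0) := by
      simpa using (continuous_neg (G := V)).tendsto 0
    exact hT.comp this
  rw [ENNReal.tendsto_nhds_zero] at hT' ⊢
  intro ε hε
  obtain ⟨r, hr, hball⟩ := Metric.eventually_nhds_iff_ball.1 (hT' ε hε)
  filter_upwards [hφ.eventually (gt_mem_nhds hr)] with i hi
  refine (key i).trans ?_
  have hρc : Continuous ((φ i).normed μ) := (φ i).continuous_normed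
  rw [lintegral_withDensity_eq_lintegral_mul₀' (by fun_prop)]
  · calc _ ≤ ∫⁻ y, ENNReal.ofReal ((φ i).normed μ y) * ε ∂μ := by
          refine lintegral_mono fun y => ?_
          by_cases hy : y ∈ Metric.ball (0 : V) r
          · exact mul_le_mul_right (hball y hy) _
          · have : (φ i).normed μ y = 0 := by
              rw [← Function.notMem_support, (φ i).support_normed_eq]
              exact fun h => hy (Metric.ball_subset_ball hi.le h)
            simp [this]
      _ = ε := by
        rw [lintegral_mul_const _ (by fun_prop),
          ← ofReal_integral_eq_lintegral_ofReal (φ i).integrable_normed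
            (Eventually.of_forall (φ i).nonneg_normed),
          (φ i).integral_normed, ENNReal.ofReal_one, one_mul]
  · have hmeas : StronglyMeasurable fun q : V × V => W (-q.1 + q.2) - W q.2 := by
      refine (hWm.comp_measurable ?_).sub (hWm.comp_measurable measurable_snd)
      exact (measurable_fst.neg).add measurable_snd
    have := hmeas.enorm.pow_const p
    exact (this.lintegral_prod_right').aemeasurable

end Mollification

instance isAddHaarMeasure_volume_spaceTime (n : ℕ) :
    (volume : Measure (Space n × ℝ)).IsAddHaarMeasure :=
  inferInstanceAs (((volume : Measure (Space n)).prod (volume : Measure ℝ)).IsAddHaarMeasure)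

/-! ### Calculus of spatial gradients and time derivatives -/

section SpaceGrad

variable {n : ℕ}

theorem spaceGrad_eq {φ : Space n × ℝ → ℝ} {z : Space n × ℝ} (hφ : DifferentiableAt ℝ φ z) :
    spaceGrad φ z = (InnerProductSpace.toDual ℝ (Space n)).symm
      ((fderiv ℝ φ z).comp (ContinuousLinearMap.inl ℝ (Space n) ℝ)) := by
  unfold spaceGrad gradient
  congr 1
  have h1 : HasFDerivAt (fun y : Space n => (y, z.2)) (ContinuousLinearMap.inl ℝ (Space n) ℝ)
      z.1 := hasFDerivAt_prodMk_left z.1 z.2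
  have h2 : HasFDerivAt φ (fderiv ℝ φ z) (z.1, z.2) := hφ.hasFDerivAt
  exact (h2.comp z.1 h1).fderiv

theorem inner_spaceGrad {φ : Space n × ℝ → ℝ} {z : Space n × ℝ} (hφ : DifferentiableAt ℝ φ z)
    (v : Space n) : inner ℝ (spaceGrad φ z) v = fderiv ℝ φ z (v, 0) := by
  rw [spaceGrad_eq hφ, InnerProductSpace.toDual_symm_apply]
  simp

theorem timeDeriv_eq {φ : Space n × ℝ → ℝ} {z : Space n × ℝ} (hφ : DifferentiableAt ℝ φ z) :
    timeDeriv φ z = fderiv ℝ φ z (0, 1) := by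
  unfold timeDeriv
  have h1 : HasDerivAt (fun s : ℝ => (z.1, s)) ((0 : Space n), (1 : ℝ)) z.2 :=
    (hasDerivAt_const z.2 z.1).prodMk (hasDerivAt_id z.2)
  have h2 : HasFDerivAt φ (fderiv ℝ φ z) (z.1, z.2) := hφ.hasFDerivAt
  exact (h2.comp_hasDerivAt z.2 h1).deriv

theorem continuous_spaceGrad {φ : Space n × ℝ → ℝ} (hφ : ContDiff ℝ 1 φ) :
    Continuous (spaceGrad φ) := by
  have h : spaceGrad φ = fun z => (InnerProductSpace.toDual ℝ (Space n)).symm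
      ((fderiv ℝ φ z).comp (ContinuousLinearMap.inl ℝ (Space n) ℝ)) :=
    funext fun z => spaceGrad_eq (hφ.differentiable one_ne_zero z)
  rw [h]
  refine (LinearIsometryEquiv.continuous _).comp ?_
  exact (hφ.continuous_fderiv one_ne_zero).clm_comp continuous_const

theorem continuous_timeDeriv {φ : Space n × ℝ → ℝ} (hφ : ContDiff ℝ 1 φ) :
    Continuous (timeDeriv φ) := by
  have h : timeDeriv φ = fun z => fderiv ℝ φ z (0, 1) :=
    funext fun z => timeDeriv_eq (hφ.differentiable one_ne_zero z)
  rw [h]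
  exact (hφ.continuous_fderiv one_ne_zero).clm_apply continuous_const

theorem spaceGrad_eq_zero {φ : Space n × ℝ → ℝ} (hφ : Differentiable ℝ φ) {z : Space n × ℝ}
    (hz : z ∉ tsupport φ) : spaceGrad φ z = 0 := by
  rw [spaceGrad_eq (hφ z), fderiv_of_notMem_tsupport ℝ hz]
  simp

theorem timeDeriv_eq_zero {φ : Space n × ℝ → ℝ} (hφ : Differentiable ℝ φ) {z : Space n × ℝ}
    (hz : z ∉ tsupport φ) : timeDeriv φ z = 0 := by
  rw [timeDeriv_eq (hφ z), fderiv_of_notMem_tsupport ℝ hz]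
  simp

theorem hasCompactSupport_spaceGrad {φ : Space n × ℝ → ℝ} (hφ : Differentiable ℝ φ)
    (hc : HasCompactSupport φ) : HasCompactSupport (spaceGrad φ) :=
  HasCompactSupport.intro hc.isCompact fun _ hz => spaceGrad_eq_zero hφ hz

theorem hasCompactSupport_timeDeriv {φ : Space n × ℝ → ℝ} (hφ : Differentiable ℝ φ)
    (hc : HasCompactSupport φ) : HasCompactSupport (timeDeriv φ) :=
  HasCompactSupport.intro hc.isCompact fun _ hz => timeDeriv_eq_zero hφ hz

theorem spaceGrad_comp_mul {f : ℝ → ℝ} {w η : Space n × ℝ → ℝ} {z : Space n × ℝ}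
    (hf : Differentiable ℝ f) (hw : DifferentiableAt ℝ w z) (hη : DifferentiableAt ℝ η z) :
    spaceGrad (fun z => f (w z) * η z) z =
      (deriv f (w z) * η z) • spaceGrad w z + f (w z) • spaceGrad η z := by
  have h1 : HasFDerivAt (fun z => f (w z)) (deriv f (w z) • fderiv ℝ w z) z :=
    (hf (w z)).hasDerivAt.comp_hasFDerivAt z hw.hasFDerivAt
  have h2 : HasFDerivAt (fun z => f (w z) * η z) _ z := h1.mul hη.hasFDerivAt
  refine ext_inner_right ℝ fun v => ?_
  rw [inner_spaceGrad h2.differentiableAt, inner_add_left, inner_smul_left, inner_smul_left,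
    inner_spaceGrad hw, inner_spaceGrad hη, h2.fderiv]
  simp
  ring

end SpaceGrad

/-! ### Smooth approximation of functions with a weak spatial gradient -/

section Approximation

variable {n : ℕ}

/-- The reflected kernel `t ↦ ρ (z - t)` is an admissible test function because the ball around `z`
lies in `K`. Reflection flips the sign of its gradient, which cancels the sign in the weak gradient
identity. Cutting `u` and `G` off to `K` makes the convolutions global without changing them at `z`.
-/
theorem spaceGrad_convolution {Q : Opens (Space n × ℝ)} {u : Space n × ℝ → ℝ}
    {G : Space n × ℝ → Space n}
    (hu : LocallyIntegrableOn u (Q : Set (Space n × ℝ)))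
    (hG : LocallyIntegrableOn G (Q : Set (Space n × ℝ)))
    (hgrad : IsWeakSpaceGrad Q u G) {K : Set (Space n × ℝ)} (hK : IsCompact K)
    (hKQ : K ⊆ (Q : Set (Space n × ℝ))) {ρ : Space n × ℝ → ℝ}
    (hρ : ContDiff ℝ ((⊤ : ℕ∞) : WithTop ℕ∞) ρ) {r : ℝ} (hsupp : tsupport ρ ⊆ Metric.closedBall 0 r)
    {z : Space n × ℝ} (hz : Metric.closedBall z r ⊆ K) :
    spaceGrad (ρ ⋆[ContinuousLinearMap.lsmul ℝ ℝ, volume] K.indicator u) z =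
      (ρ ⋆[ContinuousLinearMap.lsmul ℝ ℝ, volume] K.indicator G) z := by
  have hρ1 : ContDiff ℝ 1 ρ := hρ.of_le (by simp)
  have hρd : Differentiable ℝ ρ := hρ1.differentiable one_ne_zero
  have hρc : HasCompactSupport ρ :=
    HasCompactSupport.of_support_subset_isCompact (isCompact_closedBall 0 r)
      ((subset_tsupport _).trans hsupp)
  have huK : Integrable (K.indicator u) :=
    (hu.integrableOn_compact_subset hKQ hK).integrable_indicator hK.measurableSet
  have hGK : Integrable (K.indicator G) :=
    (hG.integrableOn_compact_subset hKQ hK).integrable_indicator hK.measurableSet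
  set ψ : Space n × ℝ → ℝ := fun t => ρ (z - t) with hψ
  have hψs : ContDiff ℝ ((⊤ : ℕ∞) : WithTop ℕ∞) ψ := hρ.comp (contDiff_const.sub contDiff_id)
  have hψd : Differentiable ℝ ψ := (hψs.of_le (m := 1) (by simp)).differentiable one_ne_zero
  have hψball : tsupport ψ ⊆ Metric.closedBall z r := by
    refine closure_minimal (fun t ht => ?_) Metric.isClosed_closedBall
    have h1 : z - t ∈ tsupport ρ := subset_tsupport _ ht
    have h2 := hsupp h1
    rw [mem_closedBall_zero_iff] at h2
    rw [mem_closedBall_iff_norm, norm_sub_rev]; exact h2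
  have hψc : HasCompactSupport ψ :=
    HasCompactSupport.of_support_subset_isCompact (isCompact_closedBall z r)
      ((subset_tsupport _).trans hψball)
  let φ : 𝓓(Q, ℝ) := ⟨ψ, hψs, hψc, hψball.trans (hz.trans hKQ)⟩
  have hfd : ∀ t, fderiv ℝ ψ t = -(fderiv ℝ ρ (z - t)) := by
    intro t
    have h1 : HasFDerivAt (fun t : Space n × ℝ => z - t)
        (-(ContinuousLinearMap.id ℝ (Space n × ℝ))) t := (hasFDerivAt_id t).const_sub z
    have h2 := ((hρd (z - t)).hasFDerivAt).comp t h1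
    rw [show ψ = ρ ∘ (fun t => z - t) from rfl, h2.fderiv]
    ext <;> simp
  have hweak := hgrad φ
  have hwd : HasFDerivAt (ρ ⋆[ContinuousLinearMap.lsmul ℝ ℝ, volume] K.indicator u) _ z :=
    hρc.hasFDerivAt_convolution_left (ContinuousLinearMap.lsmul ℝ ℝ) hρ1 huK.locallyIntegrable z
  have hzero : ∀ t ∉ K, ψ t = 0 ∧ spaceGrad ψ t = 0 := fun t ht =>
    ⟨image_eq_zero_of_notMem_tsupport fun h => ht (hz (hψball h)),
      spaceGrad_eq_zero hψd fun h => ht (hz (hψball h))⟩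
  have e1 : ∫ t in (Q : Set (Space n × ℝ)), u t • spaceGrad ψ t
      = ∫ t, K.indicator u t • spaceGrad ψ t := by
    rw [setIntegral_eq_integral_of_forall_compl_eq_zero]
    · congr 1; ext1 t
      by_cases ht : t ∈ K
      · rw [indicator_of_mem ht]
      · rw [(hzero t ht).2, smul_zero, smul_zero]
    · intro t ht
      rw [(hzero t fun h => ht (hKQ h)).2, smul_zero]
  have e2 : ∫ t in (Q : Set (Space n × ℝ)), ψ t • G t = ∫ t, ψ t • K.indicator G t := by
    rw [setIntegral_eq_integral_of_forall_compl_eq_zero]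
    · congr 1; ext1 t
      by_cases ht : t ∈ K
      · rw [indicator_of_mem ht]
      · rw [(hzero t ht).1, zero_smul, zero_smul]
    · intro t ht
      rw [(hzero t fun h => ht (hKQ h)).1, zero_smul]
  have hweak' : ∫ t, K.indicator u t • spaceGrad ψ t = -∫ t, ψ t • K.indicator G t := by
    rw [← e1, ← e2]; exact hweak
  have hconv : (ρ ⋆[ContinuousLinearMap.lsmul ℝ ℝ, volume] K.indicator G) z
      = ∫ t, ψ t • K.indicator G t := by
    rw [convolution_eq_swap]; rfl
  have hint : Integrable fun t => K.indicator u t • spaceGrad ψ t := by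
    have hsg : Continuous (spaceGrad ψ) := continuous_spaceGrad (hψs.of_le (by simp))
    have := huK.locallyIntegrable.integrable_smul_right_of_hasCompactSupport hsg
      (hasCompactSupport_spaceGrad hψd hψc)
    exact this
  refine ext_inner_right ℝ fun v => ?_
  rw [inner_spaceGrad hwd.differentiableAt, hconv, ← neg_neg (∫ t, ψ t • K.indicator G t),
    ← hweak', hwd.fderiv, inner_neg_left, real_inner_comm, ← integral_inner hint,
    convolution_eq_swap]
  have hint2 : Integrable fun t => ((ContinuousLinearMap.precompL (Space n × ℝ)
      (ContinuousLinearMap.lsmul ℝ ℝ : ℝ →L[ℝ] ℝ →L[ℝ] ℝ)) (fderiv ℝ ρ (z - t)))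
        (K.indicator u t) := by
    have := (HasCompactSupport.convolutionExists_left
      (ContinuousLinearMap.precompL (Space n × ℝ)
      (ContinuousLinearMap.lsmul ℝ ℝ : ℝ →L[ℝ] ℝ →L[ℝ] ℝ)) (hρc.fderiv ℝ)
      (hρ1.continuous_fderiv one_ne_zero) huK.locallyIntegrable z)
    exact this.integrable_swap
  rw [ContinuousLinearMap.integral_apply hint2, ← integral_neg]
  congr 1; ext1 t
  rw [inner_smul_right, real_inner_comm, inner_spaceGrad (hψd t), hfd]
  simp [ContinuousLinearMap.precompL_apply, mul_comm]

theorem exists_smooth_approx {Q : Opens (Space n × ℝ)} {u : Space n × ℝ → ℝ}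
    {G : Space n × ℝ → Space n} {p : ℝ} (hp : 1 ≤ p)
    (hu : LocallyIntegrableOn u (Q : Set (Space n × ℝ))) (hGm : Measurable G)
    (hG : LocallyIntegrableOn G (Q : Set (Space n × ℝ)))
    (hGp : LocallyIntegrableOn (fun z => ‖G z‖ ^ p) (Q : Set (Space n × ℝ)))
    (hgrad : IsWeakSpaceGrad Q u G) {K : Set (Space n × ℝ)} (hK : IsCompact K)
    (hKQ : K ⊆ (Q : Set (Space n × ℝ))) :
    ∃ w : ℕ → Space n × ℝ → ℝ, (∀ i, ContDiff ℝ ((⊤ : ℕ∞) : WithTop ℕ∞) (w i)) ∧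
      (∀ᵐ z ∂volume.restrict K, Tendsto (fun i => w i z) atTop (𝓝 (u z))) ∧
      Tendsto (fun i => ∫⁻ z in K, ‖spaceGrad (w i) z - G z‖ₑ ^ p) atTop (𝓝 0) := by
  have hp0 : 0 < p := by linarith
  obtain ⟨r, hr, hrQ⟩ := hK.exists_cthickening_subset_open Q.isOpen hKQ
  set K' := Metric.cthickening r K with hK'
  have hK'c : IsCompact K' := hK.cthickening
  -- Outer radii stay below the thickening radius `r`, so the convolutions only see points of `Q`.
  -- The fixed ratio of outer to inner radius is what the Lebesgue differentiation argument for
  -- almost everywhere convergence needs.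
  let φ : ℕ → ContDiffBump (0 : Space n × ℝ) := fun i =>
    ⟨r / (2 * (i + 2)), r / (i + 2), by positivity, by
      apply div_lt_div_of_pos_left hr (by positivity)
      have : (0 : ℝ) ≤ i := by positivity
      linarith⟩
  have hφr : ∀ i, (φ i).rOut ≤ r := fun i => by
    change r / ((i : ℝ) + 2) ≤ r
    apply div_le_self hr.le
    have : (0 : ℝ) ≤ i := by positivity
    linarith
  have hφ0 : Tendsto (fun i => (φ i).rOut) atTop (𝓝 0) := by
    change Tendsto (fun i : ℕ => r / ((i : ℝ) + 2)) atTop (𝓝 0)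
    exact tendsto_const_nhds.div_atTop
      (tendsto_atTop_add_const_right _ _ tendsto_natCast_atTop_atTop)
  have hφK : ∀ᶠ i in atTop, (φ i).rOut ≤ 2 * (φ i).rIn := Eventually.of_forall fun i => by
    change r / ((i : ℝ) + 2) ≤ 2 * (r / (2 * (i + 2)))
    rw [mul_div_assoc', mul_div_mul_left _ _ two_ne_zero]
  have huK : Integrable (K'.indicator u) :=
    (hu.integrableOn_compact_subset hrQ hK'c).integrable_indicator hK'c.measurableSet
  refine ⟨fun i => (φ i).normed volume ⋆[ContinuousLinearMap.lsmul ℝ ℝ, volume] K'.indicator u,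
    fun i => ?_, ?_, ?_⟩
  · exact (φ i).hasCompactSupport_normed.contDiff_convolution_left _ (φ i).contDiff_normed
      huK.locallyIntegrable
  · have h1 := ContDiffBump.ae_convolution_tendsto_right_of_locallyIntegrable
      (μ := (volume : Measure (Space n × ℝ))) hφ0 hφK huK.locallyIntegrable
    filter_upwards [ae_restrict_of_ae h1, ae_restrict_mem hK.measurableSet] with z hz hzK
    rwa [indicator_of_mem (Metric.self_subset_cthickening K hzK)] at hz
  · have hGi : StronglyMeasurable (K'.indicator G) :=
      hGm.stronglyMeasurable.indicator hK'c.measurableSet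
    have hmem : MemLp (K'.indicator G) (ENNReal.ofReal p) volume := by
      rw [memLp_indicator_iff_restrict hK'c.measurableSet]
      rw [← integrable_norm_rpow_iff hGm.aestronglyMeasurable (by simpa using hp0) (by simp),
        ENNReal.toReal_ofReal hp0.le]
      exact hGp.integrableOn_compact_subset hrQ hK'c
    have h1 := tendsto_lintegral_convolution_sub hp hGi hmem hφ0
    refine tendsto_of_tendsto_of_tendsto_of_le_of_le tendsto_const_nhds h1 (fun i => zero_le) ?_
    intro i
    refine le_trans (le_of_eq ?_) (setLIntegral_le_lintegral K _)
    refine setLIntegral_congr_fun hK.measurableSet fun z hz => ?_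
    have hball : Metric.closedBall z (φ i).rOut ⊆ K' :=
      (Metric.closedBall_subset_closedBall (hφr i)).trans
        (Metric.closedBall_subset_cthickening hz r)
    have hmemz : z ∈ K' := Metric.self_subset_cthickening K hz
    dsimp only
    rw [spaceGrad_convolution hu hG hgrad hK'c hrQ (φ i).contDiff_normed
      (φ i).tsupport_normed_eq.le hball, indicator_of_mem hmemz]

end Approximation

/-! ### Growth and coercivity of the conductivity -/

namespace GenPoly

variable (g : GenPoly)

theorem expo_last_pos : 0 < g.expo (Fin.last g.N) := by
  have h : (0 : Fin (g.N + 1)) < Fin.last g.N := by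
    rw [Fin.lt_def]; exact g.one_le_N
  have := g.expo_strictMono h
  rwa [g.expo_zero] at this

theorem a_pos : 0 < g.a := div_pos g.expo_last_pos (by linarith [g.expo_last_pos])

theorem a_lt_one : g.a < 1 := by
  unfold a
  rw [div_lt_one (by linarith [g.expo_last_pos])]
  linarith

theorem one_sub_a : 1 - g.a = (g.expo (Fin.last g.N) + 1)⁻¹ := by
  have := g.expo_last_pos
  unfold a
  field_simp
  ring

theorem coeff_last_mul_le_eval {s : ℝ} (hs : 0 ≤ s) :
    g.coeff (Fin.last g.N) * s ^ g.expo (Fin.last g.N) ≤ g.eval s :=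
  Finset.single_le_sum (f := fun i => g.coeff i * s ^ g.expo i)
    (fun i _ => mul_nonneg (g.coeff_pos i).le (Real.rpow_nonneg hs _))
    (Finset.mem_univ (Fin.last g.N))

theorem eval_le_of_one_le {s : ℝ} (hs : 1 ≤ s) :
    g.eval s ≤ (∑ i, g.coeff i) * s ^ g.expo (Fin.last g.N) := by
  rw [Finset.sum_mul]
  refine Finset.sum_le_sum fun i _ => mul_le_mul_of_nonneg_left ?_ (g.coeff_pos i).le
  exact Real.rpow_le_rpow_of_exponent_le hs (g.expo_strictMono.monotone (Fin.le_last i))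

theorem eval_one : g.eval 1 = ∑ i, g.coeff i := by simp [eval]

theorem sum_coeff_pos : 0 < ∑ i, g.coeff i := g.eval_one ▸ g.eval_pos zero_le_one

theorem K_pos (ξ : ℝ≥0) : 0 < g.K ξ := one_div_pos.2 (g.eval_pos (g.root_nonneg ξ))

theorem K_mul_self (ξ : ℝ≥0) : g.K ξ * ξ = g.root ξ := by
  have h := g.eval_pos (g.root_nonneg ξ)
  rw [← g.root_mul_eval ξ, K]
  field_simp

theorem root_monotone : Monotone g.root := by
  intro ξ ζ h
  by_contra! hlt
  have h1 : g.root ζ * g.eval (g.root ζ) < g.root ξ * g.eval (g.root ξ) :=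
    calc g.root ζ * g.eval (g.root ζ) ≤ g.root ζ * g.eval (g.root ξ) :=
          mul_le_mul_of_nonneg_left
            (g.monotoneOn_eval (g.root_nonneg ζ) (g.root_nonneg ξ) hlt.le) (g.root_nonneg ζ)
      _ < _ := mul_lt_mul_of_pos_right hlt (g.eval_pos (g.root_nonneg ξ))
  rw [g.root_mul_eval, g.root_mul_eval] at h1
  exact absurd h (not_le.2 (by exact_mod_cast h1))

theorem K_antitone : Antitone g.K := fun _ _ h =>
  one_div_le_one_div_of_le (g.eval_pos (g.root_nonneg _))
    (g.monotoneOn_eval (g.root_nonneg _) (g.root_nonneg _) (g.root_monotone h))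

theorem measurable_K : Measurable g.K := g.K_antitone.measurable

/-- `K(ξ) ξ` grows at most like `ξ ^ (1 - a)`. -/
theorem K_mul_le (ξ : ℝ≥0) :
    g.K ξ * ξ ≤ g.coeff (Fin.last g.N) ^ (-(1 - g.a)) * (ξ : ℝ) ^ (1 - g.a) := by
  rw [K_mul_self]
  have hs := g.root_nonneg ξ
  set s := g.root ξ
  have hc := g.coeff_pos (Fin.last g.N)
  have he := g.expo_last_pos
  have h1a : 0 < 1 - g.a := by linarith [g.a_lt_one]
  -- Keep only the top term of `s g(s) = ξ`, then take the power `1 - a = 1 / (α_N + 1)`; the flux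
  -- `K(ξ) ξ` is `s` itself.
  have h1 : g.coeff (Fin.last g.N) * s ^ (g.expo (Fin.last g.N) + 1) ≤ ξ := by
    rw [← g.root_mul_eval ξ, Real.rpow_add_one' hs (by linarith)]
    calc _ = s * (g.coeff (Fin.last g.N) * s ^ g.expo (Fin.last g.N)) := by ring
      _ ≤ _ := mul_le_mul_of_nonneg_left (g.coeff_last_mul_le_eval hs) hs
  have h2 := Real.rpow_le_rpow (by positivity) h1 h1a.le
  rw [Real.mul_rpow hc.le (by positivity), ← Real.rpow_mul hs, g.one_sub_a,
    mul_inv_cancel₀ (by linarith), Real.rpow_one, ← g.one_sub_a] at h2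
  calc s = g.coeff (Fin.last g.N) ^ (-(1 - g.a)) * (g.coeff (Fin.last g.N) ^ (1 - g.a) * s) := by
        rw [← mul_assoc, ← Real.rpow_add hc]; simp
    _ ≤ _ := by gcongr

/-- Coercivity: `K(ξ) ξ²` dominates a multiple of `ξ ^ (2 - a)` up to a constant. -/
theorem le_K_mul_sq (ξ : ℝ≥0) :
    (∑ i, g.coeff i) ^ (-(1 - g.a)) * (ξ : ℝ) ^ (2 - g.a) - ∑ i, g.coeff i
      ≤ g.K ξ * (ξ : ℝ) ^ 2 := by
  have hs := g.root_nonneg ξ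
  have hA := g.sum_coeff_pos
  have he := g.expo_last_pos
  have h1a : 0 < 1 - g.a := by linarith [g.a_lt_one]
  have hpos : 0 ≤ g.K ξ * (ξ : ℝ) ^ 2 := mul_nonneg (g.K_pos ξ).le (by positivity)
  -- For a root below `1`, `ξ` is at most `g(1)`, the sum of the coefficients, and the left-hand
  -- side is not positive. For a root at least `1`, the top power bounds every term of `g`.
  rcases lt_or_ge (g.root ξ) 1 with h | h
  · have hξ : (ξ : ℝ) ≤ ∑ i, g.coeff i := by
      rw [← g.root_mul_eval ξ, ← g.eval_one]
      calc _ ≤ 1 * g.eval 1 := mul_le_mul h.le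
            (g.monotoneOn_eval hs (by simp) h.le) (g.eval_pos hs).le zero_le_one
        _ = _ := one_mul _
    have h2 : (∑ i, g.coeff i) ^ (-(1 - g.a)) * (ξ : ℝ) ^ (2 - g.a) ≤ ∑ i, g.coeff i := by
      calc _ ≤ (∑ i, g.coeff i) ^ (-(1 - g.a)) * (∑ i, g.coeff i) ^ (2 - g.a) := by
            gcongr; linarith
        _ = _ := by rw [← Real.rpow_add hA]; ring_nf; exact Real.rpow_one _
    linarith
  · have hs0 : 0 < g.root ξ := by linarith
    have hE := g.eval_pos hs
    have hle := g.eval_le_of_one_le h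
    have hsq : g.K ξ * (ξ : ℝ) ^ 2 = g.root ξ * ξ := by rw [pow_two, ← mul_assoc, K_mul_self]
    have hξ0 : (0 : ℝ) < ξ := by rw [← g.root_mul_eval ξ]; positivity
    have h3 : (ξ : ℝ) ^ (1 - g.a) ≤ (∑ i, g.coeff i) ^ (1 - g.a) * g.root ξ := by
      have h4 : (ξ : ℝ) ≤ (∑ i, g.coeff i) * g.root ξ ^ (g.expo (Fin.last g.N) + 1) := by
        rw [Real.rpow_add_one' hs (by linarith)]
        calc (ξ : ℝ) = g.root ξ * g.eval (g.root ξ) := (g.root_mul_eval ξ).symm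
          _ ≤ g.root ξ * ((∑ i, g.coeff i) * g.root ξ ^ g.expo (Fin.last g.N)) := by gcongr
          _ = _ := by ring
      have h5 := Real.rpow_le_rpow hξ0.le h4 h1a.le
      rw [Real.mul_rpow hA.le (by positivity), ← Real.rpow_mul hs, g.one_sub_a,
        mul_inv_cancel₀ (by linarith), Real.rpow_one, ← g.one_sub_a] at h5
      exact h5
    have h6 : (∑ i, g.coeff i) ^ (-(1 - g.a)) * (ξ : ℝ) ^ (2 - g.a) ≤ g.root ξ * ξ := by
      calc _ = (∑ i, g.coeff i) ^ (-(1 - g.a)) * (ξ : ℝ) ^ (1 - g.a) * ξ := by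
            rw [show 2 - g.a = (1 - g.a) + 1 by ring, Real.rpow_add_one hξ0.ne']; ring
        _ ≤ (∑ i, g.coeff i) ^ (-(1 - g.a)) *
            ((∑ i, g.coeff i) ^ (1 - g.a) * g.root ξ) * ξ := by gcongr
        _ = _ := by rw [← mul_assoc, ← Real.rpow_add hA]; simp
    rw [hsq]
    linarith

end GenPoly

/-- The primitive `∫₀ˢ f(r) d(r^lam)`. -/
noncomputable def stieltjesPrimitive (f : ℝ → ℝ) (lam s : ℝ) : ℝ :=
  ∫ y in (0 : ℝ)..s ^ lam, f (y ^ (1 / lam))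

/-! ### The primitive attached to the time derivative of `u ^ lam` -/

section StieltjesPrimitive

variable {f : ℝ → ℝ} {lam : ℝ}

theorem continuous_comp_rpow (hf : Continuous f) (hlam : 0 < lam) :
    Continuous fun y : ℝ => f (y ^ (1 / lam)) :=
  hf.comp (Real.continuous_rpow_const (by positivity))

theorem continuous_stieltjesPrimitive (hf : Continuous f) (hlam : 0 < lam) :
    Continuous (stieltjesPrimitive f lam) := by
  have h1 : Continuous fun b : ℝ => ∫ y in (0 : ℝ)..b, f (y ^ (1 / lam)) :=
    intervalIntegral.continuous_primitive
      (fun a b => (continuous_comp_rpow hf hlam).intervalIntegrable a b) 0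
  exact h1.comp (Real.continuous_rpow_const hlam.le)

/-- As a function of `s ^ lam` the primitive has the non-decreasing derivative `f`, so it is convex
and lies above its tangent lines. This replaces the chain rule in time. -/
theorem sub_mul_le_stieltjesPrimitive_sub (hf : Continuous f) (hm : Monotone f) (hlam : 0 < lam)
    {s t : ℝ} (hs : 0 ≤ s) (ht : 0 ≤ t) :
    (s ^ lam - t ^ lam) * f t ≤ stieltjesPrimitive f lam s - stieltjesPrimitive f lam t := by
  have hc := continuous_comp_rpow hf hlam
  have hsub : stieltjesPrimitive f lam s - stieltjesPrimitive f lam t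
      = ∫ y in t ^ lam..s ^ lam, f (y ^ (1 / lam)) :=
    intervalIntegral.integral_interval_sub_left (hc.intervalIntegrable _ _)
      (hc.intervalIntegrable _ _)
  have ht' : f t = f ((t ^ lam) ^ (1 / lam)) := by
    rw [← Real.rpow_mul ht, mul_one_div_cancel hlam.ne', Real.rpow_one]
  have hconst : (s ^ lam - t ^ lam) * f t = ∫ _ in t ^ lam..s ^ lam, f t := by
    rw [intervalIntegral.integral_const, smul_eq_mul]
  have hlam' : 0 < 1 / lam := by positivity
  rw [hsub, hconst]
  rcases le_total (t ^ lam) (s ^ lam) with h | h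
  · refine intervalIntegral.integral_mono_on h intervalIntegrable_const
      (hc.intervalIntegrable _ _) fun y hy => ?_
    rw [ht']
    exact hm (Real.rpow_le_rpow (by positivity) hy.1 hlam'.le)
  · rw [intervalIntegral.integral_symm, intervalIntegral.integral_symm (s ^ lam)]
    refine neg_le_neg (intervalIntegral.integral_mono_on h
      (hc.intervalIntegrable _ _) intervalIntegrable_const fun y hy => ?_)
    rw [ht']
    exact hm (Real.rpow_le_rpow ((Real.rpow_nonneg hs _).trans hy.1) hy.2 hlam'.le)

theorem stieltjesPrimitive_zero (hlam : 0 < lam) : stieltjesPrimitive f lam 0 = 0 := by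
  simp [stieltjesPrimitive, Real.zero_rpow hlam.ne']

theorem stieltjesPrimitive_le (hf : Continuous f) (hm : Monotone f) (hlam : 0 < lam)
    {s : ℝ} (hs : 0 ≤ s) : stieltjesPrimitive f lam s ≤ s ^ lam * f s := by
  have h := sub_mul_le_stieltjesPrimitive_sub hf hm hlam le_rfl hs
  rw [stieltjesPrimitive_zero hlam, Real.zero_rpow hlam.ne'] at h
  linarith

theorem le_stieltjesPrimitive (hf : Continuous f) (hm : Monotone f) (hf0 : ∀ s, 0 ≤ f s)
    (hlam : 0 < lam) {s t : ℝ} (hs : 0 ≤ s) (ht : 0 ≤ t) :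
    (s ^ lam - t ^ lam) * f t ≤ stieltjesPrimitive f lam s := by
  have h := sub_mul_le_stieltjesPrimitive_sub hf hm hlam hs ht
  have h0 := sub_mul_le_stieltjesPrimitive_sub hf hm hlam ht le_rfl
  rw [stieltjesPrimitive_zero hlam, Real.zero_rpow hlam.ne'] at h0
  have : 0 ≤ (t ^ lam - 0) * f 0 := mul_nonneg (by simpa using Real.rpow_nonneg ht _) (hf0 0)
  linarith

theorem stieltjesPrimitive_nonneg (hf : Continuous f) (hm : Monotone f) (hf0 : ∀ s, 0 ≤ f s)
    (hlam : 0 < lam) {s : ℝ} (hs : 0 ≤ s) : 0 ≤ stieltjesPrimitive f lam s := by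
  have h := le_stieltjesPrimitive hf hm hf0 hlam hs hs
  simpa using h

end StieltjesPrimitive

/-! ### Passing to the limit in the chain rule -/

section ChainLimit

variable {n : ℕ}

/-- The error splits into `f'(w_i) η (∇w_i - G)`, small by convergence of the gradients, and a
remainder `R i` with differences of `f'` and `f` in front of the fixed functions `G` and `∇η`. The
remainder tends to zero almost everywhere and is dominated. -/
theorem tendsto_lintegral_spaceGrad_comp_mul {p : ℝ} (hp : 1 ≤ p) {K : Set (Space n × ℝ)}
    (hK : volume K ≠ ⊤) {u : Space n × ℝ → ℝ} {G : Space n × ℝ → Space n}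
    (hu : Measurable u) (hG : Measurable G) (hGp : ∫⁻ z in K, ‖G z‖ₑ ^ p ≠ ⊤)
    {w : ℕ → Space n × ℝ → ℝ} (hw : ∀ i, ContDiff ℝ 1 (w i))
    (hwu : ∀ᵐ z ∂volume.restrict K, Tendsto (fun i => w i z) atTop (𝓝 (u z)))
    (hwG : Tendsto (fun i => ∫⁻ z in K, ‖spaceGrad (w i) z - G z‖ₑ ^ p) atTop (𝓝 0))
    {f : ℝ → ℝ} (hf : ContDiff ℝ 1 f) {η : Space n × ℝ → ℝ} (hη : ContDiff ℝ 1 η)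
    {B : ℝ≥0} (hfB : ∀ s, ‖f s‖₊ ≤ B) (hfB' : ∀ s, ‖deriv f s‖₊ ≤ B) (hηB : ∀ z, ‖η z‖₊ ≤ B)
    (hηB' : ∀ z, ‖spaceGrad η z‖₊ ≤ B) :
    Tendsto (fun i => ∫⁻ z in K, ‖spaceGrad (fun z => f (w i z) * η z) z -
      ((deriv f (u z) * η z) • G z + f (u z) • spaceGrad η z)‖ₑ ^ p) atTop (𝓝 0) := by
  have hp0 : 0 < p := by linarith
  have hfd : Differentiable ℝ f := hf.differentiable one_ne_zero
  have hf'c : Continuous (deriv f) := hf.continuous_deriv le_rfl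
  have hgη := continuous_spaceGrad hη
  set R : ℕ → Space n × ℝ → Space n := fun i z =>
    ((deriv f (w i z) - deriv f (u z)) * η z) • G z + (f (w i z) - f (u z)) • spaceGrad η z with hR
  have hRm : ∀ i, Measurable (R i) := by
    intro i
    have h1 : Measurable fun z => deriv f (w i z) := (hf'c.comp (hw i).continuous).measurable
    have h2 : Measurable fun z => f (w i z) := (hf.continuous.comp (hw i).continuous).measurable
    have h3 : Measurable fun z => deriv f (u z) := hf'c.measurable.comp hu
    have h4 : Measurable fun z => f (u z) := hf.continuous.measurable.comp hu
    exact (((h1.sub h3).mul hη.continuous.measurable).smul hG).add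
      ((h2.sub h4).smul hgη.measurable)
  have hdom : ∀ i z, ‖R i z‖ₑ ^ p ≤ ((2 * B * B : ℝ≥0) * ‖G z‖ₑ + (2 * B * B : ℝ≥0)) ^ p := by
    intro i z
    gcongr
    refine (enorm_add_le _ _).trans ?_
    rw [enorm_smul, enorm_smul, enorm_mul]
    have e1 : ‖deriv f (w i z) - deriv f (u z)‖ₑ ≤ ((2 * B : ℝ≥0) : ℝ≥0∞) := by
      rw [enorm_eq_nnnorm, ENNReal.coe_le_coe, two_mul]
      exact (nnnorm_sub_le _ _).trans (add_le_add (hfB' _) (hfB' _))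
    have e2 : ‖f (w i z) - f (u z)‖ₑ ≤ ((2 * B : ℝ≥0) : ℝ≥0∞) := by
      rw [enorm_eq_nnnorm, ENNReal.coe_le_coe, two_mul]
      exact (nnnorm_sub_le _ _).trans (add_le_add (hfB _) (hfB _))
    have e3 : ‖η z‖ₑ ≤ (B : ℝ≥0∞) := by
      rw [enorm_eq_nnnorm, ENNReal.coe_le_coe]; exact hηB z
    have e4 : ‖spaceGrad η z‖ₑ ≤ (B : ℝ≥0∞) := by
      rw [enorm_eq_nnnorm, ENNReal.coe_le_coe]; exact hηB' z
    rw [ENNReal.coe_mul (2 * B)]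
    gcongr
  have hRlim : Tendsto (fun i => ∫⁻ z in K, ‖R i z‖ₑ ^ p) atTop (𝓝 0) := by
    have h0 : ∫⁻ _ in K, (0 : ℝ≥0∞) = 0 := by simp
    rw [← h0]
    refine tendsto_lintegral_of_dominated_convergence
      (fun z => ((2 * B * B : ℝ≥0) * ‖G z‖ₑ + (2 * B * B : ℝ≥0)) ^ p)
      (fun i => (hRm i).enorm.pow_const p) (fun i => Eventually.of_forall (hdom i)) ?_ ?_
    · have hle : ∫⁻ z in K, ((2 * B * B : ℝ≥0) * ‖G z‖ₑ + (2 * B * B : ℝ≥0)) ^ p ≤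
          ∫⁻ z in K, 2 ^ (p - 1) * (((2 * B * B : ℝ≥0) : ℝ≥0∞) ^ p * ‖G z‖ₑ ^ p +
            ((2 * B * B : ℝ≥0) : ℝ≥0∞) ^ p) := by
        refine lintegral_mono fun z => ?_
        refine (ENNReal.rpow_add_le_mul_rpow_add_rpow _ _ hp).trans (le_of_eq ?_)
        rw [ENNReal.mul_rpow_of_nonneg _ _ hp0.le]
      refine ne_top_of_le_ne_top ?_ hle
      have hm : Measurable fun z => ‖G z‖ₑ ^ p := hG.enorm.pow_const p
      rw [lintegral_const_mul _ (by fun_prop),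
        lintegral_add_right _ measurable_const, lintegral_const_mul _ hm, lintegral_const,
        Measure.restrict_apply_univ]
      finiteness
    · filter_upwards [hwu] with z hz
      have h1 : Tendsto (fun i => R i z) atTop (𝓝 (((deriv f (u z) - deriv f (u z)) * η z) • G z +
          (f (u z) - f (u z)) • spaceGrad η z)) := by
        have c1 := (hf'c.tendsto (u z)).comp hz
        have c2 := (hf.continuous.tendsto (u z)).comp hz
        exact (((c1.sub_const _).mul_const _).smul_const _).add ((c2.sub_const _).smul_const _)
      rw [sub_self, zero_mul, zero_smul, sub_self, zero_smul, add_zero] at h1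
      have h2 := h1.enorm.ennrpow_const p
      rwa [enorm_zero, ENNReal.zero_rpow_of_pos hp0] at h2
  have hbound : ∀ i, ∫⁻ z in K, ‖spaceGrad (fun z => f (w i z) * η z) z -
      ((deriv f (u z) * η z) • G z + f (u z) • spaceGrad η z)‖ₑ ^ p ≤
      2 ^ (p - 1) * (((B * B : ℝ≥0) : ℝ≥0∞) ^ p * ∫⁻ z in K, ‖spaceGrad (w i) z - G z‖ₑ ^ p) +
        2 ^ (p - 1) * ∫⁻ z in K, ‖R i z‖ₑ ^ p := by
    intro i
    have hm1 : Measurable fun z => ‖spaceGrad (w i) z - G z‖ₑ ^ p :=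
      ((continuous_spaceGrad (hw i)).measurable.sub hG).enorm.pow_const p
    have hm2 : Measurable fun z => ‖R i z‖ₑ ^ p := (hRm i).enorm.pow_const p
    rw [← lintegral_const_mul _ hm1, ← lintegral_const_mul _ (hm1.const_mul _),
      ← lintegral_const_mul _ hm2, ← lintegral_add_right _ (hm2.const_mul _)]
    refine lintegral_mono fun z => ?_
    have hsplit : spaceGrad (fun z => f (w i z) * η z) z -
        ((deriv f (u z) * η z) • G z + f (u z) • spaceGrad η z) =
        (deriv f (w i z) * η z) • (spaceGrad (w i) z - G z) + R i z := by
      rw [spaceGrad_comp_mul hfd ((hw i).differentiable one_ne_zero z)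
        (hη.differentiable one_ne_zero z), hR]
      module
    dsimp only
    rw [hsplit, ← mul_add]
    refine (ENNReal.rpow_le_rpow (enorm_add_le _ _) hp0.le).trans ?_
    refine (ENNReal.rpow_add_le_mul_rpow_add_rpow _ _ hp).trans ?_
    gcongr
    rw [enorm_smul, ENNReal.mul_rpow_of_nonneg _ _ hp0.le, enorm_mul, ENNReal.coe_mul]
    gcongr
    · rw [enorm_eq_nnnorm, ENNReal.coe_le_coe]; exact hfB' _
    · rw [enorm_eq_nnnorm, ENNReal.coe_le_coe]; exact hηB z
  refine tendsto_of_tendsto_of_tendsto_of_le_of_le tendsto_const_nhds ?_ (fun i => zero_le) hbound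
  have c1 := ENNReal.Tendsto.const_mul (a := ((B * B : ℝ≥0) : ℝ≥0∞) ^ p) hwG
    (Or.inr (by finiteness))
  have c2 := ENNReal.Tendsto.const_mul (a := (2 : ℝ≥0∞) ^ (p - 1)) c1 (Or.inr (by finiteness))
  have c3 := ENNReal.Tendsto.const_mul (a := (2 : ℝ≥0∞) ^ (p - 1)) hRlim (Or.inr (by finiteness))
  have c4 := c2.add c3
  simpa using c4

end ChainLimit

/-- A weak solution `u` together with its weak spatial gradient `G`, where `u` is everywhere
non-negative and both functions are Borel measurable. -/
structure IsMeasurableWeakSolution {n : ℕ} (g : GenPoly) (lam : ℝ) (Q : Opens (Space n × ℝ))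
    (u : Space n × ℝ → ℝ) (G : Space n × ℝ → Space n) : Prop where
  measurable : Measurable u
  nonneg : ∀ z, 0 ≤ u z
  locallyIntegrableOn : LocallyIntegrableOn u (Q : Set (Space n × ℝ))
  measurable_grad : Measurable G
  locallyIntegrableOn_grad : LocallyIntegrableOn G (Q : Set (Space n × ℝ))
  locallyIntegrableOn_rpow : LocallyIntegrableOn (fun z => ‖G z‖ ^ (2 - g.a))
    (Q : Set (Space n × ℝ))
  isWeakSpaceGrad : IsWeakSpaceGrad Q u G
  equation : ∀ φ : 𝓓(Q, ℝ), ∫ z in (Q : Set (Space n × ℝ)), u z ^ lam * timeDeriv φ z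
      = ∫ z in (Q : Set (Space n × ℝ)), g.K ‖G z‖₊ * inner ℝ (G z) (spaceGrad φ z)

/-! ### Time shifts and the duality pairing with the flux -/

section Translation

variable {n : ℕ}

theorem timeDeriv_translate {φ : Space n × ℝ → ℝ} (s : ℝ) (z : Space n × ℝ) :
    timeDeriv (fun z => φ (z + (0, s))) z = timeDeriv φ (z + (0, s)) := by
  unfold timeDeriv
  have h : (fun r : ℝ => φ ((z.1, r) + (0, s))) = fun r => (fun r => φ (z.1, r)) (r + s) := by
    ext r; simp
  rw [h, deriv_comp_add_const (fun r => φ (z.1, r))]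
  simp

theorem spaceGrad_translate {φ : Space n × ℝ → ℝ} (s : ℝ) (z : Space n × ℝ) :
    spaceGrad (fun z => φ (z + (0, s))) z = spaceGrad φ (z + (0, s)) := by
  unfold spaceGrad
  simp

/-- The shift sits on the smooth factor, so `m` need only be integrable: its lack of time regularity
does not matter. -/
theorem hasDerivAt_integral_mul_translate {m η : Space n × ℝ → ℝ} (hm : Integrable m)
    (hη : ContDiff ℝ 1 η) (hηc : HasCompactSupport η) (s : ℝ) :
    HasDerivAt (fun s => ∫ z, m z * η (z + (0, s))) (∫ z, m z * timeDeriv η (z + (0, s))) s := by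
  have hηd := hη.differentiable one_ne_zero
  obtain ⟨C, hC⟩ := (continuous_timeDeriv hη).bounded_above_of_compact_support
    (hasCompactSupport_timeDeriv hηd hηc)
  obtain ⟨C', hC'⟩ := hη.continuous.bounded_above_of_compact_support hηc
  have htr : ∀ s : ℝ, Continuous fun z : Space n × ℝ => z + (0, s) := fun s => by fun_prop
  refine (hasDerivAt_integral_of_dominated_loc_of_deriv_le (s := univ)
    (F := fun s z => m z * η (z + (0, s)))
    (F' := fun s z => m z * timeDeriv η (z + (0, s))) (bound := fun z => ‖m z‖ * C)
    univ_mem ?_ ?_ ?_ ?_ ?_ ?_).2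
  · exact Eventually.of_forall fun s =>
      hm.aestronglyMeasurable.mul (hη.continuous.comp (htr s)).aestronglyMeasurable
  · exact hm.mul_bdd (c := C') (hη.continuous.comp (htr s)).aestronglyMeasurable
      (Eventually.of_forall fun z => hC' _)
  · exact hm.aestronglyMeasurable.mul
      ((continuous_timeDeriv hη).comp (htr s)).aestronglyMeasurable
  · refine Eventually.of_forall fun z r _ => ?_
    rw [norm_mul]
    exact mul_le_mul_of_nonneg_left (hC _) (norm_nonneg _)
  · exact hm.norm.mul_const C
  · refine Eventually.of_forall fun z r _ => ?_
    have h1 : HasDerivAt (fun r : ℝ => z + ((0 : Space n), r)) ((0 : Space n), (1 : ℝ)) r :=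
      ((hasDerivAt_const r (0 : Space n)).prodMk (hasDerivAt_id r)).const_add z
    have h2 := (hηd (z + (0, r))).hasFDerivAt.comp_hasDerivAt r h1
    rw [timeDeriv_eq (hηd _)]
    exact h2.const_mul (m z)

theorem integral_mul_translate (m η : Space n × ℝ → ℝ) (h : ℝ) :
    ∫ z, m z * η (z + (0, h)) = ∫ z, m (z - (0, h)) * η z := by
  rw [← integral_add_right_eq_self (fun z => m (z - (0, h)) * η z) ((0 : Space n), h)]
  simp

end Translation

section Pairing

variable {α E : Type*} [MeasurableSpace α] {μ : Measure α} [NormedAddCommGroup E]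
  [InnerProductSpace ℝ E]

theorem lintegral_enorm_inner_le {p q : ℝ} (hpq : p.HolderConjugate q) {F V : α → E}
    (hF : AEStronglyMeasurable F μ) (hV : AEStronglyMeasurable V μ) :
    ∫⁻ z, ‖(inner ℝ (F z) (V z) : ℝ)‖ₑ ∂μ ≤
      (∫⁻ z, ‖F z‖ₑ ^ q ∂μ) ^ (1 / q) * (∫⁻ z, ‖V z‖ₑ ^ p ∂μ) ^ (1 / p) := by
  refine le_trans (lintegral_mono fun z => ?_)
    (ENNReal.lintegral_mul_le_Lp_mul_Lq μ hpq.symm hF.enorm hV.enorm)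
  rw [Pi.mul_apply, ← ofReal_norm, ← ofReal_norm, ← ofReal_norm,
    ← ENNReal.ofReal_mul (norm_nonneg _)]
  exact ENNReal.ofReal_le_ofReal (norm_inner_le_norm _ _)

theorem integrable_inner_of_lintegral_rpow {p q : ℝ} (hpq : p.HolderConjugate q) {F V : α → E}
    (hF : AEStronglyMeasurable F μ) (hV : AEStronglyMeasurable V μ)
    (hFq : ∫⁻ z, ‖F z‖ₑ ^ q ∂μ ≠ ⊤) (hVp : ∫⁻ z, ‖V z‖ₑ ^ p ∂μ ≠ ⊤) :
    Integrable (fun z => (inner ℝ (F z) (V z) : ℝ)) μ := by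
  refine ⟨hF.inner hV, ?_⟩
  refine (lintegral_enorm_inner_le hpq hF hV).trans_lt ?_
  have h1 : 0 ≤ 1 / q := one_div_nonneg.2 hpq.symm.nonneg
  have h2 : 0 ≤ 1 / p := one_div_nonneg.2 hpq.nonneg
  exact ENNReal.mul_lt_top (ENNReal.rpow_lt_top_of_nonneg h1 hFq)
    (ENNReal.rpow_lt_top_of_nonneg h2 hVp)

end Pairing

theorem GenPoly.holderConjugate (g : GenPoly) :
    (2 - g.a).HolderConjugate ((2 - g.a) / (1 - g.a)) := by
  have h1 := g.a_lt_one
  have h := Real.HolderConjugate.conjExponent (p := 2 - g.a) (by linarith)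
  rw [Real.conjExponent] at h
  convert h using 2
  ring

/-- The flux grows like `‖x‖ ^ (1 - a)`, and `(1 - a)` times the conjugate exponent of `2 - a` is `2
- a`: the flux lies in the dual space of the gradients. -/
theorem GenPoly.enorm_flux_rpow_le (g : GenPoly) {E : Type*} [NormedAddCommGroup E]
    [NormedSpace ℝ E] (x : E) :
    ‖g.K ‖x‖₊ • x‖ₑ ^ ((2 - g.a) / (1 - g.a)) ≤
      ENNReal.ofReal (g.coeff (Fin.last g.N) ^ (-(1 - g.a))) ^ ((2 - g.a) / (1 - g.a)) *
        ‖x‖ₑ ^ (2 - g.a) := by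
  have h1 : 0 < 1 - g.a := by linarith [g.a_lt_one]
  have hq : 0 ≤ (2 - g.a) / (1 - g.a) := by apply div_nonneg <;> linarith
  have h2 : ‖g.K ‖x‖₊ • x‖ₑ ≤
      ENNReal.ofReal (g.coeff (Fin.last g.N) ^ (-(1 - g.a))) * ‖x‖ₑ ^ (1 - g.a) := by
    rw [← ofReal_norm, ← ofReal_norm x, ENNReal.ofReal_rpow_of_nonneg (norm_nonneg _) h1.le,
      ← ENNReal.ofReal_mul (Real.rpow_nonneg (g.coeff_pos _).le _), norm_smul,
      Real.norm_of_nonneg (g.K_pos _).le]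
    exact ENNReal.ofReal_le_ofReal (g.K_mul_le ‖x‖₊)
  calc _ ≤ (ENNReal.ofReal (g.coeff (Fin.last g.N) ^ (-(1 - g.a))) * ‖x‖ₑ ^ (1 - g.a)) ^
        ((2 - g.a) / (1 - g.a)) := by gcongr
    _ = _ := by
      rw [ENNReal.mul_rpow_of_nonneg _ _ hq, ← ENNReal.rpow_mul, mul_div_cancel₀ _ h1.ne']

/-! ### Testing the weak equation with functions of the solution -/

section TestedInequality

variable {n : ℕ} {g : GenPoly} {lam : ℝ} {Q : Opens (Space n × ℝ)} {u : Space n × ℝ → ℝ}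
  {G : Space n × ℝ → Space n}

theorem IsMeasurableWeakSolution.lintegral_grad_rpow_ne_top
    (h : IsMeasurableWeakSolution g lam Q u G) {K : Set (Space n × ℝ)} (hK : IsCompact K)
    (hKQ : K ⊆ (Q : Set (Space n × ℝ))) : ∫⁻ z in K, ‖G z‖ₑ ^ (2 - g.a) ≠ ⊤ := by
  have h1 := (h.locallyIntegrableOn_rpow.integrableOn_compact_subset hKQ hK).2
  have h2 : ∫⁻ z in K, ‖G z‖ₑ ^ (2 - g.a) = ∫⁻ z in K, ‖‖G z‖ ^ (2 - g.a)‖ₑ := by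
    refine lintegral_congr fun z => ?_
    rw [Real.enorm_rpow_of_nonneg (norm_nonneg _) (by linarith [g.a_lt_one]), enorm_norm]
  rw [h2]
  exact h1.ne

theorem IsMeasurableWeakSolution.integrableOn_rpow
    (h : IsMeasurableWeakSolution g lam Q u G) (hlam : lam ∈ Ioc (0 : ℝ) 1)
    {K : Set (Space n × ℝ)} (hK : IsCompact K) (hKQ : K ⊆ (Q : Set (Space n × ℝ))) :
    IntegrableOn (fun z => u z ^ lam) K := by
  have h1 := h.locallyIntegrableOn.integrableOn_compact_subset hKQ hK
  have h2 : IntegrableOn (fun z => 1 + u z) K :=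
    (integrableOn_const hK.measure_lt_top.ne).add h1
  refine h2.mono' (h.measurable.pow_const lam).aestronglyMeasurable
    (Eventually.of_forall fun z => ?_)
  have hu := h.nonneg z
  rw [Real.norm_of_nonneg (Real.rpow_nonneg hu _)]
  rcases le_total (u z) 1 with h3 | h3
  · linarith [Real.rpow_le_one hu h3 hlam.1.le]
  · have := Real.rpow_le_rpow_of_exponent_le h3 hlam.2
    rw [Real.rpow_one] at this
    linarith

/-- The weak equation tested against `f(u) η` with `f` smooth, bounded and non-decreasing. -/
theorem IsMeasurableWeakSolution.tested_inequality (h : IsMeasurableWeakSolution g lam Q u G)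
    (hlam : lam ∈ Ioc (0 : ℝ) 1) {f : ℝ → ℝ} (hf : ContDiff ℝ ((⊤ : ℕ∞) : WithTop ℕ∞) f)
    (hm : Monotone f) (hf0 : ∀ s, 0 ≤ f s) {B : ℝ≥0} (hfB : ∀ s, ‖f s‖₊ ≤ B)
    (hfB' : ∀ s, ‖deriv f s‖₊ ≤ B) {η : Space n × ℝ → ℝ}
    (hη : ContDiff ℝ ((⊤ : ℕ∞) : WithTop ℕ∞) η)
    (hηc : HasCompactSupport η) (hηQ : tsupport η ⊆ (Q : Set (Space n × ℝ)))
    (hη0 : ∀ z, 0 ≤ η z) :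
    ∫ z, g.K ‖G z‖₊ * inner ℝ (G z) ((deriv f (u z) * η z) • G z + f (u z) • spaceGrad η z) ≤
      ∫ z, stieltjesPrimitive f lam (u z) * timeDeriv η z := by
  have hp1 : 1 ≤ 2 - g.a := by linarith [g.a_lt_one]
  have hp0 : 0 < 2 - g.a := by linarith
  have hpq := g.holderConjugate
  set p := 2 - g.a with hp
  set q := p / (1 - g.a) with hq
  have hη1 : ContDiff ℝ 1 η := hη.of_le (by simp)
  have hf1 : ContDiff ℝ 1 f := hf.of_le (by simp)
  have hηd := hη1.differentiable one_ne_zero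
  -- The thickening leaves room for time shifts up to `h0`: shifted test functions remain supported
  -- in a compact subset of `Q`.
  obtain ⟨h0, hh0, hK1Q⟩ := hηc.isCompact.exists_cthickening_subset_open Q.isOpen hηQ
  set K1 := Metric.cthickening h0 (tsupport η) with hK1
  have hK1c : IsCompact K1 := hηc.isCompact.cthickening
  have hK01 : tsupport η ⊆ K1 := Metric.self_subset_cthickening _
  have hnorm : ∀ s : ℝ, ‖((0 : Space n), s)‖ = |s| := fun s => by simp
  have hshift : ∀ z : Space n × ℝ, ∀ s : ℝ, |s| ≤ h0 → z + (0, s) ∈ tsupport η → z ∈ K1 := by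
    intro z s hs hz
    refine Metric.closedBall_subset_cthickening hz h0 ?_
    rw [mem_closedBall_iff_norm]
    simpa [hnorm] using hs
  have hshift' : ∀ z : Space n × ℝ, ∀ s : ℝ, |s| ≤ h0 → z ∈ tsupport η → z - (0, s) ∈ K1 :=
    fun z s hs hz => hshift _ s hs (by simpa using hz)
  obtain ⟨w, hws, hwu, hwG⟩ := exists_smooth_approx hp1 h.locallyIntegrableOn
    h.measurable_grad h.locallyIntegrableOn_grad h.locallyIntegrableOn_rpow h.isWeakSpaceGrad
    hK1c hK1Q
  have hw1 : ∀ i, ContDiff ℝ 1 (w i) := fun i => (hws i).of_le (by simp)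
  obtain ⟨C1, hC1⟩ := hη1.continuous.bounded_above_of_compact_support hηc
  obtain ⟨C2, hC2⟩ := (continuous_spaceGrad hη1).bounded_above_of_compact_support
    (hasCompactSupport_spaceGrad hηd hηc)
  have hGtop := h.lintegral_grad_rpow_ne_top hK1c hK1Q
  set φ : ℕ → Space n × ℝ → ℝ := fun i z => f (w i z) * η z with hφ
  set W : Space n × ℝ → Space n := fun z =>
    (deriv f (u z) * η z) • G z + f (u z) • spaceGrad η z with hW
  have hφs : ∀ i, ContDiff ℝ ((⊤ : ℕ∞) : WithTop ℕ∞) (φ i) := fun i =>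
    (hf.comp (hws i)).mul hη
  have hφ1 : ∀ i, ContDiff ℝ 1 (φ i) := fun i => (hφs i).of_le (by simp)
  have hφd : ∀ i, Differentiable ℝ (φ i) := fun i => (hφ1 i).differentiable one_ne_zero
  have hφt : ∀ i, tsupport (φ i) ⊆ tsupport η := fun i => tsupport_mul_subset_right
  have hφc : ∀ i, HasCompactSupport (φ i) := fun i => hηc.mul_left
  have hVoff : ∀ i, ∀ z ∉ K1, spaceGrad (φ i) z = 0 := fun i z hz =>
    spaceGrad_eq_zero (hφd i) fun hz' => hz (hK01 (hφt i hz'))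
  have hWoff : ∀ z ∉ K1, W z = 0 := by
    intro z hz
    have hz' : z ∉ tsupport η := fun h' => hz (hK01 h')
    rw [hW]; dsimp only
    rw [image_eq_zero_of_notMem_tsupport hz', spaceGrad_eq_zero hηd hz']
    simp
  have hWm : Measurable W :=
    (((hf1.continuous_deriv le_rfl).measurable.comp h.measurable).mul
      hη1.continuous.measurable |>.smul h.measurable_grad).add
      ((hf1.continuous.measurable.comp h.measurable).smul (continuous_spaceGrad hη1).measurable)
  have hE : Tendsto (fun i => ∫⁻ z, ‖spaceGrad (φ i) z - W z‖ₑ ^ p) atTop (𝓝 0) := by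
    have := tendsto_lintegral_spaceGrad_comp_mul hp1 hK1c.measure_lt_top.ne h.measurable
      h.measurable_grad hGtop hw1 hwu hwG hf1 hη1
      (B := max B (max C1.toNNReal C2.toNNReal))
      (fun s => (hfB s).trans (le_max_left _ _)) (fun s => (hfB' s).trans (le_max_left _ _))
      (fun z => ((NNReal.le_toNNReal_of_coe_le (hC1 z)).trans (le_max_left _ _)).trans
        (le_max_right _ _))
      (fun z => ((NNReal.le_toNNReal_of_coe_le (hC2 z)).trans (le_max_right _ _)).trans
        (le_max_right _ _))
    refine this.congr fun i => ?_
    refine setLIntegral_eq_of_support_subset ?_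
    intro z hz
    by_contra hzK
    refine hz ?_
    change ‖spaceGrad (φ i) z - W z‖ₑ ^ p = 0
    rw [hVoff i z hzK, hWoff z hzK, sub_zero, enorm_zero, ENNReal.zero_rpow_of_pos hp0]
  have hVp : ∀ i, ∫⁻ z, ‖spaceGrad (φ i) z‖ₑ ^ p ≠ ⊤ := by
    intro i
    have := ((continuous_spaceGrad (hφ1 i)).memLp_of_hasCompactSupport
      (p := ENNReal.ofReal p) (μ := volume)
      (hasCompactSupport_spaceGrad (hφd i) (hφc i))).eLpNorm_lt_top
    rw [← eLpNorm_ofReal_rpow hp0]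
    exact ENNReal.rpow_ne_top_of_nonneg hp0.le this.ne
  have htri : ∀ X Y : Space n × ℝ → Space n, Measurable Y →
      ∫⁻ z, ‖X z + Y z‖ₑ ^ p ≤ 2 ^ (p - 1) * ((∫⁻ z, ‖X z‖ₑ ^ p) + ∫⁻ z, ‖Y z‖ₑ ^ p) := by
    intro X Y hY
    rw [← lintegral_add_right _ (hY.enorm.pow_const p), ← lintegral_const_mul' _ _ (by finiteness)]
    exact lintegral_mono fun z => (ENNReal.rpow_le_rpow (enorm_add_le _ _) hp0.le).trans
      (ENNReal.rpow_add_le_mul_rpow_add_rpow _ _ hp1)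
  -- `W` is at finite `L^p` distance from the gradient of one smooth compactly supported
  -- approximation.
  have hWp : ∫⁻ z, ‖W z‖ₑ ^ p ≠ ⊤ := by
    obtain ⟨i, hi⟩ := (hE.eventually (gt_mem_nhds ENNReal.zero_lt_top)).exists
    have h1 := htri (fun z => W z - spaceGrad (φ i) z) (fun z => spaceGrad (φ i) z)
      (continuous_spaceGrad (hφ1 i)).measurable
    simp only [sub_add_cancel] at h1
    refine ne_top_of_le_ne_top ?_ h1
    have h2 : ∫⁻ z, ‖W z - spaceGrad (φ i) z‖ₑ ^ p ≠ ⊤ := by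
      simp_rw [enorm_sub_rev (W _)]
      exact hi.ne
    have h3 := hVp i
    finiteness
  have hWmem : MemLp W (ENNReal.ofReal p) volume := by
    refine ⟨hWm.aestronglyMeasurable, ?_⟩
    rw [← ENNReal.rpow_lt_top_iff_of_pos hp0, eLpNorm_ofReal_rpow hp0]
    exact hWp.lt_top
  have hω := tendsto_lintegral_translate_sub hp1 hWmem
  set F1 : Space n × ℝ → Space n := K1.indicator fun z => g.K ‖G z‖₊ • G z with hF1
  have hF1m : Measurable F1 := by
    refine Measurable.indicator ?_ hK1c.measurableSet
    exact (g.measurable_K.comp h.measurable_grad.nnnorm).smul h.measurable_grad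
  have hF1q : ∫⁻ z, ‖F1 z‖ₑ ^ q ≠ ⊤ := by
    have hq0 : 0 < q := hpq.symm.pos
    have h1 : ∫⁻ z, ‖F1 z‖ₑ ^ q = ∫⁻ z in K1, ‖g.K ‖G z‖₊ • G z‖ₑ ^ q := by
      rw [← lintegral_indicator hK1c.measurableSet]
      refine lintegral_congr fun z => ?_
      by_cases hz : z ∈ K1
      · rw [hF1, indicator_of_mem hz, indicator_of_mem hz]
      · rw [hF1, indicator_of_notMem hz, indicator_of_notMem hz, enorm_zero,
          ENNReal.zero_rpow_of_pos hq0]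
    rw [h1]
    refine ne_top_of_le_ne_top ?_ (lintegral_mono fun z => g.enorm_flux_rpow_le (G z))
    rw [lintegral_const_mul _ (h.measurable_grad.enorm.pow_const _)]
    exact ENNReal.mul_ne_top (ENNReal.rpow_ne_top_of_nonneg hq0.le (by simp)) hGtop
  set A := (∫⁻ z, ‖F1 z‖ₑ ^ q) ^ (1 / q) with hA
  have hAtop : A ≠ ⊤ := ENNReal.rpow_ne_top_of_nonneg (one_div_nonneg.2 hpq.symm.nonneg) hF1q
  set b := ∫ z, (inner ℝ (F1 z) (W z) : ℝ) with hb
  set v1 : Space n × ℝ → ℝ := K1.indicator fun z => u z ^ lam with hv1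
  have hv1i : Integrable v1 :=
    (h.integrableOn_rpow hlam hK1c hK1Q).integrable_indicator hK1c.measurableSet
  set Φ1 : Space n × ℝ → ℝ := K1.indicator fun z => stieltjesPrimitive f lam (u z) with hΦ1
  have hΦm : Measurable fun z => stieltjesPrimitive f lam (u z) :=
    (continuous_stieltjesPrimitive hf1.continuous hlam.1).measurable.comp h.measurable
  have hΦ1i : Integrable Φ1 := by
    refine (hv1i.mul_const (B : ℝ)).mono'
      (hΦm.indicator hK1c.measurableSet).aestronglyMeasurable (Eventually.of_forall fun z => ?_)
    by_cases hz : z ∈ K1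
    · rw [hΦ1, hv1, indicator_of_mem hz, indicator_of_mem hz, Real.norm_of_nonneg
        (stieltjesPrimitive_nonneg hf1.continuous hm hf0 hlam.1 (h.nonneg z))]
      refine (stieltjesPrimitive_le hf1.continuous hm hlam.1 (h.nonneg z)).trans ?_
      refine mul_le_mul_of_nonneg_left ?_ (Real.rpow_nonneg (h.nonneg z) _)
      have := hfB (u z)
      rw [← NNReal.coe_le_coe, coe_nnnorm] at this
      exact (le_abs_self _).trans this
    · rw [hΦ1, hv1, indicator_of_notMem hz, indicator_of_notMem hz]; simp
  -- the weak equation for translated test functions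
  have hweak : ∀ i, ∀ s : ℝ, |s| ≤ h0 → ∫ z, v1 z * timeDeriv (φ i) (z + (0, s)) =
      ∫ z, (inner ℝ (F1 z) (spaceGrad (φ i) (z + (0, s))) : ℝ) := by
    intro i s hs
    have htr : ContDiff ℝ ((⊤ : ℕ∞) : WithTop ℕ∞) fun z : Space n × ℝ => φ i (z + (0, s)) :=
      (hφs i).comp (contDiff_id.add contDiff_const)
    have hts : tsupport (fun z : Space n × ℝ => φ i (z + (0, s))) ⊆ K1 := by
      refine closure_minimal (fun z hz => ?_) hK1c.isClosed
      exact hshift z s hs (hφt i (subset_tsupport _ hz))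
    let ψ : 𝓓(Q, ℝ) := ⟨fun z => φ i (z + (0, s)), htr,
      HasCompactSupport.of_support_subset_isCompact hK1c ((subset_tsupport _).trans hts),
      hts.trans hK1Q⟩
    have heq := h.equation ψ
    have hψ : (ψ : Space n × ℝ → ℝ) = fun z => φ i (z + (0, s)) := rfl
    rw [hψ] at heq
    simp only [timeDeriv_translate, spaceGrad_translate] at heq
    have hoff : ∀ z ∉ K1, timeDeriv (φ i) (z + (0, s)) = 0 ∧
        spaceGrad (φ i) (z + (0, s)) = 0 := fun z hz =>
      ⟨timeDeriv_eq_zero (hφd i) fun hz' => hz (hshift z s hs (hφt i hz')),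
        spaceGrad_eq_zero (hφd i) fun hz' => hz (hshift z s hs (hφt i hz'))⟩
    rw [setIntegral_eq_integral_of_forall_compl_eq_zero,
      setIntegral_eq_integral_of_forall_compl_eq_zero] at heq
    · calc _ = ∫ z, u z ^ lam * timeDeriv (φ i) (z + (0, s)) := by
            congr 1; ext1 z
            by_cases hz : z ∈ K1
            · rw [hv1, indicator_of_mem hz]
            · rw [(hoff z hz).1, mul_zero, mul_zero]
        _ = _ := heq
        _ = _ := by
            congr 1; ext1 z
            by_cases hz : z ∈ K1
            · rw [hF1, indicator_of_mem hz, real_inner_smul_left]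
            · rw [(hoff z hz).2, inner_zero_right, inner_zero_right, mul_zero]
    · intro z hz
      rw [(hoff z fun h' => hz (hK1Q h')).2, inner_zero_right, mul_zero]
    · intro z hz
      rw [(hoff z fun h' => hz (hK1Q h')).1, mul_zero]
  have hinner : ∀ i, ∀ s : ℝ,
      ‖(∫ z, (inner ℝ (F1 z) (spaceGrad (φ i) (z + (0, s))) : ℝ)) - b‖ₑ ≤
      A * (2 ^ (p - 1) * ((∫⁻ z, ‖spaceGrad (φ i) z - W z‖ₑ ^ p) +
        ∫⁻ z, ‖W ((0, s) + z) - W z‖ₑ ^ p)) ^ (1 / p) := by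
    intro i s
    have hVs : Continuous fun z => spaceGrad (φ i) (z + (0, s)) :=
      (continuous_spaceGrad (hφ1 i)).comp (by fun_prop)
    have hVsp : ∫⁻ z, ‖spaceGrad (φ i) (z + (0, s))‖ₑ ^ p ≠ ⊤ := by
      rw [lintegral_add_right_eq_self (fun z => ‖spaceGrad (φ i) z‖ₑ ^ p)]
      exact hVp i
    rw [hb, ← integral_sub
      (integrable_inner_of_lintegral_rpow hpq hF1m.aestronglyMeasurable
        hVs.aestronglyMeasurable hF1q hVsp)
      (integrable_inner_of_lintegral_rpow hpq hF1m.aestronglyMeasurable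
        hWm.aestronglyMeasurable hF1q hWp)]
    simp_rw [← inner_sub_right]
    refine (enorm_integral_le_lintegral_enorm _).trans ?_
    refine (lintegral_enorm_inner_le hpq hF1m.aestronglyMeasurable
      (hVs.measurable.sub hWm).aestronglyMeasurable).trans ?_
    have hWs : Measurable fun z : Space n × ℝ => W ((0, s) + z) :=
      hWm.comp (measurable_const_add _)
    have h1 := htri (fun z => spaceGrad (φ i) (z + (0, s)) - W (z + (0, s)))
      (fun z => W ((0, s) + z) - W z) (hWs.sub hWm)
    have h2 : ∀ z : Space n × ℝ, (0, s) + z = z + (0, s) := fun z => add_comm _ _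
    simp only [h2, sub_add_sub_cancel] at h1 ⊢
    rw [lintegral_add_right_eq_self (fun z => ‖spaceGrad (φ i) z - W z‖ₑ ^ p)] at h1
    have h3 : 0 ≤ 1 / p := one_div_nonneg.2 hp0.le
    gcongr
    exact h1
  have hbW : b = ∫ z, g.K ‖G z‖₊ * inner ℝ (G z) (W z) := by
    rw [hb]; congr 1; ext1 z
    by_cases hz : z ∈ K1
    · rw [hF1, indicator_of_mem hz, real_inner_smul_left]
    · rw [hWoff z hz, inner_zero_right, inner_zero_right, mul_zero]
  have hΦη : ∫ z, Φ1 z * timeDeriv η (z + (0, (0 : ℝ))) =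
      ∫ z, stieltjesPrimitive f lam (u z) * timeDeriv η z := by
    congr 1; ext1 z
    rw [Prod.mk_zero_zero, add_zero]
    by_cases hz : z ∈ K1
    · rw [hΦ1, indicator_of_mem hz]
    · rw [timeDeriv_eq_zero hηd fun h' => hz (hK01 h'), mul_zero, mul_zero]
  rw [← hbW, ← hΦη]
  have hslope := (hasDerivAt_integral_mul_translate hΦ1i hη1 hηc 0).tendsto_slope_zero_right
  refine le_of_forall_pos_le_add fun ε hε => ?_
  -- smallness of the error
  have hsmall : ∃ δ : ℝ≥0∞, 0 < δ ∧ ∀ x ≤ δ + δ,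
      A * (2 ^ (p - 1) * x) ^ (1 / p) ≤ ENNReal.ofReal ε := by
    have hT : Tendsto (fun x : ℝ≥0∞ => A * (2 ^ (p - 1) * x) ^ (1 / p)) (𝓝 0) (𝓝 0) := by
      have c1 := ENNReal.Tendsto.const_mul (a := (2 : ℝ≥0∞) ^ (p - 1))
        (tendsto_id (α := ℝ≥0∞) (x := 𝓝 0)) (Or.inr (by finiteness))
      have c2 := c1.ennrpow_const (1 / p)
      have c3 := ENNReal.Tendsto.const_mul (a := A) c2 (Or.inr hAtop)
      have h3 : 0 < 1 / p := one_div_pos.2 hp0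
      simpa only [id, mul_zero, ENNReal.zero_rpow_of_pos h3] using c3
    have h1 := (ENNReal.tendsto_nhds_zero.1 hT) (ENNReal.ofReal ε) (by simpa using hε)
    rw [ENNReal.nhds_zero_basis_Iic.eventually_iff] at h1
    obtain ⟨δ, hδ, h2⟩ := h1
    refine ⟨δ / 2, ENNReal.half_pos hδ.ne', fun x hx => h2 ?_⟩
    rwa [ENNReal.add_halves] at hx
  obtain ⟨δ, hδ, hsm⟩ := hsmall
  have hωs : ∀ᶠ s : ℝ in 𝓝 0, ∫⁻ z, ‖W ((0, s) + z) - W z‖ₑ ^ p ≤ δ := by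
    have hc : Tendsto (fun s : ℝ => ((0 : Space n), s)) (𝓝 0) (𝓝 0) := by
      have : Continuous fun s : ℝ => ((0 : Space n), s) := by fun_prop
      exact this.tendsto 0
    exact (ENNReal.tendsto_nhds_zero.1 (hω.comp hc)) δ hδ
  obtain ⟨h1, hh1, hω1⟩ := Metric.eventually_nhds_iff_ball.1 hωs
  have hmain : ∀ᶠ t : ℝ in 𝓝[>] 0, b ≤ t⁻¹ • ((∫ z, Φ1 z * η (z + (0, 0 + t))) -
      ∫ z, Φ1 z * η (z + (0, 0))) + ε := by
    have hlt : 0 < min h0 h1 := lt_min hh0 hh1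
    filter_upwards [Ioo_mem_nhdsGT hlt] with t ht
    have ht0 : 0 < t := ht.1
    have hth0 : t < h0 := ht.2.trans_le (min_le_left _ _)
    have hth1 : t < h1 := ht.2.trans_le (min_le_right _ _)
    have hstep : ∀ᶠ i in atTop,
        b ≤ (t⁻¹ * ∫ z, (v1 (z - (0, t)) - v1 z) * φ i z) + ε := by
      filter_upwards [(ENNReal.tendsto_nhds_zero.1 hE) δ hδ] with i hi
      have hD := hasDerivAt_integral_mul_translate hv1i (hφ1 i) (hφc i)
      -- The mean value theorem replaces the difference quotient of `s ↦ ∫ v1 φ_i(· + s)` by its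
      -- derivative at some intermediate shift `s`, where the weak equation applies. The shift
      -- depends on `i`, but the translation error was made small uniformly for shifts below `h1`.
      obtain ⟨s, hs, hsl⟩ := exists_hasDerivAt_eq_slope _ _ ht0
        (fun x _ => (hD x).continuousAt.continuousWithinAt) (fun x _ => hD x)
      have hsabs : |s| ≤ h0 := by rw [abs_of_pos hs.1]; linarith [hs.2]
      rw [hweak i s hsabs] at hsl
      have hb1 := hinner i s
      have hb2 : ∫⁻ z, ‖W ((0, s) + z) - W z‖ₑ ^ p ≤ δ := by
        refine hω1 s ?_
        rw [mem_ball_zero_iff, Real.norm_eq_abs, abs_of_pos hs.1]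
        linarith [hs.2]
      have hb3 := hb1.trans (hsm _ (add_le_add hi hb2))
      rw [hsl, ← ofReal_norm, ENNReal.ofReal_le_ofReal_iff hε.le, Real.norm_eq_abs] at hb3
      have hb4 := (abs_le.1 hb3).1
      have hLi : (∫ z, v1 z * φ i (z + (0, t))) - ∫ z, v1 z * φ i (z + (0, 0)) =
          ∫ z, (v1 (z - (0, t)) - v1 z) * φ i z := by
        rw [integral_mul_translate, ← integral_sub]
        · simp only [Prod.mk_zero_zero, add_zero, sub_mul]
        · obtain ⟨C, hC⟩ := (hφ1 i).continuous.bounded_above_of_compact_support (hφc i)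
          exact (hv1i.comp_sub_right _).mul_bdd (c := C)
            (hφ1 i).continuous.aestronglyMeasurable (Eventually.of_forall hC)
        · obtain ⟨C, hC⟩ := (hφ1 i).continuous.bounded_above_of_compact_support (hφc i)
          simp only [Prod.mk_zero_zero, add_zero]
          exact hv1i.mul_bdd (c := C)
            (hφ1 i).continuous.aestronglyMeasurable (Eventually.of_forall hC)
      rw [hLi, sub_zero, div_eq_inv_mul] at hb4
      linarith
    have hlim : Tendsto (fun i => ∫ z, (v1 (z - (0, t)) - v1 z) * φ i z) atTop
        (𝓝 (∫ z, (v1 (z - (0, t)) - v1 z) * (f (u z) * η z))) := by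
      have hvd : Integrable fun z => v1 (z - (0, t)) - v1 z := (hv1i.comp_sub_right _).sub hv1i
      refine tendsto_integral_of_dominated_convergence
        (fun z => ‖v1 (z - (0, t)) - v1 z‖ * (B * C1)) (fun i => ?_) ?_ (fun i => ?_) ?_
      · exact hvd.aestronglyMeasurable.mul (hφ1 i).continuous.aestronglyMeasurable
      · exact hvd.norm.mul_const _
      · refine Eventually.of_forall fun z => ?_
        rw [norm_mul, norm_mul]
        have e1 : ‖f (w i z)‖ ≤ B := hfB (w i z)
        gcongr
        exact hC1 z
      · rw [ae_restrict_iff' hK1c.measurableSet] at hwu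
        filter_upwards [hwu] with z hz
        by_cases hzK : z ∈ K1
        · exact (((hf1.continuous.tendsto _).comp (hz hzK)).mul_const _).const_mul _
        · have : η z = 0 := image_eq_zero_of_notMem_tsupport fun h' => hzK (hK01 h')
          simp [hφ, this]
    have hb5 : b ≤ (t⁻¹ * ∫ z, (v1 (z - (0, t)) - v1 z) * (f (u z) * η z)) + ε :=
      ge_of_tendsto ((hlim.const_mul t⁻¹).add_const ε) hstep
    refine hb5.trans ?_
    rw [zero_add, integral_mul_translate, ← integral_sub]
    · rw [smul_eq_mul]
      gcongr
      · have hvd : Integrable fun z => v1 (z - (0, t)) - v1 z :=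
          (hv1i.comp_sub_right _).sub hv1i
        refine hvd.mul_bdd (c := B * C1) ?_ (Eventually.of_forall fun z => ?_)
        · exact ((hf1.continuous.measurable.comp h.measurable).mul
            hη1.continuous.measurable).aestronglyMeasurable
        · rw [norm_mul]
          have e1 : ‖f (u z)‖ ≤ B := hfB (u z)
          gcongr
          exact hC1 z
      · refine Integrable.sub ?_ ?_
        · exact (hΦ1i.comp_sub_right _).mul_bdd (c := C1)
            hη1.continuous.aestronglyMeasurable (Eventually.of_forall hC1)
        · simp only [Prod.mk_zero_zero, add_zero]
          exact hΦ1i.mul_bdd (c := C1)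
            hη1.continuous.aestronglyMeasurable (Eventually.of_forall hC1)
      · intro z
        dsimp only
        rw [Prod.mk_zero_zero, add_zero, ← sub_mul, ← mul_assoc]
        by_cases hz : z ∈ tsupport η
        · refine mul_le_mul_of_nonneg_right ?_ (hη0 z)
          have hz1 : z - (0, t) ∈ K1 := hshift' z t (by rw [abs_of_pos ht0]; exact hth0.le) hz
          rw [hv1, hΦ1, indicator_of_mem hz1, indicator_of_mem (hK01 hz),
            indicator_of_mem hz1, indicator_of_mem (hK01 hz)]
          -- Convexity in `u ^ lam`, multiplied by `η ≥ 0`. After this the remaining difference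
          -- quotient can again be moved onto `η`, and `t → 0` is harmless.
          exact sub_mul_le_stieltjesPrimitive_sub hf1.continuous hm hlam.1 (h.nonneg _)
            (h.nonneg _)
        · rw [image_eq_zero_of_notMem_tsupport hz, mul_zero, mul_zero]
    · exact (hΦ1i.comp_sub_right _).mul_bdd (c := C1)
        hη1.continuous.aestronglyMeasurable (Eventually.of_forall hC1)
    · simp only [Prod.mk_zero_zero, add_zero]
      exact hΦ1i.mul_bdd (c := C1)
        hη1.continuous.aestronglyMeasurable (Eventually.of_forall hC1)
  exact ge_of_tendsto (hslope.add_const ε) hmain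

end TestedInequality

/-! ### Smooth steps -/

section StepFn

/-- A smooth non-decreasing function equal to `0` on `(-∞, l]` and to `1` on `[m, ∞)`. -/
noncomputable def stepFn (l m s : ℝ) : ℝ := Real.smoothTransition ((s - l) / (m - l))

theorem exists_bound_deriv_smoothTransition :
    ∃ L : ℝ, 1 ≤ L ∧ ∀ x, |deriv Real.smoothTransition x| ≤ L := by
  have hc : Continuous (deriv Real.smoothTransition) :=
    (Real.smoothTransition.contDiff (n := 1)).continuous_deriv le_rfl
  obtain ⟨C, hC⟩ := isCompact_Icc.exists_bound_of_continuousOn (s := Icc (0 : ℝ) 1) hc.continuousOn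
  refine ⟨max 1 C, le_max_left _ _, fun x => ?_⟩
  by_cases hx : x ∈ Icc (0 : ℝ) 1
  · exact (hC x hx).trans (le_max_right _ _)
  · have : deriv Real.smoothTransition x = 0 := by
      rw [mem_Icc, not_and_or, not_le, not_le] at hx
      rcases hx with hx | hx
      · have : Real.smoothTransition =ᶠ[𝓝 x] fun _ => 0 := by
          filter_upwards [gt_mem_nhds hx] with y hy
          exact Real.smoothTransition.zero_of_nonpos hy.le
        rw [this.deriv_eq, deriv_const]
      · have : Real.smoothTransition =ᶠ[𝓝 x] fun _ => 1 := by
          filter_upwards [lt_mem_nhds hx] with y hy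
          exact Real.smoothTransition.one_of_one_le hy.le
        rw [this.deriv_eq, deriv_const]
    rw [this, abs_zero]
    exact zero_le_one.trans (le_max_left _ _)

/-- A bound for the derivative of the standard smooth transition function. -/
noncomputable def transitionBound : ℝ := exists_bound_deriv_smoothTransition.choose

theorem one_le_transitionBound : 1 ≤ transitionBound :=
  exists_bound_deriv_smoothTransition.choose_spec.1

theorem abs_deriv_smoothTransition_le (x : ℝ) :
    |deriv Real.smoothTransition x| ≤ transitionBound :=
  exists_bound_deriv_smoothTransition.choose_spec.2 x

variable {l m : ℝ}

theorem contDiff_stepFn : ContDiff ℝ ((⊤ : ℕ∞) : WithTop ℕ∞) (stepFn l m) :=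
  Real.smoothTransition.contDiff.comp ((contDiff_id.sub contDiff_const).div_const _)

theorem differentiable_stepFn : Differentiable ℝ (stepFn l m) :=
  contDiff_stepFn.differentiable (by simp)

theorem stepFn_nonneg (s : ℝ) : 0 ≤ stepFn l m s := Real.smoothTransition.nonneg _

theorem stepFn_le_one (s : ℝ) : stepFn l m s ≤ 1 := Real.smoothTransition.le_one _

theorem stepFn_eq_zero (hlm : l < m) {s : ℝ} (hs : s ≤ l) : stepFn l m s = 0 :=
  Real.smoothTransition.zero_of_nonpos
    (div_nonpos_of_nonpos_of_nonneg (by linarith) (by linarith))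

theorem stepFn_eq_one (hlm : l < m) {s : ℝ} (hs : m ≤ s) : stepFn l m s = 1 := by
  refine Real.smoothTransition.one_of_one_le ?_
  rw [le_div_iff₀ (by linarith)]
  linarith

theorem monotone_stepFn (hlm : l < m) : Monotone (stepFn l m) := fun _ _ h =>
  Real.smoothTransition.monotone (div_le_div_of_nonneg_right (by linarith) (by linarith))

theorem deriv_stepFn_nonneg (hlm : l < m) (s : ℝ) : 0 ≤ deriv (stepFn l m) s :=
  (monotone_stepFn hlm).deriv_nonneg

theorem abs_deriv_stepFn_le (hlm : l < m) (s : ℝ) :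
    |deriv (stepFn l m) s| ≤ transitionBound / (m - l) := by
  have h1 : HasDerivAt (fun s => (s - l) / (m - l)) (1 / (m - l)) s :=
    ((hasDerivAt_id s).sub_const l).div_const _
  have h2 : HasDerivAt Real.smoothTransition (deriv Real.smoothTransition ((s - l) / (m - l)))
      ((s - l) / (m - l)) :=
    ((Real.smoothTransition.contDiff (n := 1)).differentiable one_ne_zero _).hasDerivAt
  have h3 : HasDerivAt (stepFn l m) _ s := h2.comp s h1
  rw [h3.deriv, abs_mul, abs_of_pos (one_div_pos.2 (by linarith : 0 < m - l)), mul_one_div]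
  exact div_le_div_of_nonneg_right (abs_deriv_smoothTransition_le _) (by linarith)

theorem deriv_stepFn_of_le (hlm : l < m) {s : ℝ} (hs : s ≤ l) : deriv (stepFn l m) s = 0 := by
  have : IsLocalMin (stepFn l m) s := Eventually.of_forall fun y => by
    rw [stepFn_eq_zero hlm hs]; exact stepFn_nonneg y
  exact this.deriv_eq_zero

theorem deriv_stepFn_of_ge (hlm : l < m) {s : ℝ} (hs : m ≤ s) : deriv (stepFn l m) s = 0 := by
  have : IsLocalMax (stepFn l m) s := Eventually.of_forall fun y => by
    rw [stepFn_eq_one hlm hs]; exact stepFn_le_one y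
  exact this.deriv_eq_zero

end StepFn

/-! ### Bounded smooth truncations of powers -/

section TruncPow

/-- A smooth, bounded, non-decreasing approximation of `s ^ γ`, cut off below the level `l`. -/
noncomputable def truncPow (l m γ τ s : ℝ) : ℝ := stepFn l m s * (s / (1 + τ * s)) ^ γ

variable {l m γ τ : ℝ}

theorem truncPow_of_le (hlm : l < m) {s : ℝ} (hs : s ≤ l) : truncPow l m γ τ s = 0 := by
  rw [truncPow, stepFn_eq_zero hlm hs, zero_mul]

theorem truncPow_of_ge (hlm : l < m) {s : ℝ} (hs : m ≤ s) :
    truncPow l m γ τ s = (s / (1 + τ * s)) ^ γ := by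
  rw [truncPow, stepFn_eq_one hlm hs, one_mul]

theorem hasDerivAt_truncPow (hτ : 0 < τ) {s : ℝ} (hs : 0 < s) :
    HasDerivAt (truncPow l m γ τ) (deriv (stepFn l m) s * (s / (1 + τ * s)) ^ γ +
      stepFn l m s * (1 / (1 + τ * s) ^ 2 * γ * (s / (1 + τ * s)) ^ (γ - 1))) s := by
  have hpos : 0 < 1 + τ * s := by positivity
  have h1 : HasDerivAt (fun s => s / (1 + τ * s)) (1 / (1 + τ * s) ^ 2) s := by
    have h2 : HasDerivAt (fun s => 1 + τ * s) τ s := by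
      simpa using ((hasDerivAt_id s).const_mul τ).const_add 1
    have h3 : HasDerivAt (fun s => s / (1 + τ * s)) ((1 * (1 + τ * s) - s * τ) / (1 + τ * s) ^ 2) s :=
      (hasDerivAt_id s).div h2 hpos.ne'
    rwa [show 1 * (1 + τ * s) - s * τ = 1 by ring] at h3
  have h4 := h1.rpow_const (p := γ) (Or.inl (by positivity))
  exact (differentiable_stepFn s).hasDerivAt.mul h4

theorem contDiff_truncPow (hl : 0 < l) (hlm : l < m) (hτ : 0 < τ) :
    ContDiff ℝ ((⊤ : ℕ∞) : WithTop ℕ∞) (truncPow l m γ τ) := by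
  rw [contDiff_iff_contDiffAt]
  intro s
  rcases lt_or_ge s l with h | h
  · have : truncPow l m γ τ =ᶠ[𝓝 s] fun _ => 0 := by
      filter_upwards [gt_mem_nhds h] with y hy
      exact truncPow_of_le hlm hy.le
    exact contDiffAt_const.congr_of_eventuallyEq this
  · have hs : 0 < s := hl.trans_le h
    have hpos : 0 < 1 + τ * s := by positivity
    have h1 : ContDiffAt ℝ ((⊤ : ℕ∞) : WithTop ℕ∞) (fun s => s / (1 + τ * s)) s :=
      contDiffAt_id.div (contDiffAt_const.add (contDiffAt_const.mul contDiffAt_id)) hpos.ne'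
    exact contDiff_stepFn.contDiffAt.mul (h1.rpow_const_of_ne (by positivity))

theorem truncPow_nonneg (hl : 0 < l) (hlm : l < m) (hτ : 0 < τ) (s : ℝ) :
    0 ≤ truncPow l m γ τ s := by
  rcases le_or_gt s l with h | h
  · rw [truncPow_of_le hlm h]
  · have hs : 0 < s := hl.trans h
    exact mul_nonneg (stepFn_nonneg s) (by positivity)

theorem div_one_add_mul_le (hτ : 0 < τ) {s : ℝ} (hs : 0 < s) : s / (1 + τ * s) ≤ s :=
  div_le_self hs.le (by nlinarith)

theorem div_one_add_mul_le_inv (hτ : 0 < τ) {s : ℝ} (hs : 0 < s) : s / (1 + τ * s) ≤ τ⁻¹ := by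
  rw [div_le_iff₀ (by positivity), mul_add, inv_mul_cancel_left₀ hτ.ne']
  have := inv_pos.2 hτ
  linarith

theorem truncPow_le_rpow (hl : 0 < l) (hlm : l < m) (hτ : 0 < τ) (hγ : 0 ≤ γ) {s : ℝ}
    (hs : 0 ≤ s) : truncPow l m γ τ s ≤ s ^ γ := by
  rcases le_or_gt s l with h | h
  · rw [truncPow_of_le hlm h]; positivity
  · have hs : 0 < s := hl.trans h
    calc _ ≤ 1 * s ^ γ := mul_le_mul (stepFn_le_one s)
          (Real.rpow_le_rpow (by positivity) (div_one_add_mul_le hτ hs) hγ) (by positivity)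
          zero_le_one
      _ = _ := one_mul _

theorem truncPow_le_bound (hl : 0 < l) (hlm : l < m) (hτ : 0 < τ) (hγ : 0 ≤ γ) (s : ℝ) :
    truncPow l m γ τ s ≤ τ⁻¹ ^ γ := by
  rcases le_or_gt s l with h | h
  · rw [truncPow_of_le hlm h]; positivity
  · have hs : 0 < s := hl.trans h
    calc _ ≤ 1 * τ⁻¹ ^ γ := mul_le_mul (stepFn_le_one s)
          (Real.rpow_le_rpow (by positivity) (div_one_add_mul_le_inv hτ hs) hγ) (by positivity)
          zero_le_one
      _ = _ := one_mul _

theorem deriv_truncPow_of_le (hl : 0 < l) (hlm : l < m) (hτ : 0 < τ) {s : ℝ} (hs : s ≤ l) :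
    deriv (truncPow l m γ τ) s = 0 := by
  have : IsLocalMin (truncPow l m γ τ) s := Eventually.of_forall fun y => by
    rw [truncPow_of_le hlm hs]; exact truncPow_nonneg hl hlm hτ y
  exact this.deriv_eq_zero

theorem deriv_truncPow_nonneg (hl : 0 < l) (hlm : l < m) (hτ : 0 < τ) (hγ : 0 ≤ γ) (s : ℝ) :
    0 ≤ deriv (truncPow l m γ τ) s := by
  rcases le_or_gt s l with h | h
  · rw [deriv_truncPow_of_le hl hlm hτ h]
  · have hs : 0 < s := hl.trans h
    rw [(hasDerivAt_truncPow hτ hs).deriv]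
    have h1 := deriv_stepFn_nonneg hlm s
    have h2 := stepFn_nonneg (l := l) (m := m) s
    positivity

theorem monotone_truncPow (hl : 0 < l) (hlm : l < m) (hτ : 0 < τ) (hγ : 0 ≤ γ) :
    Monotone (truncPow l m γ τ) :=
  monotone_of_deriv_nonneg ((contDiff_truncPow hl hlm hτ).differentiable (by simp))
    (deriv_truncPow_nonneg hl hlm hτ hγ)

theorem deriv_truncPow_le (hl : 0 < l) (hlm : l < m) (hτ : 0 < τ) (hγ : 1 ≤ γ) {s : ℝ}
    (hs : 0 < s) :
    deriv (truncPow l m γ τ) s ≤ (transitionBound / (m - l) * m + γ) * s ^ (γ - 1) := by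
  rw [(hasDerivAt_truncPow hτ hs).deriv, add_mul]
  have hL := one_le_transitionBound
  have hml : 0 < m - l := by linarith
  have hb : s / (1 + τ * s) ≤ s := div_one_add_mul_le hτ hs
  refine add_le_add ?_ ?_
  · rcases le_or_gt m s with h | h
    · rw [deriv_stepFn_of_ge hlm h, zero_mul]
      have : 0 < m := hl.trans hlm
      positivity
    · have hsp : s ^ γ = s * s ^ (γ - 1) := by
        rw [← Real.rpow_one_add' hs.le (by linarith)]; congr 1; ring
      calc _ ≤ transitionBound / (m - l) * s ^ γ :=
            mul_le_mul ((le_abs_self _).trans (abs_deriv_stepFn_le hlm s))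
              (Real.rpow_le_rpow (by positivity) hb (by linarith)) (by positivity) (by positivity)
        _ ≤ transitionBound / (m - l) * (m * s ^ (γ - 1)) := by rw [hsp]; gcongr
        _ = _ := by ring
  · have h1 : 1 / (1 + τ * s) ^ 2 ≤ 1 := by
      rw [div_le_one (by positivity)]
      nlinarith [mul_pos hτ hs]
    calc _ ≤ 1 * (1 * γ * s ^ (γ - 1)) := by
          refine mul_le_mul (stepFn_le_one s) ?_ (by positivity) zero_le_one
          gcongr
      _ = _ := by ring

theorem deriv_truncPow_le_bound (hl : 0 < l) (hlm : l < m) (hτ : 0 < τ) (hγ : 1 ≤ γ) (s : ℝ) :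
    deriv (truncPow l m γ τ) s ≤
      transitionBound / (m - l) * τ⁻¹ ^ γ + γ * τ⁻¹ ^ (γ - 1) := by
  have hL := one_le_transitionBound
  have hml : 0 < m - l := by linarith
  rcases le_or_gt s l with h | h
  · rw [deriv_truncPow_of_le hl hlm hτ h]
    positivity
  · have hs : 0 < s := hl.trans h
    have hb : s / (1 + τ * s) ≤ τ⁻¹ := div_one_add_mul_le_inv hτ hs
    rw [(hasDerivAt_truncPow hτ hs).deriv]
    refine add_le_add ?_ ?_
    · exact mul_le_mul ((le_abs_self _).trans (abs_deriv_stepFn_le hlm s))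
        (Real.rpow_le_rpow (by positivity) hb (by linarith)) (by positivity) (by positivity)
    · have h1 : 1 / (1 + τ * s) ^ 2 ≤ 1 := by
        rw [div_le_one (by positivity)]
        nlinarith [mul_pos hτ hs]
      calc _ ≤ 1 * (1 * γ * τ⁻¹ ^ (γ - 1)) := by
            refine mul_le_mul (stepFn_le_one s) ?_ (by positivity) zero_le_one
            gcongr
        _ = _ := by ring

theorem exists_nnnorm_truncPow_le (hl : 0 < l) (hlm : l < m) (hτ : 0 < τ) (hγ : 1 ≤ γ) :
    ∃ B : ℝ≥0, (∀ s, ‖truncPow l m γ τ s‖₊ ≤ B) ∧ ∀ s, ‖deriv (truncPow l m γ τ) s‖₊ ≤ B := by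
  refine ⟨max (τ⁻¹ ^ γ).toNNReal
    (transitionBound / (m - l) * τ⁻¹ ^ γ + γ * τ⁻¹ ^ (γ - 1)).toNNReal, fun s => ?_, fun s => ?_⟩
  · refine (NNReal.le_toNNReal_of_coe_le ?_).trans (le_max_left _ _)
    rw [coe_nnnorm, Real.norm_of_nonneg (truncPow_nonneg hl hlm hτ s)]
    exact truncPow_le_bound hl hlm hτ (by linarith) s
  · refine (NNReal.le_toNNReal_of_coe_le ?_).trans (le_max_right _ _)
    rw [coe_nnnorm, Real.norm_of_nonneg (deriv_truncPow_nonneg hl hlm hτ (by linarith) s)]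
    exact deriv_truncPow_le_bound hl hlm hτ hγ s

/-- The derivative of the step only helps, so it is dropped; the derivative of the regularized power
alone already gives `γ` times the left-hand side. -/
theorem truncPow_le_mul_deriv (hl : 0 < l) (hlm : l < m) (hτ : 0 < τ) (hγ : 1 ≤ γ) {s : ℝ}
    (hs : 0 < s) : truncPow l m γ τ s ≤ s * (1 + τ * s) * deriv (truncPow l m γ τ) s := by
  have hpos : 0 < 1 + τ * s := by positivity
  have h1 := deriv_stepFn_nonneg hlm s
  have h2 := stepFn_nonneg (l := l) (m := m) s
  have hb : 0 < s / (1 + τ * s) := by positivity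
  have hbγ : (s / (1 + τ * s)) ^ γ = (s / (1 + τ * s)) * (s / (1 + τ * s)) ^ (γ - 1) := by
    rw [← Real.rpow_one_add' hb.le (by linarith)]; congr 1; ring
  rw [(hasDerivAt_truncPow hτ hs).deriv, mul_add]
  have h3 : s * (1 + τ * s) * (stepFn l m s * (1 / (1 + τ * s) ^ 2 * γ *
      (s / (1 + τ * s)) ^ (γ - 1))) = γ * truncPow l m γ τ s := by
    rw [truncPow, hbγ]
    field_simp
  rw [h3]
  have h4 : 0 ≤ s * (1 + τ * s) * (deriv (stepFn l m) s * (s / (1 + τ * s)) ^ γ) := by positivity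
  have h5 := truncPow_nonneg (γ := γ) hl hlm hτ s
  nlinarith

/-- This is the exact form Young's inequality needs to absorb the cross term of the energy estimate,
with a constant independent of `τ`. The loss `(1 + τ s) ^ (p - 1)` is compensated by the denominator
`(1 + τ s) ^ γ`, since `p - 1 ≤ 1 ≤ γ`. -/
theorem truncPow_rpow_le (hl : 0 < l) (hlm : l < m) (hτ : 0 < τ) (hγ : 1 ≤ γ) {p : ℝ}
    (hp1 : 1 < p) (hp2 : p ≤ 2) {s : ℝ} (hs : 0 < s) :
    truncPow l m γ τ s ^ p ≤ s ^ (γ + p - 1) * deriv (truncPow l m γ τ) s ^ (p - 1) := by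
  have h0 := truncPow_nonneg (γ := γ) hl hlm hτ s
  have hd := deriv_truncPow_nonneg (γ := γ) hl hlm hτ (by linarith) s
  have hpos : 0 < 1 + τ * s := by positivity
  have hone : 1 ≤ 1 + τ * s := by nlinarith [mul_pos hτ hs]
  have h1 : truncPow l m γ τ s * (1 + τ * s) ^ (p - 1) ≤ s ^ γ := by
    have hcalc : truncPow l m γ τ s ≤ s ^ γ / (1 + τ * s) ^ γ := by
      rw [← Real.div_rpow hs.le hpos.le]
      exact mul_le_of_le_one_left (by positivity) (stepFn_le_one s)
    calc _ ≤ s ^ γ / (1 + τ * s) ^ γ * (1 + τ * s) ^ γ := by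
          refine mul_le_mul hcalc ?_ (by positivity) (by positivity)
          exact Real.rpow_le_rpow_of_exponent_le hone (by linarith)
      _ = s ^ γ := div_mul_cancel₀ _ (by positivity)
  calc truncPow l m γ τ s ^ p = truncPow l m γ τ s * truncPow l m γ τ s ^ (p - 1) := by
        rw [← Real.rpow_one_add' h0 (by linarith)]; congr 1; ring
    _ ≤ truncPow l m γ τ s * (s * (1 + τ * s) * deriv (truncPow l m γ τ) s) ^ (p - 1) := by
        refine mul_le_mul_of_nonneg_left ?_ h0
        exact Real.rpow_le_rpow h0 (truncPow_le_mul_deriv hl hlm hτ hγ hs) (by linarith)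
    _ = (truncPow l m γ τ s * (1 + τ * s) ^ (p - 1)) * s ^ (p - 1) *
          deriv (truncPow l m γ τ) s ^ (p - 1) := by
        rw [Real.mul_rpow (by positivity) hd, Real.mul_rpow hs.le hpos.le]; ring
    _ ≤ s ^ γ * s ^ (p - 1) * deriv (truncPow l m γ τ) s ^ (p - 1) := by gcongr
    _ = _ := by rw [← Real.rpow_add hs]; ring_nf

theorem le_deriv_truncPow (hl : 0 < l) (hlm : l < m) (hτ : 0 < τ) (hγ : 1 ≤ γ) {s : ℝ}
    (hs : m ≤ s) :
    (s / (1 + τ * s)) ^ (γ - 1) / (1 + τ * s) ^ 2 ≤ deriv (truncPow l m γ τ) s := by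
  have hs0 : 0 < s := hl.trans (hlm.trans_le hs)
  have hpos : 0 < 1 + τ * s := by positivity
  rw [(hasDerivAt_truncPow hτ hs0).deriv, deriv_stepFn_of_ge hlm hs, stepFn_eq_one hlm hs,
    zero_mul, zero_add, one_mul, div_eq_mul_one_div, mul_comm]
  have : 1 / (1 + τ * s) ^ 2 ≤ 1 / (1 + τ * s) ^ 2 * γ := le_mul_of_one_le_right (by positivity) hγ
  gcongr

theorem stieltjesPrimitive_truncPow_le (hl : 0 < l) (hlm : l < m) (hτ : 0 < τ) (hγ : 0 ≤ γ)
    {lam : ℝ} (hlam : 0 < lam) {s : ℝ} (hs : 0 ≤ s) :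
    stieltjesPrimitive (truncPow l m γ τ) lam s ≤ if l < s then s ^ (γ + lam) else 0 := by
  have h := stieltjesPrimitive_le (contDiff_truncPow (γ := γ) hl hlm hτ).continuous
    (monotone_truncPow hl hlm hτ hγ) hlam hs
  refine h.trans ?_
  split_ifs with hls
  · rw [add_comm, Real.rpow_add (hl.trans hls)]
    gcongr
    exact truncPow_le_rpow hl hlm hτ hγ hs
  · rw [truncPow_of_le hlm (not_lt.1 hls), mul_zero]

/-- Compare with the tangent line at `r s`, which is still above the step, and use Bernoulli's
inequality `r ^ lam ≤ 1 - lam (1 - r)`. The gap between two levels supplies an `r` below `1`. -/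
theorem le_stieltjesPrimitive_truncPow (hl : 0 < l) (hlm : l < m) (hτ : 0 < τ) (hγ : 0 ≤ γ)
    {lam : ℝ} (hlam : lam ∈ Ioc (0 : ℝ) 1) {r : ℝ} (hr : r ∈ Icc (0 : ℝ) 1) {s : ℝ} (hs : 0 < s)
    (hrs : m ≤ r * s) :
    lam * (1 - r) * r ^ γ * (s ^ lam * (s / (1 + τ * s)) ^ γ) ≤
      stieltjesPrimitive (truncPow l m γ τ) lam s := by
  have hrs0 : 0 < r * s := (hl.trans hlm).trans_le hrs
  have hr0 : 0 < r := pos_of_mul_pos_left hrs0 hs.le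
  refine le_trans ?_ (le_stieltjesPrimitive (contDiff_truncPow (γ := γ) hl hlm hτ).continuous
    (monotone_truncPow hl hlm hτ hγ) (truncPow_nonneg hl hlm hτ) hlam.1 hs.le hrs0.le)
  rw [truncPow_of_ge hlm hrs, Real.mul_rpow hr.1 hs.le]
  have h1 : r ^ lam ≤ 1 - lam * (1 - r) := by
    have := _root_.rpow_one_add_le_one_add_mul_self (s := r - 1) (p := lam) (by linarith [hr.1])
      hlam.1.le hlam.2
    rw [add_sub_cancel] at this
    linarith
  have h2 : r ^ γ * (s / (1 + τ * s)) ^ γ ≤ (r * s / (1 + τ * (r * s))) ^ γ := by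
    rw [← Real.mul_rpow hr.1 (by positivity)]
    refine Real.rpow_le_rpow (by positivity) ?_ hγ
    rw [mul_div_assoc']
    apply div_le_div_of_nonneg_left hrs0.le (by positivity)
    have : r * s ≤ s := mul_le_of_le_one_left hs.le hr.2
    gcongr
  calc _ = (lam * (1 - r) * s ^ lam) * (r ^ γ * (s / (1 + τ * s)) ^ γ) := by ring
    _ ≤ (s ^ lam - r ^ lam * s ^ lam) * (r * s / (1 + τ * (r * s))) ^ γ := by
      refine mul_le_mul ?_ h2 (by positivity) ?_
      · have : 0 ≤ s ^ lam := by positivity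
        nlinarith
      · have : 0 ≤ s ^ lam := by positivity
        have h3 : 0 ≤ lam * (1 - r) := mul_nonneg hlam.1.le (by linarith [hr.2])
        nlinarith

end TruncPow

/-- A form of Young's inequality. -/
theorem le_mul_add_of_rpow_le {x X A p ε : ℝ} (hx : 0 ≤ x) (hX : 0 ≤ X) (hA : 0 ≤ A) (hp : 1 < p)
    (hε : 0 < ε) (h : x ^ p ≤ A * X ^ (p - 1)) : x ≤ ε * X + ε ^ (1 - p) * A := by
  have hA' : 0 ≤ ε ^ (1 - p) * A := by positivity
  -- Either the first term already dominates, or `X` is below `x / ε` and the powers of `x` cancel.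
  rcases le_or_gt x (ε * X) with h1 | h1
  · linarith
  · have hx0 : 0 < x := (mul_nonneg hε.le hX).trans_lt h1
    have h2 : X ≤ ε⁻¹ * x := by rw [inv_mul_eq_div, le_div_iff₀ hε]; linarith
    have h3 : x * x ^ (p - 1) ≤ ε ^ (1 - p) * A * x ^ (p - 1) := by
      calc x * x ^ (p - 1) = x ^ p := by
            rw [← Real.rpow_one_add' hx (by linarith)]; congr 1; ring
        _ ≤ A * X ^ (p - 1) := h
        _ ≤ A * (ε⁻¹ * x) ^ (p - 1) := by gcongr
        _ = _ := by
          rw [Real.mul_rpow (by positivity) hx, Real.inv_rpow hε.le, ← Real.rpow_neg hε.le,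
            neg_sub]; ring
    have h4 := le_of_mul_le_mul_right h3 (by positivity)
    have : 0 ≤ ε * X := by positivity
    linarith

/-- The function `u ^ α` restricted to the super-level set `{u > l}`. -/
noncomputable def levelPow {X : Type*} (u : X → ℝ) (l α : ℝ) (z : X) : ℝ :=
  if l < u z then u z ^ α else 0

theorem levelPow_nonneg {X : Type*} {u : X → ℝ} (hu : ∀ z, 0 ≤ u z) (l α : ℝ) (z : X) :
    0 ≤ levelPow u l α z := by
  unfold levelPow
  split_ifs
  · exact Real.rpow_nonneg (hu z) _
  · exact le_rfl

theorem measurable_levelPow {X : Type*} [MeasurableSpace X] {u : X → ℝ} (hu : Measurable u)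
    (l α : ℝ) : Measurable (levelPow u l α) :=
  Measurable.ite (measurableSet_lt measurable_const hu) (hu.pow_const α) measurable_const

theorem levelPow_anti {X : Type*} {u : X → ℝ} (hu : ∀ z, 0 ≤ u z) {l l' : ℝ} (h : l ≤ l') (α : ℝ)
    (z : X) : levelPow u l' α z ≤ levelPow u l α z := by
  unfold levelPow
  split_ifs with h1 h2 h2
  · exact le_rfl
  · exact absurd (h.trans_lt h1) h2
  · exact Real.rpow_nonneg (hu z) _
  · exact le_rfl

/-- Above a positive level a missing power of `u` costs only a negative power of the level. This
lets one integral of `u ^ α` measure all error terms. -/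
theorem levelPow_sub_le {X : Type*} {u : X → ℝ} {l : ℝ} (hl : 0 < l) {α e : ℝ} (he : 0 ≤ e)
    (z : X) : levelPow u l (α - e) z ≤ l ^ (-e) * levelPow u l α z := by
  unfold levelPow
  split_ifs with h
  · have hu : 0 < u z := hl.trans h
    rw [sub_eq_add_neg, Real.rpow_add hu, mul_comm]
    refine mul_le_mul_of_nonneg_right ?_ (by positivity)
    exact Real.rpow_le_rpow_of_nonpos hl h.le (by linarith)
  · simp

/-! ### Pointwise coercivity with a cut-off -/

namespace GenPoly

variable (g : GenPoly)

/-- The constant in the coercivity estimate for the flux. -/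
noncomputable def coercConst : ℝ := (∑ i, g.coeff i) ^ (-(1 - g.a))

/-- The constant in the growth estimate for the flux. -/
noncomputable def growthConst : ℝ := g.coeff (Fin.last g.N) ^ (-(1 - g.a))

/-- The constant in front of the cut-off gradient in the Caccioppoli inequality. -/
noncomputable def youngConst : ℝ :=
  2 * g.growthConst * (g.coercConst / (4 * g.growthConst)) ^ (1 - (2 - g.a))

theorem coercConst_pos : 0 < g.coercConst := Real.rpow_pos_of_pos g.sum_coeff_pos _

theorem growthConst_pos : 0 < g.growthConst := Real.rpow_pos_of_pos (g.coeff_pos _) _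

theorem youngConst_pos : 0 < g.youngConst := by
  have := g.coercConst_pos
  have := g.growthConst_pos
  unfold youngConst
  positivity

theorem K_mul_norm_le {E : Type*} [NormedAddCommGroup E] (x : E) :
    g.K ‖x‖₊ * ‖x‖ ≤ g.growthConst * ‖x‖ ^ (1 - g.a) := g.K_mul_le ‖x‖₊

theorem K_mul_norm_sq_le {E : Type*} [NormedAddCommGroup E] (x : E) :
    g.K ‖x‖₊ * ‖x‖ ^ 2 ≤ g.growthConst * ‖x‖ ^ (2 - g.a) := by
  have h1 := g.K_mul_norm_le x
  have h2 : ‖x‖ ^ (2 - g.a) = ‖x‖ ^ (1 - g.a) * ‖x‖ := by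
    rw [← Real.rpow_add_one' (norm_nonneg x) (by linarith [g.a_lt_one])]
    congr 1; ring
  rw [h2, pow_two, ← mul_assoc, ← mul_assoc]
  exact mul_le_mul_of_nonneg_right h1 (norm_nonneg x)

theorem rpow_one_sub_le {E : Type*} [NormedAddCommGroup E] (x : E) :
    ‖x‖ ^ (1 - g.a) ≤ 1 + ‖x‖ ^ (2 - g.a) := by
  have h := g.a_lt_one
  have h0 : 0 ≤ ‖x‖ ^ (2 - g.a) := by positivity
  rcases le_total ‖x‖ 1 with h1 | h1
  · have := Real.rpow_le_one (norm_nonneg x) h1 (by linarith : 0 ≤ 1 - g.a)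
    linarith
  · have := Real.rpow_le_rpow_of_exponent_le h1 (by linarith : 1 - g.a ≤ 2 - g.a)
    linarith

/-- Pointwise coercivity of the flux tested against `f(u) ζ²`. -/
theorem coercivity_pointwise {E : Type*} [NormedAddCommGroup E] [InnerProductSpace ℝ E]
    {l m γ τ s ζ : ℝ} (hl : 0 < l) (hlm : l < m) (hτ : 0 < τ) (hγ : 1 ≤ γ) (hζ0 : 0 ≤ ζ)
    (hζ1 : ζ ≤ 1) (x Z : E) :
    g.coercConst / 2 * (deriv (truncPow l m γ τ) s * ‖x‖ ^ (2 - g.a) * ζ ^ 2) ≤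
      g.K ‖x‖₊ * inner ℝ x ((deriv (truncPow l m γ τ) s * ζ ^ 2) • x +
        truncPow l m γ τ s • ((2 * ζ) • Z)) +
      (∑ i, g.coeff i) * (deriv (truncPow l m γ τ) s * ζ ^ 2) +
      g.youngConst * ((if l < s then s ^ (γ + (2 - g.a) - 1) else 0) * ‖Z‖ ^ (2 - g.a)) := by
  have hp1 : 1 < 2 - g.a := by linarith [g.a_lt_one]
  have hp2 : 2 - g.a ≤ 2 := by linarith [g.a_pos]
  rcases le_or_gt s l with h | h
  · rw [deriv_truncPow_of_le hl hlm hτ h, truncPow_of_le hlm h, if_neg (not_lt.2 h)]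
    simp
  rw [if_pos h]
  have hs : 0 < s := hl.trans h
  set d := deriv (truncPow l m γ τ) s with hd
  set F := truncPow l m γ τ s with hF
  have hd0 : 0 ≤ d := deriv_truncPow_nonneg hl hlm hτ (by linarith) s
  have hF0 : 0 ≤ F := truncPow_nonneg hl hlm hτ s
  have hc1 := g.coercConst_pos
  have hc2 := g.growthConst_pos
  have hcoer : g.coercConst * ‖x‖ ^ (2 - g.a) - ∑ i, g.coeff i ≤ g.K ‖x‖₊ * ‖x‖ ^ 2 :=
    g.le_K_mul_sq ‖x‖₊
  rw [inner_add_right, real_inner_smul_right, real_inner_smul_right, real_inner_smul_right,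
    real_inner_self_eq_norm_sq, mul_add]
  set y := F * ‖x‖ ^ (1 - g.a) * ζ * ‖Z‖ with hy
  set X := d * ‖x‖ ^ (2 - g.a) * ζ ^ 2 with hX
  set A := s ^ (γ + (2 - g.a) - 1) * ‖Z‖ ^ (2 - g.a) with hA
  have hX0 : 0 ≤ X := by positivity
  have hyp : y ^ (2 - g.a) ≤ A * X ^ (2 - g.a - 1) := by
    have e1 := truncPow_rpow_le hl hlm hτ hγ hp1 hp2 hs
    rw [← hd, ← hF] at e1
    have e2 : (‖x‖ ^ (1 - g.a)) ^ (2 - g.a) = (‖x‖ ^ (2 - g.a)) ^ (2 - g.a - 1) := by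
      rw [← Real.rpow_mul (norm_nonneg x), ← Real.rpow_mul (norm_nonneg x)]; congr 1; ring
    -- The square of the cut-off suffices because `2 (p - 1) ≤ p` for `p ≤ 2` and `0 ≤ ζ ≤ 1`.
    have e3 : ζ ^ (2 - g.a) ≤ (ζ ^ 2) ^ (2 - g.a - 1) := by
      rw [← Real.rpow_natCast_mul hζ0]
      rcases hζ0.eq_or_lt with h0 | h0
      · rw [← h0, Real.zero_rpow (by linarith)]; positivity
      · refine Real.rpow_le_rpow_of_exponent_ge h0 hζ1 ?_
        push_cast; linarith
    rw [hy, hX, hA, Real.mul_rpow (by positivity) (norm_nonneg Z),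
      Real.mul_rpow (by positivity) hζ0, Real.mul_rpow hF0 (by positivity),
      Real.mul_rpow (by positivity) (by positivity), Real.mul_rpow hd0 (by positivity), e2]
    calc _ ≤ (s ^ (γ + (2 - g.a) - 1) * d ^ (2 - g.a - 1)) *
          (‖x‖ ^ (2 - g.a)) ^ (2 - g.a - 1) * (ζ ^ 2) ^ (2 - g.a - 1) * ‖Z‖ ^ (2 - g.a) := by
          gcongr
      _ = _ := by ring
  -- This `ε` makes `2 * growthConst * ε` equal to half of `coercConst`, so half of the coercive
  -- term survives.
  have hyoung := le_mul_add_of_rpow_le (ε := g.coercConst / (4 * g.growthConst))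
    (by positivity) hX0 (by positivity) hp1 (by positivity) hyp
  have hcross : -(2 * g.growthConst * y) ≤ g.K ‖x‖₊ * (F * (2 * ζ * inner ℝ x Z)) := by
    have e1 : |g.K ‖x‖₊ * (F * (2 * ζ * inner ℝ x Z))| ≤ 2 * g.growthConst * y := by
      rw [abs_mul, abs_mul, abs_mul, abs_of_pos (g.K_pos _), abs_of_nonneg hF0,
        abs_of_nonneg (by positivity : 0 ≤ 2 * ζ)]
      calc _ ≤ g.K ‖x‖₊ * (F * (2 * ζ * (‖x‖ * ‖Z‖))) := by
            have := (g.K_pos ‖x‖₊).le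
            gcongr
            exact abs_real_inner_le_norm x Z
        _ = (g.K ‖x‖₊ * ‖x‖) * (2 * F * ζ * ‖Z‖) := by ring
        _ ≤ (g.growthConst * ‖x‖ ^ (1 - g.a)) * (2 * F * ζ * ‖Z‖) :=
            mul_le_mul_of_nonneg_right (g.K_mul_norm_le x) (by positivity)
        _ = _ := by rw [hy]; ring
    linarith [(abs_le.1 e1).1]
  have hmain : d * ζ ^ 2 * (g.coercConst * ‖x‖ ^ (2 - g.a) - ∑ i, g.coeff i) ≤
      g.K ‖x‖₊ * (d * ζ ^ 2 * ‖x‖ ^ 2) := by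
    calc _ ≤ d * ζ ^ 2 * (g.K ‖x‖₊ * ‖x‖ ^ 2) :=
          mul_le_mul_of_nonneg_left hcoer (by positivity)
      _ = _ := by ring
  have hy2 : 2 * g.growthConst * y ≤ g.coercConst / 2 * X + g.youngConst * A := by
    calc _ ≤ 2 * g.growthConst * (g.coercConst / (4 * g.growthConst) * X +
          (g.coercConst / (4 * g.growthConst)) ^ (1 - (2 - g.a)) * A) := by gcongr
      _ = _ := by unfold youngConst; field_simp; ring
  have hmain' : d * ζ ^ 2 * (g.coercConst * ‖x‖ ^ (2 - g.a) - ∑ i, g.coeff i) =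
      g.coercConst * X - (∑ i, g.coeff i) * (d * ζ ^ 2) := by rw [hX]; ring
  linarith

end GenPoly

/-! ### The regularized energy inequality -/

section Energy

variable {n : ℕ}

theorem spaceGrad_sq_mul {ζ : Space n → ℝ} {β : ℝ → ℝ} (hζ : Differentiable ℝ ζ)
    (z : Space n × ℝ) : spaceGrad (fun z => ζ z.1 ^ 2 * β z.2) z =
      β z.2 • ((2 * ζ z.1) • gradient ζ z.1) := by
  unfold spaceGrad gradient
  have h : HasFDerivAt (fun y => ζ y ^ 2 * β z.2) _ z.1 :=
    (((hζ z.1).hasFDerivAt.pow 2).mul_const (β z.2))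
  rw [h.fderiv]
  simp [map_smul]

theorem timeDeriv_sq_mul {ζ : Space n → ℝ} {β : ℝ → ℝ} (z : Space n × ℝ) :
    timeDeriv (fun z => ζ z.1 ^ 2 * β z.2) z = ζ z.1 ^ 2 * deriv β z.2 := by
  unfold timeDeriv
  simp

/-- The factor in front of `∫∫ u ^ α` in the energy inequality. -/
noncomputable def energyConst (g : GenPoly) (lam l m γ Λt Λx : ℝ) : ℝ :=
  Λt + (∑ i, g.coeff i) * ((transitionBound / (m - l) * m + γ) * l ^ (-(1 + lam))) +
    g.youngConst * (l ^ (-(lam - 1 + g.a)) * Λx ^ (2 - g.a))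

theorem energyConst_nonneg {g : GenPoly} {lam l m γ Λt Λx : ℝ} (hl : 0 < l) (hlm : l < m)
    (hγ : 0 ≤ γ) (ht : 0 ≤ Λt) (hx : 0 ≤ Λx) : 0 ≤ energyConst g lam l m γ Λt Λx := by
  have h1 := g.youngConst_pos
  have h2 := g.sum_coeff_pos
  have h3 := one_le_transitionBound
  have h4 : 0 < m - l := by linarith
  have h5 : 0 < m := hl.trans hlm
  unfold energyConst
  positivity

variable {g : GenPoly} {lam : ℝ} {U : Opens (Space n)} {T : ℝ} {u : Space n × ℝ → ℝ}
  {G : Space n × ℝ → Space n}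

/-- The test function is `f(u) ζ² ϑ(t) χ(t)`: `ϑ` switches on after `t₂`, `χ` switches off between
`b₁` and `b₂`. The derivative of `χ` produces the first term, an average over times in `[b₁, b₂]`;
coercivity produces the second. Neither `τ` nor `b₁, b₂` enters the bound, so both can be sent to
their limits afterwards. -/
theorem energy_tested (h : IsMeasurableWeakSolution g lam (cylinder U T) u G)
    (hlam : lam ∈ Ioc (0 : ℝ) 1) (ha : 1 - lam < g.a) {l m γ τ : ℝ} (hl : 0 < l) (hlm : l < m)
    (hτ : 0 < τ) (hγ : 1 ≤ γ)
    {ζ : Space n → ℝ} (hζ : ContDiff ℝ ((⊤ : ℕ∞) : WithTop ℕ∞) ζ) (hζ0 : ∀ x, 0 ≤ ζ x)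
    (hζ1 : ∀ x, ζ x ≤ 1) {V : Set (Space n)} (hV : MeasurableSet V)
    (hζc : HasCompactSupport ζ) (hζV : tsupport ζ ⊆ V) (hVU : V ⊆ (U : Set (Space n)))
    {Λx : ℝ} (hΛx : ∀ x, ‖gradient ζ x‖ ≤ Λx)
    {t₁ t₂ t₃ b₁ b₂ : ℝ} (h0 : 0 ≤ t₁) (h12 : t₁ < t₂) (h23 : t₂ < t₃) (hb : b₁ < b₂) (hbT : b₂ < T)
    (hN : IntegrableOn (levelPow u l (γ + lam)) (V ×ˢ Ioo t₁ T)) :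
    Integrable (fun z => stieltjesPrimitive (truncPow l m γ τ) lam (u z) * ζ z.1 ^ 2 *
        stepFn t₂ t₃ z.2 * deriv (stepFn b₁ b₂) z.2 +
        g.coercConst / 2 * (deriv (truncPow l m γ τ) (u z) * ‖G z‖ ^ (2 - g.a) * ζ z.1 ^ 2) *
          (stepFn t₂ t₃ z.2 * (1 - stepFn b₁ b₂ z.2))) ∧
    ∫ z, (stieltjesPrimitive (truncPow l m γ τ) lam (u z) * ζ z.1 ^ 2 *
        stepFn t₂ t₃ z.2 * deriv (stepFn b₁ b₂) z.2 +
        g.coercConst / 2 * (deriv (truncPow l m γ τ) (u z) * ‖G z‖ ^ (2 - g.a) * ζ z.1 ^ 2) *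
          (stepFn t₂ t₃ z.2 * (1 - stepFn b₁ b₂ z.2))) ≤
      energyConst g lam l m γ (transitionBound / (t₃ - t₂)) Λx *
        ∫ z in V ×ˢ Ioo t₁ T, levelPow u l (γ + lam) z := by
  set f := truncPow l m γ τ with hf
  set Φ := stieltjesPrimitive f lam with hΦ
  set ϑ := stepFn t₂ t₃ with hϑ
  set χ : ℝ → ℝ := fun t => 1 - stepFn b₁ b₂ t with hχ
  set β : ℝ → ℝ := fun t => ϑ t * χ t with hβ
  set η : Space n × ℝ → ℝ := fun z => ζ z.1 ^ 2 * β z.2 with hη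
  have hγ0 : 0 ≤ γ := by linarith
  have hfs : ContDiff ℝ ((⊤ : ℕ∞) : WithTop ℕ∞) f := contDiff_truncPow hl hlm hτ
  have hfm : Monotone f := monotone_truncPow hl hlm hτ hγ0
  have hf0 : ∀ s, 0 ≤ f s := truncPow_nonneg hl hlm hτ
  have hf0' : ∀ s, 0 ≤ deriv f s := deriv_truncPow_nonneg hl hlm hτ hγ0
  obtain ⟨B, hB, hB'⟩ := exists_nnnorm_truncPow_le hl hlm hτ hγ
  have hχs : ContDiff ℝ ((⊤ : ℕ∞) : WithTop ℕ∞) χ := contDiff_const.sub contDiff_stepFn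
  have hβs : ContDiff ℝ ((⊤ : ℕ∞) : WithTop ℕ∞) β := contDiff_stepFn.mul hχs
  have hηs : ContDiff ℝ ((⊤ : ℕ∞) : WithTop ℕ∞) η :=
    ((hζ.comp contDiff_fst).pow 2).mul (hβs.comp contDiff_snd)
  have hζd : Differentiable ℝ ζ := hζ.differentiable (by simp)
  have hχ0 : ∀ t, 0 ≤ χ t := fun t => sub_nonneg.2 (stepFn_le_one t)
  have hχ1 : ∀ t, χ t ≤ 1 := fun t => sub_le_self _ (stepFn_nonneg t)
  have hϑ0 : ∀ t, 0 ≤ ϑ t := stepFn_nonneg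
  have hϑ1 : ∀ t, ϑ t ≤ 1 := stepFn_le_one
  have hβ0 : ∀ t, 0 ≤ β t := fun t => mul_nonneg (hϑ0 t) (hχ0 t)
  have hβ1 : ∀ t, β t ≤ 1 := fun t => mul_le_one₀ (hϑ1 t) (hχ0 t) (hχ1 t)
  have hη0 : ∀ z, 0 ≤ η z := fun z => mul_nonneg (by positivity) (hβ0 _)
  set K0 : Set (Space n × ℝ) := tsupport ζ ×ˢ Icc t₂ b₂ with hK0
  have hK0c : IsCompact K0 := hζc.isCompact.prod isCompact_Icc
  have hK0Q : K0 ⊆ (cylinder U T : Set (Space n × ℝ)) := fun z hz =>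
    ⟨hVU (hζV hz.1), ⟨by linarith [hz.2.1], by linarith [hz.2.2]⟩⟩
  have hβoff : ∀ t, t ∉ Icc t₂ b₂ → β t = 0 := by
    intro t ht
    rw [mem_Icc, not_and_or, not_le, not_le] at ht
    rcases ht with ht | ht
    · simp only [hβ, hϑ]; rw [stepFn_eq_zero h23 ht.le, zero_mul]
    · simp only [hβ, hχ]; rw [stepFn_eq_one hb ht.le, sub_self, mul_zero]
  have hηt : tsupport η ⊆ K0 := by
    refine closure_minimal (fun z hz => ?_) hK0c.isClosed
    by_contra hzK
    refine hz ?_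
    rw [hK0, mem_prod, not_and_or] at hzK
    rcases hzK with hzK | hzK
    · simp only [hη]; rw [image_eq_zero_of_notMem_tsupport hzK]; simp
    · simp only [hη]; rw [hβoff _ hzK]; simp
  have hηc : HasCompactSupport η :=
    HasCompactSupport.of_support_subset_isCompact hK0c ((subset_tsupport _).trans hηt)
  have key := h.tested_inequality hlam hfs hfm hf0 hB hB' hηs hηc (hηt.trans hK0Q) hη0
  have hηd : Differentiable ℝ η := hηs.differentiable (by simp)
  set I : Space n × ℝ → ℝ := fun z => g.K ‖G z‖₊ *
    inner ℝ (G z) ((deriv f (u z) * η z) • G z + f (u z) • spaceGrad η z) with hI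
  set J : Space n × ℝ → ℝ := fun z => Φ (u z) * timeDeriv η z with hJ
  have hf1c : Continuous (deriv f) := (hfs.of_le (m := 1) (by simp)).continuous_deriv le_rfl
  have hη1 : ContDiff ℝ 1 η := hηs.of_le (by simp)
  obtain ⟨C2, hC2⟩ := (continuous_spaceGrad hη1).bounded_above_of_compact_support
    (hasCompactSupport_spaceGrad hηd hηc)
  obtain ⟨C3, hC3⟩ := (continuous_timeDeriv hη1).bounded_above_of_compact_support
    (hasCompactSupport_timeDeriv hηd hηc)
  have hKQ' := h.integrableOn_rpow hlam hK0c hK0Q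
  have hGp : IntegrableOn (fun z => ‖G z‖ ^ (2 - g.a)) K0 :=
    h.locallyIntegrableOn_rpow.integrableOn_compact_subset hK0Q hK0c
  have hηle : ∀ z, η z ≤ 1 := fun z =>
    mul_le_one₀ (pow_le_one₀ (hζ0 _) (hζ1 _)) (hβ0 _) (hβ1 _)
  have hIi : Integrable I := by
    have hoff : ∀ z ∉ K0, I z = 0 := by
      intro z hz
      have hz' : z ∉ tsupport η := fun h' => hz (hηt h')
      simp only [hI]
      rw [image_eq_zero_of_notMem_tsupport hz', spaceGrad_eq_zero hηd hz']
      simp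
    rw [← integrableOn_iff_integrable_of_support_subset (s := K0)
      (fun z hz => by by_contra h'; exact hz (hoff z h'))]
    have hdom : IntegrableOn (fun z => g.growthConst * B * ‖G z‖ ^ (2 - g.a) +
        g.growthConst * B * C2 * (1 + ‖G z‖ ^ (2 - g.a))) K0 :=
      (hGp.const_mul _).add (((integrableOn_const hK0c.measure_lt_top.ne).add hGp).const_mul _)
    refine hdom.mono' ?_ (Eventually.of_forall fun z => ?_)
    · have m1 : Measurable fun z => g.K ‖G z‖₊ :=
        g.measurable_K.comp h.measurable_grad.nnnorm
      have m2 : Measurable fun z => (deriv f (u z) * η z) • G z + f (u z) • spaceGrad η z :=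
        (((hf1c.measurable.comp h.measurable).mul hηd.continuous.measurable).smul
          h.measurable_grad).add
          ((hfs.continuous.measurable.comp h.measurable).smul
            (continuous_spaceGrad hη1).measurable)
      exact (m1.mul (h.measurable_grad.inner m2)).aestronglyMeasurable
    · have hd : deriv f (u z) ≤ B := (le_abs_self _).trans (hB' (u z))
      have hfz : f (u z) ≤ B := (le_abs_self _).trans (hB (u z))
      have hKp := (g.K_pos ‖G z‖₊).le
      have hgc := g.growthConst_pos
      have hdη : deriv f (u z) * η z ≤ B :=
        (mul_le_of_le_one_right (hf0' _) (hηle z)).trans hd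
      have hsg := hC2 z
      have hC20 : 0 ≤ C2 := (norm_nonneg _).trans hsg
      simp only [hI]
      rw [inner_add_right, real_inner_smul_right, real_inner_smul_right,
        real_inner_self_eq_norm_sq, mul_add]
      refine (norm_add_le _ _).trans (add_le_add ?_ ?_)
      · rw [Real.norm_of_nonneg (mul_nonneg hKp (mul_nonneg (mul_nonneg (hf0' _) (hη0 z))
          (by positivity)))]
        calc _ ≤ g.K ‖G z‖₊ * (B * ‖G z‖ ^ 2) := by gcongr
          _ = B * (g.K ‖G z‖₊ * ‖G z‖ ^ 2) := by ring
          _ ≤ B * (g.growthConst * ‖G z‖ ^ (2 - g.a)) :=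
            mul_le_mul_of_nonneg_left (g.K_mul_norm_sq_le _) B.2
          _ = _ := by ring
      · rw [norm_mul, norm_mul, Real.norm_of_nonneg hKp, Real.norm_of_nonneg (hf0 _)]
        calc _ ≤ g.K ‖G z‖₊ * (B * (‖G z‖ * C2)) := by
              gcongr
              exact (norm_inner_le_norm _ _).trans
                (mul_le_mul_of_nonneg_left hsg (norm_nonneg _))
          _ = B * C2 * (g.K ‖G z‖₊ * ‖G z‖) := by ring
          _ ≤ B * C2 * (g.growthConst * (1 + ‖G z‖ ^ (2 - g.a))) :=
            mul_le_mul_of_nonneg_left ((g.K_mul_norm_le _).trans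
              (mul_le_mul_of_nonneg_left (g.rpow_one_sub_le _) hgc.le)) (by positivity)
          _ = _ := by ring
  have hΦ0 : ∀ z, 0 ≤ Φ (u z) := fun z =>
    stieltjesPrimitive_nonneg hfs.continuous hfm hf0 hlam.1 (h.nonneg z)
  have hΦm : Measurable fun z => Φ (u z) :=
    (continuous_stieltjesPrimitive hfs.continuous hlam.1).measurable.comp h.measurable
  have hJi : Integrable J := by
    rw [← integrableOn_iff_integrable_of_support_subset (s := K0) (fun z hz => by
      by_contra h'
      refine hz ?_
      simp only [hJ]
      rw [timeDeriv_eq_zero hηd fun h'' => h' (hηt h''), mul_zero])]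
    refine (hKQ'.mul_const (B * C3)).mono'
      (hΦm.mul (continuous_timeDeriv hη1).measurable).aestronglyMeasurable
      (Eventually.of_forall fun z => ?_)
    have e1 : Φ (u z) ≤ u z ^ lam * B :=
      (stieltjesPrimitive_le hfs.continuous hfm hlam.1 (h.nonneg z)).trans
        (mul_le_mul_of_nonneg_left ((le_abs_self _).trans (hB (u z)))
          (Real.rpow_nonneg (h.nonneg z) _))
    have e2 := hC3 z
    have e3 := hΦ0 z
    simp only [hJ]
    rw [norm_mul, Real.norm_of_nonneg e3]
    calc _ ≤ (u z ^ lam * B) * C3 := mul_le_mul e1 e2 (norm_nonneg _) (e3.trans e1)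
      _ = _ := by ring
  set M0 := energyConst g lam l m γ (transitionBound / (t₃ - t₂)) Λx with hM0
  set S : Set (Space n × ℝ) := V ×ˢ Ioo t₁ T with hS
  have hSm : MeasurableSet S := hV.prod measurableSet_Ioo
  set N := levelPow u l (γ + lam) with hNdef
  have hN0 : ∀ z, 0 ≤ N z := levelPow_nonneg h.nonneg _ _
  set P : Space n × ℝ → ℝ := fun z => Φ (u z) * ζ z.1 ^ 2 * ϑ z.2 * deriv (stepFn b₁ b₂) z.2 +
        g.coercConst / 2 * (deriv f (u z) * ‖G z‖ ^ (2 - g.a) * ζ z.1 ^ 2) *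
          (ϑ z.2 * χ z.2) with hP
  have hP0 : ∀ z, 0 ≤ P z := by
    intro z
    have e1 := hΦ0 z
    have e2 := hϑ0 z.2
    have e3 := deriv_stepFn_nonneg hb z.2
    have e4 := hχ0 z.2
    have e5 := hf0' (u z)
    have e6 := g.coercConst_pos
    positivity
  -- The tested inequality says that `I - J` has non-positive integral, so a pointwise bound by `I -
  -- J` plus the error terms is enough.
  have hpt : ∀ z, P z ≤ (I z - J z) + M0 * S.indicator N z := by
    intro z
    have hβ' : deriv β z.2 = deriv ϑ z.2 * χ z.2 - ϑ z.2 * deriv (stepFn b₁ b₂) z.2 := by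
      have e1 : HasDerivAt χ (-deriv (stepFn b₁ b₂) z.2) z.2 :=
        (differentiable_stepFn z.2).hasDerivAt.const_sub 1
      have e2 : HasDerivAt ϑ (deriv ϑ z.2) z.2 := (differentiable_stepFn z.2).hasDerivAt
      have e3 : HasDerivAt β _ z.2 := e2.mul e1
      rw [e3.deriv]; ring
    have hIz : I z = β z.2 * (g.K ‖G z‖₊ * inner ℝ (G z) ((deriv f (u z) * ζ z.1 ^ 2) • G z +
        f (u z) • ((2 * ζ z.1) • gradient ζ z.1))) := by
      simp only [hI, hη]
      rw [spaceGrad_sq_mul hζd]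
      simp only [inner_add_right, real_inner_smul_right]
      ring
    have hJz : J z = Φ (u z) * (ζ z.1 ^ 2 * deriv β z.2) := by
      simp only [hJ, hη]
      rw [timeDeriv_sq_mul]
    have hco := mul_le_mul_of_nonneg_left (g.coercivity_pointwise (s := u z) hl hlm hτ hγ
      (hζ0 z.1) (hζ1 z.1) (G z) (gradient ζ z.1)) (hβ0 z.2)
    rw [← hf, mul_add, mul_add, ← hIz] at hco
    -- The power left by Young's inequality is `α - (lam - 1 + a)`. It lies below `α` precisely
    -- because `a > δ`.
    have hif : (if l < u z then u z ^ (γ + (2 - g.a) - 1) else 0) ≤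
        l ^ (-(lam - 1 + g.a)) * N z := by
      have := levelPow_sub_le (u := u) hl (α := γ + lam) (e := lam - 1 + g.a) (by linarith) z
      rw [show γ + lam - (lam - 1 + g.a) = γ + (2 - g.a) - 1 by ring] at this
      exact this
    have hrest : Φ (u z) * ζ z.1 ^ 2 * (deriv ϑ z.2 * χ z.2) +
        β z.2 * ((∑ i, g.coeff i) * (deriv f (u z) * ζ z.1 ^ 2)) +
        β z.2 * (g.youngConst * ((if l < u z then u z ^ (γ + (2 - g.a) - 1) else 0) *
          ‖gradient ζ z.1‖ ^ (2 - g.a))) ≤ M0 * S.indicator N z := by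
      by_cases hz : z ∈ S
      · rw [indicator_of_mem hz]
        have hζsq : ζ z.1 ^ 2 ≤ 1 := pow_le_one₀ (hζ0 _) (hζ1 _)
        have q1 : Φ (u z) * ζ z.1 ^ 2 * (deriv ϑ z.2 * χ z.2) ≤
            transitionBound / (t₃ - t₂) * N z := by
          have e1 : Φ (u z) ≤ N z :=
            stieltjesPrimitive_truncPow_le hl hlm hτ hγ0 hlam.1 (h.nonneg z)
          have e2 : deriv ϑ z.2 ≤ transitionBound / (t₃ - t₂) :=
            (le_abs_self _).trans (abs_deriv_stepFn_le h23 z.2)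
          have e3 := deriv_stepFn_nonneg h23 z.2
          calc _ ≤ N z * 1 * (transitionBound / (t₃ - t₂) * 1) := by
                refine mul_le_mul (mul_le_mul e1 hζsq (by positivity) (hN0 z))
                  (mul_le_mul e2 (hχ1 _) (hχ0 _) (e3.trans e2))
                  (mul_nonneg e3 (hχ0 _)) (by rw [mul_one]; exact hN0 z)
            _ = _ := by ring
        have q2 : β z.2 * ((∑ i, g.coeff i) * (deriv f (u z) * ζ z.1 ^ 2)) ≤
            (∑ i, g.coeff i) * ((transitionBound / (m - l) * m + γ) * l ^ (-(1 + lam))) *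
              N z := by
          have hA := g.sum_coeff_pos.le
          have hTB := one_le_transitionBound
          have hml : 0 < m - l := by linarith
          have hm0 : 0 < m := hl.trans hlm
          have e1 : deriv f (u z) ≤ (transitionBound / (m - l) * m + γ) *
              (l ^ (-(1 + lam)) * N z) := by
            rcases le_or_gt (u z) l with hz' | hz'
            · rw [deriv_truncPow_of_le hl hlm hτ hz']
              have := hN0 z
              positivity
            · refine (deriv_truncPow_le hl hlm hτ hγ (hl.trans hz')).trans ?_
              gcongr
              have := levelPow_sub_le (u := u) hl (α := γ + lam) (e := 1 + lam)
                (by linarith [hlam.1]) z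
              rw [show γ + lam - (1 + lam) = γ - 1 by ring] at this
              simpa only [hNdef, levelPow, if_pos hz'] using this
          have e2 : deriv f (u z) * ζ z.1 ^ 2 ≤ deriv f (u z) :=
            mul_le_of_le_one_right (hf0' _) hζsq
          calc _ ≤ 1 * ((∑ i, g.coeff i) * ((transitionBound / (m - l) * m + γ) *
                (l ^ (-(1 + lam)) * N z))) := by
                refine mul_le_mul (hβ1 _) (mul_le_mul_of_nonneg_left (e2.trans e1) hA)
                  (mul_nonneg hA (mul_nonneg (hf0' _) (by positivity))) zero_le_one
            _ = _ := by ring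
        have q3 : β z.2 * (g.youngConst * ((if l < u z then u z ^ (γ + (2 - g.a) - 1) else 0) *
            ‖gradient ζ z.1‖ ^ (2 - g.a))) ≤
            g.youngConst * (l ^ (-(lam - 1 + g.a)) * Λx ^ (2 - g.a)) * N z := by
          have hy := g.youngConst_pos.le
          have e1 : ‖gradient ζ z.1‖ ^ (2 - g.a) ≤ Λx ^ (2 - g.a) :=
            Real.rpow_le_rpow (norm_nonneg _) (hΛx _) (by linarith [g.a_lt_one])
          have e2 : (0 : ℝ) ≤ if l < u z then u z ^ (γ + (2 - g.a) - 1) else 0 :=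
            levelPow_nonneg h.nonneg l _ z
          have e3 : 0 ≤ ‖gradient ζ z.1‖ ^ (2 - g.a) := by positivity
          calc _ ≤ 1 * (g.youngConst * (l ^ (-(lam - 1 + g.a)) * N z * Λx ^ (2 - g.a))) := by
                refine mul_le_mul (hβ1 _) (mul_le_mul_of_nonneg_left
                  (mul_le_mul hif e1 e3 (e2.trans hif)) hy)
                  (mul_nonneg hy (mul_nonneg e2 e3)) zero_le_one
            _ = _ := by ring
        calc _ ≤ _ := add_le_add (add_le_add q1 q2) q3
          _ = _ := by rw [hM0, energyConst]; ring
      · rw [indicator_of_notMem hz, mul_zero]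
        rw [hS, mem_prod, not_and_or] at hz
        have hζz : z.1 ∉ V → ζ z.1 = 0 ∧ gradient ζ z.1 = 0 := by
          intro hzV
          have h' : z.1 ∉ tsupport ζ := fun h'' => hzV (hζV h'')
          refine ⟨image_eq_zero_of_notMem_tsupport h', ?_⟩
          unfold gradient
          rw [fderiv_of_notMem_tsupport ℝ h', map_zero]
        rcases hz with hz | hz
        · rw [(hζz hz).1, (hζz hz).2, norm_zero, Real.zero_rpow (by linarith [g.a_lt_one])]
          simp
        · have hβz : β z.2 = 0 := hβoff _ fun h' => hz ⟨by linarith [h'.1], by linarith [h'.2]⟩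
          have hϑχ : deriv ϑ z.2 * χ z.2 = 0 := by
            rw [mem_Ioo, not_and_or, not_lt, not_lt] at hz
            rcases hz with hz | hz
            · rw [hϑ, deriv_stepFn_of_le h23 (by linarith), zero_mul]
            · simp only [hχ]; rw [stepFn_eq_one hb (by linarith), sub_self, mul_zero]
          rw [hβz, hϑχ]
          simp
    have hPz : P z = Φ (u z) * ζ z.1 ^ 2 * ϑ z.2 * deriv (stepFn b₁ b₂) z.2 +
        β z.2 * (g.coercConst / 2 * (deriv f (u z) * ‖G z‖ ^ (2 - g.a) * ζ z.1 ^ 2)) := by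
      simp only [hP, hβ]; ring
    rw [hPz, hJz, hβ']
    linarith
  have hNi : Integrable (S.indicator N) := hN.integrable_indicator hSm
  have hRi : Integrable fun z => (I z - J z) + M0 * S.indicator N z :=
    (hIi.sub hJi).add (hNi.const_mul M0)
  have hPm : Measurable P := by
    have m1 : Measurable fun z : Space n × ℝ => ζ z.1 :=
      hζ.continuous.measurable.comp measurable_fst
    have m2 : Measurable fun z : Space n × ℝ => ϑ z.2 :=
      contDiff_stepFn.continuous.measurable.comp measurable_snd
    have m3 : Measurable fun z : Space n × ℝ => χ z.2 :=
      hχs.continuous.measurable.comp measurable_snd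
    have m4 : Measurable fun z : Space n × ℝ => deriv (stepFn b₁ b₂) z.2 :=
      (measurable_deriv _).comp measurable_snd
    have m5 : Measurable fun z => deriv f (u z) := hf1c.measurable.comp h.measurable
    have m6 : Measurable fun z => ‖G z‖ ^ (2 - g.a) := h.measurable_grad.norm.pow_const _
    exact ((((hΦm.mul (m1.pow_const 2)).mul m2).mul m4)).add
      (((measurable_const.mul ((m5.mul m6).mul (m1.pow_const 2)))).mul (m2.mul m3))
  have hPi : Integrable P := hRi.mono' hPm.aestronglyMeasurable (Eventually.of_forall fun z => by
    rw [Real.norm_of_nonneg (hP0 z)]; exact hpt z)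
  refine ⟨hPi, ?_⟩
  calc ∫ z, P z ≤ ∫ z, ((I z - J z) + M0 * S.indicator N z) := integral_mono hPi hRi hpt
    _ = ((∫ z, I z) - ∫ z, J z) + M0 * ∫ z in S, N z := by
      rw [integral_add (f := fun z => I z - J z) (hIi.sub hJi) (hNi.const_mul M0),
        integral_sub hIi hJi, integral_const_mul, integral_indicator hSm]
    _ ≤ M0 * ∫ z in S, N z := by linarith

end Energy

/-- Fatou's lemma, arranged so that the bounds may vary along the sequence. -/
theorem lintegral_le_of_tendsto_of_tendsto {α : Type*} [MeasurableSpace α] {μ : Measure α}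
    {F : ℕ → α → ℝ≥0∞} {f : α → ℝ≥0∞} (hF : ∀ i, Measurable (F i))
    (hlim : ∀ᵐ x ∂μ, Tendsto (fun i => F i x) atTop (𝓝 (f x))) {c : ℕ → ℝ≥0∞} {C : ℝ≥0∞}
    (hc : ∀ i, ∫⁻ x, F i x ∂μ ≤ c i) (hC : Tendsto c atTop (𝓝 C)) : ∫⁻ x, f x ∂μ ≤ C := by
  calc ∫⁻ x, f x ∂μ = ∫⁻ x, liminf (fun i => F i x) atTop ∂μ :=
        lintegral_congr_ae (hlim.mono fun x hx => hx.liminf_eq.symm)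
    _ ≤ liminf (fun i => ∫⁻ x, F i x ∂μ) atTop := lintegral_liminf_le hF
    _ ≤ liminf c atTop := liminf_le_liminf (Eventually.of_forall hc)
    _ = C := hC.liminf_eq

theorem lintegral_le_of_tendsto {α : Type*} [MeasurableSpace α] {μ : Measure α}
    {F : ℕ → α → ℝ≥0∞} {f : α → ℝ≥0∞} (hF : ∀ i, Measurable (F i))
    (hlim : ∀ᵐ x ∂μ, Tendsto (fun i => F i x) atTop (𝓝 (f x))) {C : ℝ≥0∞}
    (hC : ∀ i, ∫⁻ x, F i x ∂μ ≤ C) : ∫⁻ x, f x ∂μ ≤ C :=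
  lintegral_le_of_tendsto_of_tendsto hF hlim hC tendsto_const_nhds

/-! ### From averages in time to almost every time -/

section StepAverage

theorem integral_deriv_stepFn {b₁ b₂ : ℝ} (hb : b₁ < b₂) :
    ∫ t, deriv (stepFn b₁ b₂) t = 1 := by
  have hs : ContDiff ℝ 1 (stepFn b₁ b₂) := contDiff_stepFn.of_le (by simp)
  have h1 : ∫ t in b₁..b₂, deriv (stepFn b₁ b₂) t = 1 := by
    rw [intervalIntegral.integral_deriv_eq_sub (fun x _ => differentiable_stepFn x)
      ((hs.continuous_deriv le_rfl).intervalIntegrable _ _), stepFn_eq_one hb le_rfl,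
      stepFn_eq_zero hb le_rfl, sub_zero]
  rw [← h1, intervalIntegral.integral_of_le hb.le,
    setIntegral_eq_integral_of_forall_compl_eq_zero]
  intro t ht
  rw [mem_Ioc, not_and_or, not_lt, not_le] at ht
  rcases ht with ht | ht
  · exact deriv_stepFn_of_le hb ht
  · exact deriv_stepFn_of_ge hb ht.le

/-- The derivatives of steps from `t - r` to `t + r` have mass one, live in the ball of radius `r`
and are bounded by a constant over its length. They form an approximate identity that recovers `H`
at Lebesgue points. -/
theorem ae_le_of_integral_deriv_stepFn_mul_le {H : ℝ → ℝ} (hH : LocallyIntegrable H) {c d M : ℝ}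
    (h : ∀ b₁ b₂, b₁ < b₂ → b₂ < d → ∫ t, deriv (stepFn b₁ b₂) t * H t ≤ M) :
    ∀ᵐ t ∂volume.restrict (Ioo c d), H t ≤ M := by
  have hL := one_le_transitionBound
  filter_upwards [ae_restrict_of_ae
    ((Besicovitch.vitaliFamily (volume : Measure ℝ)).ae_tendsto_average_norm_sub hH),
    ae_restrict_mem measurableSet_Ioo] with t ht htd
  have h1 := ht.comp (Besicovitch.tendsto_filterAt volume t)
  have hT := tendsto_integral_smul_of_tendsto_average_norm_sub (l := 𝓝[>] (0 : ℝ))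
    (g := fun r => deriv (stepFn (t - r) (t + r))) transitionBound h1 ?_ ?_ ?_ ?_
  · refine le_of_tendsto hT ?_
    have hd : 0 < d - t := by linarith [htd.2]
    filter_upwards [Ioo_mem_nhdsGT hd] with r hr
    exact h (t - r) (t + r) (by linarith [hr.1]) (by linarith [hr.2])
  · exact Eventually.of_forall fun r => hH.integrableOn_isCompact (isCompact_closedBall _ _)
  · refine tendsto_const_nhds.congr' ?_
    filter_upwards [self_mem_nhdsWithin] with r hr
    have hr0 : 0 < r := hr
    exact (integral_deriv_stepFn (by linarith)).symm
  · filter_upwards [self_mem_nhdsWithin] with r hr y hy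
    have hr0 : 0 < r := hr
    change y ∈ Metric.closedBall t r
    rw [Real.closedBall_eq_Icc]
    by_contra hy'
    rw [mem_Icc, not_and_or, not_le, not_le] at hy'
    refine hy ?_
    rcases hy' with hy' | hy'
    · exact deriv_stepFn_of_le (by linarith) hy'.le
    · exact deriv_stepFn_of_ge (by linarith) hy'.le
  · filter_upwards [self_mem_nhdsWithin] with r hr y
    have hr0 : 0 < r := hr
    refine (abs_deriv_stepFn_le (by linarith) y).trans (le_of_eq ?_)
    change _ = transitionBound / volume.real (Metric.closedBall t r)
    rw [Real.volume_real_closedBall hr0.le]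
    congr 1; ring

theorem ae_integral_slice_le {X : Type*} [MeasureSpace X] [SigmaFinite (volume : Measure X)]
    {F : X × ℝ → ℝ} (hF : Integrable F ((volume : Measure X).prod volume)) {c d M : ℝ}
    (h : ∀ b₁ b₂, b₁ < b₂ → b₂ < d →
      ∫ z, deriv (stepFn b₁ b₂) z.2 * F z ∂(volume : Measure X).prod volume ≤ M) :
    ∀ᵐ t ∂volume.restrict (Ioo c d), Integrable (fun x => F (x, t)) ∧ ∫ x, F (x, t) ≤ M := by
  have hHi : Integrable fun t => ∫ x, F (x, t) := hF.integral_prod_right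
  have hle : ∀ b₁ b₂, b₁ < b₂ → b₂ < d →
      ∫ t, deriv (stepFn b₁ b₂) t * ∫ x, F (x, t) ≤ M := by
    intro b₁ b₂ hb hbd
    refine le_trans (le_of_eq ?_) (h b₁ b₂ hb hbd)
    have hcs : ContDiff ℝ 1 (stepFn b₁ b₂) := contDiff_stepFn.of_le (by simp)
    have hdc : Continuous (deriv (stepFn b₁ b₂)) := hcs.continuous_deriv le_rfl
    have hmi : Integrable (fun z : X × ℝ => deriv (stepFn b₁ b₂) z.2 * F z)
        ((volume : Measure X).prod volume) := by
      refine hF.bdd_mul (c := transitionBound / (b₂ - b₁))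
        (hdc.measurable.comp measurable_snd).aestronglyMeasurable
        (Eventually.of_forall fun z => ?_)
      exact abs_deriv_stepFn_le hb _
    rw [integral_prod_symm _ hmi]
    simp only [integral_const_mul]
  filter_upwards [ae_le_of_integral_deriv_stepFn_mul_le (c := c) hHi.locallyIntegrable hle,
    ae_restrict_of_ae hF.prod_left_ae] with t ht hti
  exact ⟨hti, ht⟩

end StepAverage

/-! ### Slice and gradient estimates without regularization -/

section Energy

variable {n : ℕ} {g : GenPoly} {lam : ℝ} {U : Opens (Space n)} {T : ℝ} {u : Space n × ℝ → ℝ}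
  {G : Space n × ℝ → Space n}

theorem tendsto_one_add_inv_mul (s : ℝ) :
    Tendsto (fun i : ℕ => 1 + ((i : ℝ) + 1)⁻¹ * s) atTop (𝓝 1) := by
  have h : Tendsto (fun i : ℕ => ((i : ℝ) + 1)⁻¹) atTop (𝓝 0) := by
    simpa [one_div] using tendsto_one_div_add_atTop_nhds_zero_nat (𝕜 := ℝ)
  simpa using (h.mul_const s).const_add 1

theorem tendsto_div_one_add_inv_mul_rpow {s : ℝ} (hs : 0 < s) (e : ℝ) :
    Tendsto (fun i : ℕ => (s / (1 + ((i : ℝ) + 1)⁻¹ * s)) ^ e) atTop (𝓝 (s ^ e)) := by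
  have h1 : Tendsto (fun i : ℕ => s / (1 + ((i : ℝ) + 1)⁻¹ * s)) atTop (𝓝 (s / 1)) :=
    tendsto_const_nhds.div (tendsto_one_add_inv_mul s) one_ne_zero
  rw [div_one] at h1
  exact h1.rpow_const (Or.inl hs.ne')

/-- Drop the gradient term of `energy_tested` and let the interval `[b₁, b₂]` contract to a point:
the time average becomes the value on almost every slice. -/
theorem energy_sup_regularized (h : IsMeasurableWeakSolution g lam (cylinder U T) u G)
    (hlam : lam ∈ Ioc (0 : ℝ) 1) (ha : 1 - lam < g.a) {l m γ τ : ℝ} (hl : 0 < l) (hlm : l < m)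
    (hτ : 0 < τ) (hγ : 1 ≤ γ)
    {ζ : Space n → ℝ} (hζ : ContDiff ℝ ((⊤ : ℕ∞) : WithTop ℕ∞) ζ) (hζ0 : ∀ x, 0 ≤ ζ x)
    (hζ1 : ∀ x, ζ x ≤ 1) {V : Set (Space n)} (hV : MeasurableSet V)
    (hζc : HasCompactSupport ζ) (hζV : tsupport ζ ⊆ V) (hVU : V ⊆ (U : Set (Space n)))
    {Λx : ℝ} (hΛx : ∀ x, ‖gradient ζ x‖ ≤ Λx)
    {t₁ t₂ t₃ : ℝ} (h0 : 0 ≤ t₁) (h12 : t₁ < t₂) (h23 : t₂ < t₃)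
    (hN : IntegrableOn (levelPow u l (γ + lam)) (V ×ˢ Ioo t₁ T)) :
    ∀ᵐ t ∂volume.restrict (Ioo t₃ T),
      ∫⁻ x, ENNReal.ofReal (stieltjesPrimitive (truncPow l m γ τ) lam (u (x, t)) * ζ x ^ 2) ≤
      ENNReal.ofReal (energyConst g lam l m γ (transitionBound / (t₃ - t₂)) Λx *
        ∫ z in V ×ˢ Ioo t₁ T, levelPow u l (γ + lam) z) := by
  set M := energyConst g lam l m γ (transitionBound / (t₃ - t₂)) Λx *
        ∫ z in V ×ˢ Ioo t₁ T, levelPow u l (γ + lam) z with hM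
  set S : Set (Space n × ℝ) := V ×ˢ Ioo t₁ T with hS
  have hSm : MeasurableSet S := hV.prod measurableSet_Ioo
  have hγ0 : 0 ≤ γ := by linarith
  have hfs : Continuous (truncPow l m γ τ) := (contDiff_truncPow hl hlm hτ).continuous
  have hΦ0 : ∀ z, 0 ≤ stieltjesPrimitive (truncPow l m γ τ) lam (u z) := fun z =>
    stieltjesPrimitive_nonneg hfs (monotone_truncPow hl hlm hτ hγ0)
      (truncPow_nonneg hl hlm hτ) hlam.1 (h.nonneg z)
  have hΦm : Measurable fun z => stieltjesPrimitive (truncPow l m γ τ) lam (u z) :=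
    (continuous_stieltjesPrimitive hfs hlam.1).measurable.comp h.measurable
  have hζm : Measurable fun z : Space n × ℝ => ζ z.1 :=
    hζ.continuous.measurable.comp measurable_fst
  have hϑm : Measurable fun z : Space n × ℝ => stepFn t₂ t₃ z.2 :=
    contDiff_stepFn.continuous.measurable.comp measurable_snd
  set Φ := stieltjesPrimitive (truncPow l m γ τ) lam with hΦ
  set F : Space n × ℝ → ℝ := S.indicator fun z => Φ (u z) * ζ z.1 ^ 2 * stepFn t₂ t₃ z.2 with hF
  have hNi : Integrable (S.indicator (levelPow u l (γ + lam))) := hN.integrable_indicator hSm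
  have hFi : Integrable F := by
    refine hNi.mono' ?_ (Eventually.of_forall fun z => ?_)
    · exact (((hΦm.mul (hζm.pow_const 2)).mul hϑm).indicator hSm).aestronglyMeasurable
    · by_cases hz : z ∈ S
      · rw [hF, indicator_of_mem hz, indicator_of_mem hz, Real.norm_of_nonneg
          (mul_nonneg (mul_nonneg (hΦ0 z) (by positivity)) (stepFn_nonneg _))]
        have e1 : Φ (u z) ≤ levelPow u l (γ + lam) z :=
          stieltjesPrimitive_truncPow_le hl hlm hτ hγ0 hlam.1 (h.nonneg z)
        calc _ ≤ Φ (u z) * 1 * 1 := by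
              have := hΦ0 z
              have e2 := hζ0 z.1
              have e3 := hζ1 z.1
              have e4 : ζ z.1 ^ 2 ≤ 1 := pow_le_one₀ e2 e3
              have e5 := stepFn_le_one (l := t₂) (m := t₃) z.2
              have e6 := stepFn_nonneg (l := t₂) (m := t₃) z.2
              gcongr
          _ ≤ _ := by rw [mul_one, mul_one]; exact e1
      · rw [hF, indicator_of_notMem hz, indicator_of_notMem hz, norm_zero]
  have hle : ∀ b₁ b₂, b₁ < b₂ → b₂ < T →
      ∫ z : Space n × ℝ, deriv (stepFn b₁ b₂) z.2 * F z ≤ M := by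
    intro b₁ b₂ hb hbT
    obtain ⟨hPi, hP⟩ := energy_tested h hlam ha hl hlm hτ hγ hζ hζ0 hζ1 hV hζc hζV hVU hΛx
      h0 h12 h23 hb hbT hN
    have hmi : Integrable fun z : Space n × ℝ => deriv (stepFn b₁ b₂) z.2 * F z := by
      have hcs : ContDiff ℝ 1 (stepFn b₁ b₂) := contDiff_stepFn.of_le (by simp)
      refine hFi.bdd_mul (c := transitionBound / (b₂ - b₁))
        ((hcs.continuous_deriv le_rfl).measurable.comp measurable_snd).aestronglyMeasurable
        (Eventually.of_forall fun z => ?_)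
      exact abs_deriv_stepFn_le hb _
    refine le_trans (integral_mono hmi hPi fun z => ?_) hP
    dsimp only
    have e2 := deriv_stepFn_nonneg hb z.2
    have e3 : 0 ≤ g.coercConst / 2 * (deriv (truncPow l m γ τ) (u z) *
        ‖G z‖ ^ (2 - g.a) * ζ z.1 ^ 2) * (stepFn t₂ t₃ z.2 * (1 - stepFn b₁ b₂ z.2)) := by
      have q1 := g.coercConst_pos
      have q2 := deriv_truncPow_nonneg hl hlm hτ hγ0 (u z)
      have q3 := stepFn_nonneg (l := t₂) (m := t₃) z.2
      have q4 : 0 ≤ 1 - stepFn b₁ b₂ z.2 := sub_nonneg.2 (stepFn_le_one _)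
      positivity
    have e4 : ∀ z : Space n × ℝ, 0 ≤ Φ (u z) * ζ z.1 ^ 2 * stepFn t₂ t₃ z.2 := fun z =>
      mul_nonneg (mul_nonneg (hΦ0 z) (by positivity)) (stepFn_nonneg _)
    have e5 : F z ≤ Φ (u z) * ζ z.1 ^ 2 * stepFn t₂ t₃ z.2 :=
      indicator_le_self' (fun z _ => e4 z) z
    refine le_add_of_le_of_nonneg ?_ e3
    rw [mul_comm (deriv (stepFn b₁ b₂) z.2)]
    exact mul_le_mul_of_nonneg_right e5 e2
  rw [Measure.volume_eq_prod] at hFi hle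
  filter_upwards [ae_integral_slice_le (c := t₃) hFi hle,
    ae_restrict_mem measurableSet_Ioo] with t ht htm
  obtain ⟨hti, ht⟩ := ht
  have hFt : ∀ x, F (x, t) = Φ (u (x, t)) * ζ x ^ 2 := by
    intro x
    by_cases hx : x ∈ V
    · have : (x, t) ∈ S := ⟨hx, ⟨by linarith [htm.1], htm.2⟩⟩
      rw [hF, indicator_of_mem this, stepFn_eq_one h23 htm.1.le, mul_one]
    · have : (x, t) ∉ S := fun h' => hx h'.1
      rw [hF, indicator_of_notMem this, image_eq_zero_of_notMem_tsupport
        (fun h' => hx (hζV h'))]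
      simp
  calc _ = ∫⁻ x, ENNReal.ofReal (F (x, t)) := by simp only [hFt]
    _ = ENNReal.ofReal (∫ x, F (x, t)) := by
      rw [ofReal_integral_eq_lintegral_ofReal hti]
      refine Eventually.of_forall fun x => ?_
      simp only [hFt]
      exact mul_nonneg (hΦ0 _) (by positivity)
    _ ≤ _ := ENNReal.ofReal_le_ofReal ht

/-- Fatou's lemma as `τ → 0`. The second level gap, from `m` to `m'`, is what converts the primitive
back into a power of `u`. -/
theorem energy_sup (h : IsMeasurableWeakSolution g lam (cylinder U T) u G)
    (hlam : lam ∈ Ioc (0 : ℝ) 1) (ha : 1 - lam < g.a) {l m m' γ : ℝ} (hl : 0 < l) (hlm : l < m)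
    (hmm' : m < m') (hγ : 1 ≤ γ)
    {ζ : Space n → ℝ} (hζ : ContDiff ℝ ((⊤ : ℕ∞) : WithTop ℕ∞) ζ) (hζ0 : ∀ x, 0 ≤ ζ x)
    (hζ1 : ∀ x, ζ x ≤ 1) {V : Set (Space n)} (hV : MeasurableSet V)
    (hζc : HasCompactSupport ζ) (hζV : tsupport ζ ⊆ V) (hVU : V ⊆ (U : Set (Space n)))
    {Λx : ℝ} (hΛx : ∀ x, ‖gradient ζ x‖ ≤ Λx)
    {t₁ t₂ t₃ : ℝ} (h0 : 0 ≤ t₁) (h12 : t₁ < t₂) (h23 : t₂ < t₃)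
    (hN : IntegrableOn (levelPow u l (γ + lam)) (V ×ˢ Ioo t₁ T)) :
    ∀ᵐ t ∂volume.restrict (Ioo t₃ T),
      ∫⁻ x, ENNReal.ofReal (lam * (1 - m / m') * (m / m') ^ γ *
        (levelPow u m' (γ + lam) (x, t) * ζ x ^ 2)) ≤
      ENNReal.ofReal (energyConst g lam l m γ (transitionBound / (t₃ - t₂)) Λx *
        ∫ z in V ×ˢ Ioo t₁ T, levelPow u l (γ + lam) z) := by
  set M := energyConst g lam l m γ (transitionBound / (t₃ - t₂)) Λx *
        ∫ z in V ×ˢ Ioo t₁ T, levelPow u l (γ + lam) z with hM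
  set τ : ℕ → ℝ := fun i => ((i : ℝ) + 1)⁻¹ with hτdef
  have hτ : ∀ i, 0 < τ i := fun i => by positivity
  have hγ0 : 0 ≤ γ := by linarith
  have hm0 : 0 < m := hl.trans hlm
  have hm'0 : 0 < m' := hm0.trans hmm'
  have hfs : ∀ i, Continuous (truncPow l m γ (τ i)) := fun i =>
    (contDiff_truncPow hl hlm (hτ i)).continuous
  have hΦ0 : ∀ i z, 0 ≤ stieltjesPrimitive (truncPow l m γ (τ i)) lam (u z) := fun i z =>
    stieltjesPrimitive_nonneg (hfs i) (monotone_truncPow hl hlm (hτ i) hγ0)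
      (truncPow_nonneg hl hlm (hτ i)) hlam.1 (h.nonneg z)
  have hslice := fun i => energy_sup_regularized h hlam ha hl hlm (hτ i) hγ hζ hζ0 hζ1 hV hζc hζV
    hVU hΛx h0 h12 h23 hN
  have hr : m / m' ∈ Icc (0 : ℝ) 1 := ⟨by positivity, (div_le_one hm'0).2 hmm'.le⟩
  have hr1 : 0 ≤ lam * (1 - m / m') * (m / m') ^ γ := by
    have := hlam.1
    have : 0 ≤ 1 - m / m' := by linarith [hr.2]
    positivity
  -- The regularization runs through a sequence, so the exceptional null sets of times can be
  -- united.
  filter_upwards [ae_all_iff.2 hslice] with t ht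
  refine lintegral_le_of_tendsto (F := fun i x => ENNReal.ofReal (lam * (1 - m / m') *
    (m / m') ^ γ * ((if m' < u (x, t) then u (x, t) ^ lam *
      (u (x, t) / (1 + τ i * u (x, t))) ^ γ else 0) * ζ x ^ 2))) (fun i => ?_) ?_ fun i => ?_
  · have hut : Measurable fun x => u (x, t) := h.measurable.comp measurable_prodMk_right
    refine ENNReal.measurable_ofReal.comp (measurable_const.mul (Measurable.mul ?_
      (hζ.continuous.measurable.pow_const 2)))
    refine Measurable.ite (measurableSet_lt measurable_const hut) ?_ measurable_const
    exact (hut.pow_const _).mul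
      ((hut.div (measurable_const.add (measurable_const.mul hut))).pow_const _)
  · refine Eventually.of_forall fun x => ?_
    refine (ENNReal.continuous_ofReal.tendsto _).comp ((Tendsto.mul_const _ ?_).const_mul _)
    unfold levelPow
    split_ifs with hx
    · have hu0 : 0 < u (x, t) := hm'0.trans hx
      rw [add_comm γ, Real.rpow_add hu0]
      exact (tendsto_div_one_add_inv_mul_rpow hu0 γ).const_mul _
    · exact tendsto_const_nhds
  · refine le_trans (lintegral_mono fun x => ENNReal.ofReal_le_ofReal ?_) (ht i)
    rw [← mul_assoc]
    refine mul_le_mul_of_nonneg_right ?_ (by positivity)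
    split_ifs with hx
    · have hu0 : 0 < u (x, t) := hm'0.trans hx
      refine le_stieltjesPrimitive_truncPow hl hlm (hτ i) hγ0 hlam hr hu0 ?_
      rw [div_mul_eq_mul_div, le_div_iff₀ hm'0]
      gcongr
    · rw [mul_zero]; exact hΦ0 i _

theorem energy_grad (h : IsMeasurableWeakSolution g lam (cylinder U T) u G)
    (hlam : lam ∈ Ioc (0 : ℝ) 1) (ha : 1 - lam < g.a) {l m γ : ℝ} (hl : 0 < l) (hlm : l < m)
    (hγ : 1 ≤ γ)
    {ζ : Space n → ℝ} (hζ : ContDiff ℝ ((⊤ : ℕ∞) : WithTop ℕ∞) ζ) (hζ0 : ∀ x, 0 ≤ ζ x)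
    (hζ1 : ∀ x, ζ x ≤ 1) {V : Set (Space n)} (hV : MeasurableSet V)
    (hζc : HasCompactSupport ζ) (hζV : tsupport ζ ⊆ V) (hVU : V ⊆ (U : Set (Space n)))
    {Λx : ℝ} (hΛx : ∀ x, ‖gradient ζ x‖ ≤ Λx)
    {t₁ t₂ t₃ : ℝ} (h0 : 0 ≤ t₁) (h12 : t₁ < t₂) (h23 : t₂ < t₃)
    (hN : IntegrableOn (levelPow u l (γ + lam)) (V ×ˢ Ioo t₁ T)) :
    ∫⁻ z in univ ×ˢ Ioo t₃ T, ENNReal.ofReal (g.coercConst / 2 *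
        (levelPow u m (γ - 1) z * ‖G z‖ ^ (2 - g.a) * ζ z.1 ^ 2)) ≤
      ENNReal.ofReal (energyConst g lam l m γ (transitionBound / (t₃ - t₂)) Λx *
        ∫ z in V ×ˢ Ioo t₁ T, levelPow u l (γ + lam) z) := by
  set M := energyConst g lam l m γ (transitionBound / (t₃ - t₂)) Λx *
        ∫ z in V ×ˢ Ioo t₁ T, levelPow u l (γ + lam) z with hM
  set τ : ℕ → ℝ := fun i => ((i : ℝ) + 1)⁻¹ with hτdef
  have hτ : ∀ i, 0 < τ i := fun i => by positivity
  have hτ0 : Tendsto τ atTop (𝓝 0) := by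
    simpa [one_div] using tendsto_one_div_add_atTop_nhds_zero_nat (𝕜 := ℝ)
  have hγ0 : 0 ≤ γ := by linarith
  have hm0 : 0 < m := hl.trans hlm
  have hc := g.coercConst_pos
  have hζm : Measurable fun z : Space n × ℝ => ζ z.1 :=
    hζ.continuous.measurable.comp measurable_fst
  refine lintegral_le_of_tendsto (F := fun i z => ENNReal.ofReal (g.coercConst / 2 *
    ((if m < u z then (u z / (1 + τ i * u z)) ^ (γ - 1) / (1 + τ i * u z) ^ 2 else 0) *
      ‖G z‖ ^ (2 - g.a) * ζ z.1 ^ 2) * (stepFn t₂ t₃ z.2 *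
        (1 - stepFn (T - 2 * τ i) (T - τ i) z.2)))) (fun i => ?_) ?_ fun i => ?_
  · refine ENNReal.measurable_ofReal.comp (Measurable.mul (measurable_const.mul
      (Measurable.mul (Measurable.mul ?_ (h.measurable_grad.norm.pow_const _))
        (hζm.pow_const 2))) ?_)
    · refine Measurable.ite (measurableSet_lt measurable_const h.measurable) ?_ measurable_const
      have h1 : Measurable fun z => 1 + τ i * u z :=
        measurable_const.add (measurable_const.mul h.measurable)
      exact ((h.measurable.div h1).pow_const _).div (h1.pow_const 2)
    · exact (contDiff_stepFn.continuous.measurable.comp measurable_snd).mul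
        (measurable_const.sub (contDiff_stepFn.continuous.measurable.comp measurable_snd))
  · filter_upwards [ae_restrict_mem (MeasurableSet.univ.prod measurableSet_Ioo)] with z hz
    have hz3 : t₃ < z.2 := hz.2.1
    have hzT : z.2 < T := hz.2.2
    refine (ENNReal.continuous_ofReal.tendsto _).comp ?_
    have hstep : Tendsto (fun i => stepFn t₂ t₃ z.2 *
        (1 - stepFn (T - 2 * τ i) (T - τ i) z.2)) atTop (𝓝 1) := by
      refine tendsto_const_nhds.congr' ?_
      have hlt : 0 < (T - z.2) / 2 := by linarith
      filter_upwards [hτ0.eventually (gt_mem_nhds hlt)] with i hi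
      rw [stepFn_eq_one h23 hz3.le, stepFn_eq_zero (by linarith [hτ i]) (by linarith)]
      norm_num
    have h2 : Tendsto (fun i => (if m < u z then (u z / (1 + τ i * u z)) ^ (γ - 1) /
        (1 + τ i * u z) ^ 2 else 0)) atTop (𝓝 (levelPow u m (γ - 1) z)) := by
      unfold levelPow
      split_ifs with hx
      · have hu0 : 0 < u z := hm0.trans hx
        have h3 : Tendsto (fun i => (u z / (1 + τ i * u z)) ^ (γ - 1) / (1 + τ i * u z) ^ 2)
            atTop (𝓝 (u z ^ (γ - 1) / 1 ^ 2)) := (tendsto_div_one_add_inv_mul_rpow hu0 (γ - 1)).div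
          ((tendsto_one_add_inv_mul (u z)).pow 2) (by norm_num)
        rw [one_pow, div_one] at h3
        exact h3
      · exact tendsto_const_nhds
    simpa using (((h2.mul_const (‖G z‖ ^ (2 - g.a))).mul_const (ζ z.1 ^ 2)).const_mul
      (g.coercConst / 2)).mul hstep
  -- One parameter does both jobs: as `τ i → 0` the truncation becomes the power and the final
  -- cut-off, placed between `T - 2 τ i` and `T - τ i`, moves up to `T`.
  · obtain ⟨hPi, hP⟩ := energy_tested h hlam ha hl hlm (hτ i) hγ hζ hζ0 hζ1 hV hζc hζV hVU hΛx
      h0 h12 h23 (b₁ := T - 2 * τ i) (b₂ := T - τ i) (by linarith [hτ i]) (by linarith [hτ i]) hN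
    have hfs := (contDiff_truncPow (γ := γ) hl hlm (hτ i)).continuous
    have hΦ0 : ∀ z, 0 ≤ stieltjesPrimitive (truncPow l m γ (τ i)) lam (u z) := fun z =>
      stieltjesPrimitive_nonneg hfs (monotone_truncPow hl hlm (hτ i) hγ0)
        (truncPow_nonneg hl hlm (hτ i)) hlam.1 (h.nonneg z)
    have q1 : ∀ z : Space n × ℝ, 0 ≤ stieltjesPrimitive (truncPow l m γ (τ i)) lam (u z) *
        ζ z.1 ^ 2 * stepFn t₂ t₃ z.2 * deriv (stepFn (T - 2 * τ i) (T - τ i)) z.2 := fun z =>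
      mul_nonneg (mul_nonneg (mul_nonneg (hΦ0 z) (by positivity)) (stepFn_nonneg _))
        (deriv_stepFn_nonneg (by linarith [hτ i]) _)
    have q2 : ∀ z : Space n × ℝ, 0 ≤ stepFn t₂ t₃ z.2 *
        (1 - stepFn (T - 2 * τ i) (T - τ i) z.2) := fun z =>
      mul_nonneg (stepFn_nonneg _) (sub_nonneg.2 (stepFn_le_one _))
    have q3 : ∀ z, 0 ≤ deriv (truncPow l m γ (τ i)) (u z) := fun z =>
      deriv_truncPow_nonneg hl hlm (hτ i) hγ0 (u z)
    refine (setLIntegral_le_lintegral _ _).trans ?_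
    refine le_trans (lintegral_mono fun z => ENNReal.ofReal_le_ofReal ?_) (le_trans
      (le_of_eq (ofReal_integral_eq_lintegral_ofReal hPi (Eventually.of_forall fun z => ?_)).symm)
      (ENNReal.ofReal_le_ofReal hP))
    · refine le_trans ?_ (le_add_of_nonneg_left (q1 z))
      refine mul_le_mul_of_nonneg_right ?_ (q2 z)
      have e1 : (if m < u z then (u z / (1 + τ i * u z)) ^ (γ - 1) / (1 + τ i * u z) ^ 2 else 0) ≤
          deriv (truncPow l m γ (τ i)) (u z) := by
        split_ifs with hx
        · exact le_deriv_truncPow hl hlm (hτ i) hγ hx.le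
        · exact q3 z
      gcongr
    · have := q1 z
      have := q2 z
      have := q3 z
      change 0 ≤ _
      positivity

end Energy

/-! ### Weighted and parabolic Sobolev inequalities -/

section Sobolev

variable {n : ℕ}

theorem norm_gradient_eq (v : Space n → ℝ) (x : Space n) : ‖gradient v x‖ = ‖fderiv ℝ v x‖ := by
  rw [gradient, LinearIsometryEquiv.norm_map]

/-- The Gagliardo–Nirenberg–Sobolev inequality, combined with Hölder's inequality against a
weight. -/
theorem exists_weighted_sobolev_const (hn : 2 ≤ n) {p : ℝ} (hp1 : 1 < p) (hp2 : p < 2) :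
    ∃ C : ℝ≥0, ∀ v : Space n → ℝ, ContDiff ℝ 1 v → HasCompactSupport v →
      ∀ M : Space n → ℝ≥0∞, Measurable M →
        ∫⁻ x, ‖v x‖ₑ ^ p * M x ^ (p / n) ≤
          C * (∫⁻ x, M x) ^ (p / n) * ∫⁻ x, ‖gradient v x‖ₑ ^ p := by
  have hn2 : (2 : ℝ) ≤ n := by exact_mod_cast hn
  have hn0 : (0 : ℝ) < n := by linarith
  have hnp : 0 < (n : ℝ) - p := by linarith
  have hp0 : 0 < p := by linarith
  set p' : ℝ := n * p / (n - p) with hp'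
  have hp'0 : 0 < p' := by positivity
  set C₀ := SNormLESNormFDerivOfEqConst ℝ (volume : Measure (Space n)) (p.toNNReal : ℝ) with hC₀
  refine ⟨C₀ ^ p, fun v hv hvc M hM => ?_⟩
  have hsob := eLpNorm_le_eLpNorm_fderiv_of_eq (volume : Measure (Space n)) hv hvc
    (p := p.toNNReal) (p' := p'.toNNReal) (by rw [Real.one_le_toNNReal]; exact hp1.le)
    (by simp; omega) (by
      rw [NNReal.coe_inv, Real.coe_toNNReal _ hp0.le, Real.coe_toNNReal _ hp'0.le,
        finrank_euclideanSpace_fin, hp']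
      field_simp)
  have hgrad : eLpNorm (fderiv ℝ v) (ENNReal.ofReal p) volume ^ p =
      ∫⁻ x, ‖gradient v x‖ₑ ^ p := by
    rw [eLpNorm_ofReal_rpow hp0]
    refine lintegral_congr fun x => ?_
    rw [← ofReal_norm, ← ofReal_norm, norm_gradient_eq]
  -- Raising `‖v‖ ^ p` to `n / (n - p)` gives the Sobolev exponent, raising `M ^ (p / n)` to `n / p`
  -- gives `M`. The strict inequality `p < n` comes from `p < 2 ≤ n`.
  have hPQ : (n / (n - p) : ℝ).HolderConjugate (n / p) := by
    rw [Real.holderConjugate_iff]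
    refine ⟨(one_lt_div hnp).2 (by linarith), ?_⟩
    rw [inv_div, inv_div]
    field_simp
    ring
  have hvm : Measurable fun x => ‖v x‖ₑ := hv.continuous.measurable.enorm
  calc ∫⁻ x, ‖v x‖ₑ ^ p * M x ^ (p / n)
      ≤ (∫⁻ x, (‖v x‖ₑ ^ p) ^ (n / (n - p) : ℝ)) ^ (1 / (n / (n - p) : ℝ)) *
        (∫⁻ x, (M x ^ (p / n)) ^ (n / p : ℝ)) ^ (1 / (n / p : ℝ)) :=
        ENNReal.lintegral_mul_le_Lp_mul_Lq volume hPQ (hvm.pow_const _).aemeasurable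
          (hM.pow_const _).aemeasurable
    _ = eLpNorm v (ENNReal.ofReal p') volume ^ p * (∫⁻ x, M x) ^ (p / n) := by
        congr 1
        · have e1 : ∀ x, (‖v x‖ₑ ^ p) ^ (n / (n - p) : ℝ) = ‖v x‖ₑ ^ p' := fun x => by
            rw [← ENNReal.rpow_mul]; congr 1; rw [hp']; ring
          simp only [e1]
          rw [← eLpNorm_ofReal_rpow hp'0, ← ENNReal.rpow_mul]
          congr 1
          rw [hp']; field_simp
        · have e1 : ∀ x, (M x ^ (p / n)) ^ (n / p : ℝ) = M x := fun x => by
            rw [← ENNReal.rpow_mul, show p / n * (n / p) = 1 by field_simp, ENNReal.rpow_one]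
          simp only [e1]
          congr 1
          field_simp
    _ ≤ (C₀ * eLpNorm (fderiv ℝ v) (ENNReal.ofReal p) volume) ^ p * (∫⁻ x, M x) ^ (p / n) := by
        gcongr
        exact hsob
    _ = _ := by
        rw [ENNReal.mul_rpow_of_nonneg _ _ hp0.le, hgrad, ENNReal.coe_rpow_of_nonneg _ hp0.le]
        ring

theorem lintegral_slab (I : Set ℝ) {f : Space n × ℝ → ℝ≥0∞} (hf : Measurable f) :
    ∫⁻ z in univ ×ˢ I, f z = ∫⁻ t in I, ∫⁻ x, f (x, t) := by
  rw [Measure.volume_eq_prod, ← Measure.prod_restrict, Measure.restrict_univ,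
    lintegral_prod_symm _ hf.aemeasurable]

/-- The weighted inequality is used on each time slice; the mass of the weight is bounded uniformly
in time and leaves the integral, and only the gradient is integrated. -/
theorem exists_parabolic_sobolev_const (hn : 2 ≤ n) {p : ℝ} (hp1 : 1 < p) (hp2 : p < 2) :
    ∃ C : ℝ≥0, ∀ (v : Space n × ℝ → ℝ) (I : Set ℝ) (M : Space n × ℝ → ℝ≥0∞) (E : ℝ≥0∞),
      ContDiff ℝ 1 v → (∀ t, HasCompactSupport fun x => v (x, t)) → Measurable M →
      (∀ᵐ t ∂volume.restrict I, ∫⁻ x, M (x, t) ≤ E) →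
        ∫⁻ z in univ ×ˢ I, ‖v z‖ₑ ^ p * M z ^ (p / n) ≤
          C * E ^ (p / n) * ∫⁻ z in univ ×ˢ I, ‖spaceGrad v z‖ₑ ^ p := by
  obtain ⟨C, hC⟩ := exists_weighted_sobolev_const hn hp1 hp2
  refine ⟨C, fun v I M E hv hvc hM hE => ?_⟩
  have hg := (continuous_spaceGrad hv).measurable.enorm.pow_const p
  have hvM : Measurable fun z => ‖v z‖ₑ ^ p * M z ^ (p / n) :=
    (hv.continuous.measurable.enorm.pow_const p).mul (hM.pow_const _)
  rw [lintegral_slab I hvM,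
    lintegral_slab I hg, ← lintegral_const_mul _ hg.lintegral_prod_left']
  refine lintegral_mono_ae ?_
  filter_upwards [hE] with t ht
  have hvt : ContDiff ℝ 1 fun x => v (x, t) := hv.comp (contDiff_id.prodMk contDiff_const)
  refine (hC _ hvt (hvc t) (fun x => M (x, t)) (hM.comp measurable_prodMk_right)).trans ?_
  unfold spaceGrad
  dsimp only
  gcongr

end Sobolev

/-- Convergence in `L^p` gives an upper bound for the `p`-energies that converges to the energy of
the limit. -/
theorem exists_tendsto_bound_lintegral_rpow {α E : Type*} [MeasurableSpace α] {μ : Measure α}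
    [NormedAddCommGroup E] {p : ℝ} (hp : 1 ≤ p) {a : ℕ → α → E} {b : α → E}
    (ha : ∀ i, AEStronglyMeasurable (a i) μ) (hb : AEStronglyMeasurable b μ)
    (h : Tendsto (fun i => ∫⁻ x, ‖a i x - b x‖ₑ ^ p ∂μ) atTop (𝓝 0)) :
    ∃ c : ℕ → ℝ≥0∞, (∀ i, ∫⁻ x, ‖a i x‖ₑ ^ p ∂μ ≤ c i) ∧
      Tendsto c atTop (𝓝 (∫⁻ x, ‖b x‖ₑ ^ p ∂μ)) := by
  have hp0 : 0 < p := by linarith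
  have hr : ∀ x : ℝ≥0∞, (x ^ (1 / p)) ^ p = x := fun x => by
    rw [← ENNReal.rpow_mul, one_div_mul_cancel hp0.ne', ENNReal.rpow_one]
  -- The bound is Minkowski's inequality raised to the power `p`; its first summand tends to zero.
  refine ⟨fun i => ((∫⁻ x, ‖a i x - b x‖ₑ ^ p ∂μ) ^ (1 / p) +
    (∫⁻ x, ‖b x‖ₑ ^ p ∂μ) ^ (1 / p)) ^ p, fun i => ?_, ?_⟩
  · have h1 : eLpNorm (a i) (ENNReal.ofReal p) μ ≤
        eLpNorm (fun x => a i x - b x) (ENNReal.ofReal p) μ + eLpNorm b (ENNReal.ofReal p) μ := by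
      have := eLpNorm_add_le (p := ENNReal.ofReal p) ((ha i).sub hb) hb
        (ENNReal.one_le_ofReal.2 hp)
      have e : (fun x => a i x - b x) + b = a i := by ext x; simp
      rwa [show a i - b = fun x => a i x - b x from rfl, e] at this
    have h2 : ∀ F : α → E, eLpNorm F (ENNReal.ofReal p) μ = (∫⁻ x, ‖F x‖ₑ ^ p ∂μ) ^ (1 / p) := by
      intro F
      rw [← eLpNorm_ofReal_rpow hp0, ← ENNReal.rpow_mul, mul_one_div_cancel hp0.ne',
        ENNReal.rpow_one]
    rw [← eLpNorm_ofReal_rpow hp0]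
    rw [h2 (fun x => a i x - b x), h2 b] at h1
    exact ENNReal.rpow_le_rpow h1 hp0.le
  · have h1 : Tendsto (fun i => (∫⁻ x, ‖a i x - b x‖ₑ ^ p ∂μ) ^ (1 / p)) atTop (𝓝 (0 ^ (1 / p))) :=
      (ENNReal.continuous_rpow_const.tendsto _).comp h
    rw [ENNReal.zero_rpow_of_pos (by positivity)] at h1
    have h2 := (ENNReal.continuous_rpow_const (y := p)).tendsto _ |>.comp
      (h1.add_const ((∫⁻ x, ‖b x‖ₑ ^ p ∂μ) ^ (1 / p)))
    rw [zero_add, hr] at h2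
    exact h2

/-! ### The parabolic Sobolev inequality for weak solutions -/

section Limit

variable {n : ℕ} {Q : Opens (Space n × ℝ)} {U : Opens (Space n)} {T : ℝ} {u : Space n × ℝ → ℝ}
  {G : Space n × ℝ → Space n}

/-- Apply the smooth inequality to `f(w_i) ζ`. The left side passes to the limit by Fatou, the right
side by `L^p` convergence of the gradients. The conditions `0 < s₁` and `s₂ < T` keep the support
compact inside the cylinder, where the approximation is available. -/
theorem exists_parabolic_sobolev_comp_const (hn : 2 ≤ n) {p : ℝ} (hp1 : 1 < p) (hp2 : p < 2) :
    ∃ C : ℝ≥0, ∀ (U : Opens (Space n)) (T : ℝ) (u : Space n × ℝ → ℝ) (G : Space n × ℝ → Space n),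
      Measurable u → Measurable G →
      LocallyIntegrableOn u (cylinder U T : Set (Space n × ℝ)) →
      LocallyIntegrableOn G (cylinder U T : Set (Space n × ℝ)) →
      LocallyIntegrableOn (fun z => ‖G z‖ ^ p) (cylinder U T : Set (Space n × ℝ)) →
      IsWeakSpaceGrad (cylinder U T) u G →
      ∀ (f : ℝ → ℝ) (B : ℝ≥0) (ζ : Space n → ℝ) (s₁ s₂ : ℝ) (M : Space n × ℝ → ℝ≥0∞) (E : ℝ≥0∞),
      ContDiff ℝ 1 f → (∀ s, ‖f s‖₊ ≤ B) → (∀ s, ‖deriv f s‖₊ ≤ B) →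
      ContDiff ℝ ((⊤ : ℕ∞) : WithTop ℕ∞) ζ → HasCompactSupport ζ →
      tsupport ζ ⊆ (U : Set (Space n)) → 0 < s₁ → s₂ < T →
      Measurable M → (∀ z, M z ≠ ⊤) → E ≠ ⊤ →
      (∀ᵐ t ∂volume.restrict (Ioo s₁ s₂), ∫⁻ x, M (x, t) ≤ E) →
      ∫⁻ z in univ ×ˢ Ioo s₁ s₂, ‖f (u z) * ζ z.1‖ₑ ^ p * M z ^ (p / n) ≤
        C * E ^ (p / n) * ∫⁻ z in univ ×ˢ Ioo s₁ s₂,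
          ‖(deriv f (u z) * ζ z.1) • G z + f (u z) • gradient ζ z.1‖ₑ ^ p := by
  obtain ⟨C, hC⟩ := exists_parabolic_sobolev_const hn hp1 hp2
  refine ⟨C, fun U T u G hu hG hul hGl hGp hw f B ζ s₁ s₂ M E hf hfB hfB' hζ hζc hζU hs₁ hs₂ hM
    hMt hEt hE => ?_⟩
  set K : Set (Space n × ℝ) := tsupport ζ ×ˢ Icc s₁ s₂ with hK
  set J : Set (Space n × ℝ) := univ ×ˢ Ioo s₁ s₂ with hJ
  have hKc : IsCompact K := hζc.isCompact.prod isCompact_Icc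
  have hKm : MeasurableSet K := hKc.measurableSet
  have hJm : MeasurableSet J := MeasurableSet.univ.prod measurableSet_Ioo
  have hKQ : K ⊆ (cylinder U T : Set (Space n × ℝ)) := fun z hz =>
    ⟨hζU hz.1, hs₁.trans_le hz.2.1, hz.2.2.trans_lt hs₂⟩
  have hζ1 : ContDiff ℝ 1 ζ := hζ.of_le (by simp)
  have hη : ContDiff ℝ 1 fun z : Space n × ℝ => ζ z.1 := hζ1.comp contDiff_fst
  have hgc : Continuous fun x => gradient ζ x :=
    (InnerProductSpace.toDual ℝ (Space n)).symm.continuous.comp (hζ1.continuous_fderiv one_ne_zero)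
  have hgs : ∀ x, x ∉ tsupport ζ → gradient ζ x = 0 := fun x hx => by
    rw [gradient, fderiv_of_notMem_tsupport ℝ hx, map_zero]
  obtain ⟨B₁, hB₁⟩ := hζ.continuous.bounded_above_of_compact_support hζc
  obtain ⟨B₂, hB₂⟩ := hgc.bounded_above_of_compact_support
    (HasCompactSupport.of_support_subset_isCompact hζc.isCompact fun x hx => by
      by_contra h; exact hx (hgs x h))
  set B' : ℝ≥0 := max B (max B₁.toNNReal B₂.toNNReal) with hB'
  have hGK : ∫⁻ z in K, ‖G z‖ₑ ^ p ≠ ⊤ := by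
    have h1 := (hGp.mono_set hKQ).integrableOn_isCompact hKc
    have h2 := h1.hasFiniteIntegral.ne
    refine ne_of_eq_of_ne (lintegral_congr fun z => ?_) h2
    rw [Real.enorm_of_nonneg (by positivity), ← ofReal_norm,
      ENNReal.ofReal_rpow_of_nonneg (norm_nonneg _) (by linarith)]
  obtain ⟨w, hws, hwu, hwG⟩ := exists_smooth_approx hp1.le hul hG hGl hGp hw hKc hKQ
  have hws1 : ∀ i, ContDiff ℝ 1 (w i) := fun i => (hws i).of_le (by simp)
  have hlim := tendsto_lintegral_spaceGrad_comp_mul hp1.le hKc.measure_lt_top.ne hu hG hGK hws1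
    hwu hwG hf hη (B := B') (fun s => (hfB s).trans (le_max_left _ _))
    (fun s => (hfB' s).trans (le_max_left _ _))
    (fun z => (NNReal.le_toNNReal_of_coe_le (hB₁ z.1)).trans
      ((le_max_left _ _).trans (le_max_right _ _)))
    (fun z => (NNReal.le_toNNReal_of_coe_le (hB₂ z.1)).trans
      ((le_max_right _ _).trans (le_max_right _ _)))
  set b : Space n × ℝ → Space n := fun z =>
    (deriv f (u z) * ζ z.1) • G z + f (u z) • gradient ζ z.1 with hb
  have hbm : Measurable b := by
    refine Measurable.add (Measurable.smul (Measurable.mul ?_ hη.continuous.measurable) hG)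
      (Measurable.smul (hf.continuous.measurable.comp hu) (hgc.measurable.comp measurable_fst))
    exact (hf.continuous_deriv le_rfl).measurable.comp hu
  have hv : ∀ i, ContDiff ℝ 1 fun z => f (w i z) * ζ z.1 := fun i =>
    (hf.comp (hws1 i)).mul hη
  obtain ⟨c, hc, hcl⟩ := exists_tendsto_bound_lintegral_rpow hp1.le
    (fun i => (continuous_spaceGrad (hv i)).aestronglyMeasurable)
    hbm.aestronglyMeasurable hlim
  have hbK : ∫⁻ z in K, ‖b z‖ₑ ^ p ≤ ∫⁻ z in J, ‖b z‖ₑ ^ p := by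
    have hne : (K : Set (Space n × ℝ)) =ᵐ[volume] tsupport ζ ×ˢ Ioo s₁ s₂ := by
      rw [Measure.volume_eq_prod]
      exact Measure.set_prod_ae_eq (ae_eq_refl _) Ioo_ae_eq_Icc.symm
    rw [setLIntegral_congr hne]
    exact lintegral_mono_set (prod_mono (subset_univ _) Subset.rfl)
  have hvK : ∀ i, ∫⁻ z in J, ‖spaceGrad (fun z => f (w i z) * ζ z.1) z‖ₑ ^ p ≤
      ∫⁻ z in K, ‖spaceGrad (fun z => f (w i z) * ζ z.1) z‖ₑ ^ p := by
    intro i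
    rw [← lintegral_indicator hJm, ← lintegral_indicator hKm]
    refine lintegral_mono fun z => ?_
    by_cases hz : z ∈ K
    · rw [indicator_of_mem hz]
      exact indicator_le_self _ _ _
    · rw [indicator_of_notMem hz]
      by_cases hzJ : z ∈ J
      · have hzt : z.1 ∉ tsupport ζ := fun h => hz ⟨h, Ioo_subset_Icc_self hzJ.2⟩
        rw [indicator_of_mem hzJ, spaceGrad_eq_zero ((hv i).differentiable one_ne_zero)]
        · simp [show 0 < p by linarith]
        · intro h
          apply hzt
          have h1 : Function.support (fun z => f (w i z) * ζ z.1) ⊆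
              Prod.fst ⁻¹' tsupport ζ := fun y hy =>
            subset_tsupport _ (right_ne_zero_of_mul hy)
          exact closure_minimal h1 ((isClosed_tsupport ζ).preimage continuous_fst) h
      · rw [indicator_of_notMem hzJ]
  have hCE : (C : ℝ≥0∞) * E ^ (p / n) ≠ ⊤ :=
    ENNReal.mul_ne_top ENNReal.coe_ne_top (ENNReal.rpow_ne_top_of_nonneg (by positivity) hEt)
  refine (lintegral_le_of_tendsto_of_tendsto (F := fun i z => ‖f (w i z) * ζ z.1‖ₑ ^ p *
    M z ^ (p / n)) (c := fun i => C * E ^ (p / n) * c i) (fun i => ?_) ?_ (fun i => ?_)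
    (ENNReal.Tendsto.const_mul hcl (Or.inr hCE))).trans (mul_le_mul_right hbK _)
  · exact ((hv i).continuous.measurable.enorm.pow_const p).mul (hM.pow_const _)
  · rw [ae_restrict_iff' hJm]
    rw [ae_restrict_iff' hKm] at hwu
    filter_upwards [hwu] with z hz hzJ
    refine ENNReal.Tendsto.mul_const ?_
      (Or.inr (ENNReal.rpow_ne_top_of_nonneg (by positivity) (hMt z)))
    refine (ENNReal.continuous_rpow_const.tendsto _).comp
      ((continuous_enorm.tendsto _).comp ?_)
    by_cases hzt : z.1 ∈ tsupport ζ
    · exact ((hf.continuous.tendsto _).comp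
        (hz ⟨hzt, Ioo_subset_Icc_self hzJ.2⟩)).mul_const _
    · simp [image_eq_zero_of_notMem_tsupport hzt]
  · refine (hC _ (Ioo s₁ s₂) M E (hv i) (fun t => ?_) hM hE).trans
      (mul_le_mul_right ((hvK i).trans (hc i)) _)
    exact hζc.mul_left

end Limit

theorem add_rpow_le_four_mul {x y p : ℝ} (hx : 0 ≤ x) (hy : 0 ≤ y) (hp0 : 0 ≤ p) (hp : p ≤ 2) :
    (x + y) ^ p ≤ 4 * (x ^ p + y ^ p) := by
  have hm : 0 ≤ max x y := hx.trans (le_max_left _ _)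
  calc (x + y) ^ p ≤ (2 * max x y) ^ p := by
        refine Real.rpow_le_rpow (by positivity) ?_ hp0
        linarith [le_max_left x y, le_max_right x y]
    _ = 2 ^ p * max x y ^ p := Real.mul_rpow (by norm_num) hm
    _ ≤ 4 * (x ^ p + y ^ p) := by
        have h2 : (2 : ℝ) ^ p ≤ 4 := by
          calc (2 : ℝ) ^ p ≤ 2 ^ (2 : ℝ) := Real.rpow_le_rpow_of_exponent_le (by norm_num) hp
            _ = 4 := by norm_num
        refine mul_le_mul h2 ?_ (by positivity) (by norm_num)
        rcases max_cases x y with h | h <;> rw [h.1]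
        · linarith [Real.rpow_nonneg hy p]
        · linarith [Real.rpow_nonneg hx p]

theorem levelPow_rpow {X : Type*} {u : X → ℝ} (hu : ∀ z, 0 ≤ u z) (l e : ℝ) {p : ℝ} (hp : 0 < p)
    (z : X) : levelPow u l e z ^ p = levelPow u l (e * p) z := by
  unfold levelPow
  split_ifs
  · rw [Real.rpow_mul (hu z)]
  · exact Real.zero_rpow hp.ne'

/-! ### Gain of integrability -/

section Gain

variable {n : ℕ} {g : GenPoly} {lam : ℝ} {U : Opens (Space n)} {T : ℝ} {u : Space n × ℝ → ℝ}
  {G : Space n × ℝ → Space n}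

/-- The exponent `q` is chosen so that `(q - 1) p = γ - 1`: then `‖∇ u ^ q‖ ^ p` is a multiple of `u
^ (γ - 1) ‖∇u‖ ^ p`, the quantity in the energy estimate. The gradient of `χ` meets `u ^ (q p)`,
whose exponent `α - D` is again below `α`. -/
theorem norm_grad_truncPow_rpow_le (hu : ∀ z, 0 ≤ u z) {p γ q m m' τ D Λ : ℝ} (hp1 : 1 < p)
    (hp2 : p < 2)
    (hγ : 1 ≤ γ) (hq : q * p = γ - 1 + p) (hm : 0 < m) (hmm' : m < m') (hτ : 0 < τ)
    (hD : 0 ≤ D) {α : ℝ} (hα : γ - 1 + p = α - D) {ζ χ : Space n → ℝ}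
    (hχ0 : ∀ x, 0 ≤ χ x) (hχ1 : ∀ x, χ x ≤ 1) (hΛ : ∀ x, ‖gradient χ x‖ ≤ Λ)
    (hζχ : ∀ x ∈ tsupport χ, ζ x = 1) (z : Space n × ℝ) :
    ‖(deriv (truncPow m m' q τ) (u z) * χ z.1) • G z +
        truncPow m m' q τ (u z) • gradient χ z.1‖ ^ p ≤
      4 * ((transitionBound / (m' - m) * m' + q) ^ p *
          (levelPow u m (γ - 1) z * ‖G z‖ ^ p * ζ z.1 ^ 2) +
        m ^ (-D) * Λ ^ p * (tsupport χ).indicator (fun _ => levelPow u m α z) z.1) := by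
  have hp0 : 0 < p := by linarith
  have hq1 : 1 ≤ q := by
    by_contra hcon
    have h1 : q * p < 1 * p := mul_lt_mul_of_pos_right (not_le.1 hcon) hp0
    linarith
  have hL := one_le_transitionBound
  have hc : 0 ≤ transitionBound / (m' - m) * m' + q := by
    have : 0 < m' - m := by linarith
    have : 0 < m' := by linarith
    positivity
  set c₁ := transitionBound / (m' - m) * m' + q with hc₁
  have hΛ0 : 0 ≤ Λ := (norm_nonneg _).trans (hΛ 0)
  have hl1 := levelPow_nonneg hu m (γ - 1) z
  have hl2 := levelPow_nonneg hu m α z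
  by_cases hz : z.1 ∈ tsupport χ
  · rw [indicator_of_mem hz, hζχ _ hz]
    have hd0 := deriv_truncPow_nonneg hm hmm' hτ (γ := q) (by linarith) (u z)
    have h1 : deriv (truncPow m m' q τ) (u z) ≤ c₁ * levelPow u m (q - 1) z := by
      unfold levelPow
      split_ifs with hmu
      · exact deriv_truncPow_le hm hmm' hτ hq1 (hm.trans hmu)
      · rw [deriv_truncPow_of_le hm hmm' hτ (not_lt.1 hmu), mul_zero]
    have h2 : truncPow m m' q τ (u z) ≤ levelPow u m q z := by
      unfold levelPow
      split_ifs with hmu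
      · exact truncPow_le_rpow hm hmm' hτ (by linarith) (hu z)
      · rw [truncPow_of_le hmm' (not_lt.1 hmu)]
    have h20 := truncPow_nonneg (γ := q) hm hmm' hτ (u z)
    have hq0 := levelPow_nonneg hu m (q - 1) z
    have hq0' := levelPow_nonneg hu m q z
    have hN : ‖(deriv (truncPow m m' q τ) (u z) * χ z.1) • G z +
        truncPow m m' q τ (u z) • gradient χ z.1‖ ≤
        c₁ * levelPow u m (q - 1) z * ‖G z‖ + levelPow u m q z * Λ := by
      refine (norm_add_le _ _).trans ?_
      rw [norm_smul, norm_smul, Real.norm_of_nonneg (mul_nonneg hd0 (hχ0 _)),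
        Real.norm_of_nonneg h20]
      have h3 : deriv (truncPow m m' q τ) (u z) * χ z.1 ≤ c₁ * levelPow u m (q - 1) z :=
        (mul_le_of_le_one_right hd0 (hχ1 _)).trans h1
      have := hΛ z.1
      gcongr
    have e1 : (q - 1) * p = γ - 1 := by linarith
    have e2 : q * p = α - D := by linarith
    calc _ ≤ (c₁ * levelPow u m (q - 1) z * ‖G z‖ + levelPow u m q z * Λ) ^ p :=
          Real.rpow_le_rpow (norm_nonneg _) hN hp0.le
      _ ≤ 4 * ((c₁ * levelPow u m (q - 1) z * ‖G z‖) ^ p + (levelPow u m q z * Λ) ^ p) :=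
          add_rpow_le_four_mul (by positivity) (by positivity) hp0.le hp2.le
      _ = 4 * (c₁ ^ p * (levelPow u m (γ - 1) z * ‖G z‖ ^ p * 1 ^ 2) +
          levelPow u m (α - D) z * Λ ^ p) := by
          rw [Real.mul_rpow (by positivity) (norm_nonneg _), Real.mul_rpow hc hq0,
            Real.mul_rpow hq0' hΛ0, levelPow_rpow hu _ _ hp0, levelPow_rpow hu _ _ hp0, e1, e2]
          ring
      _ ≤ _ := by
          have h5 := levelPow_sub_le (u := u) hm (α := α) hD z
          have h6 : levelPow u m (α - D) z * Λ ^ p ≤ m ^ (-D) * levelPow u m α z * Λ ^ p :=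
            mul_le_mul_of_nonneg_right h5 (by positivity)
          linarith
  · have h1 : gradient χ z.1 = 0 := by rw [gradient, fderiv_of_notMem_tsupport ℝ hz, map_zero]
    rw [h1, image_eq_zero_of_notMem_tsupport hz, mul_zero, zero_smul, smul_zero, add_zero,
      norm_zero, Real.zero_rpow hp0.ne', indicator_of_notMem hz, mul_zero, add_zero]
    positivity

/-- The constant in the time-uniform bound for the integral of `u ^ (γ + lam)` over super-level
sets. -/
noncomputable def supConst (g : GenPoly) (lam l m m' γ Λt Λx : ℝ) : ℝ :=
  energyConst g lam l m γ Λt Λx / (lam * (1 - m / m') * (m / m') ^ γ)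

/-- The constant in the bound for the gradient of the truncated power. -/
noncomputable def gradConst (g : GenPoly) (lam l m m' γ q Λt Λx Λ : ℝ) : ℝ :=
  4 * ((transitionBound / (m' - m) * m' + q) ^ (2 - g.a) *
    (2 / g.coercConst * energyConst g lam l m γ Λt Λx) + m ^ (-(lam - 1 + g.a)) * Λ ^ (2 - g.a))

theorem lintegral_grad_truncPow_le (h : IsMeasurableWeakSolution g lam (cylinder U T) u G)
    (hlam : lam ∈ Ioc (0 : ℝ) 1) (ha : 1 - lam < g.a) {l m m' γ q τ : ℝ} (hl : 0 < l) (hlm : l < m)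
    (hmm' : m < m') (hγ : 1 ≤ γ) (hq : q * (2 - g.a) = γ - 1 + (2 - g.a)) (hτ : 0 < τ)
    {ζ : Space n → ℝ} (hζ : ContDiff ℝ ((⊤ : ℕ∞) : WithTop ℕ∞) ζ) (hζ0 : ∀ x, 0 ≤ ζ x)
    (hζ1 : ∀ x, ζ x ≤ 1) {V : Set (Space n)} (hV : MeasurableSet V)
    (hζc : HasCompactSupport ζ) (hζV : tsupport ζ ⊆ V) (hVU : V ⊆ (U : Set (Space n)))
    {Λx : ℝ} (hΛx : ∀ x, ‖gradient ζ x‖ ≤ Λx)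
    {χ : Space n → ℝ} (hχ0 : ∀ x, 0 ≤ χ x) (hχ1 : ∀ x, χ x ≤ 1) {Λ : ℝ}
    (hΛ : ∀ x, ‖gradient χ x‖ ≤ Λ) (hζχ : ∀ x ∈ tsupport χ, ζ x = 1)
    {t₁ t₂ t₃ : ℝ} (h0 : 0 ≤ t₁) (h12 : t₁ < t₂) (h23 : t₂ < t₃)
    (hN : IntegrableOn (levelPow u l (γ + lam)) (V ×ˢ Ioo t₁ T)) :
    ∫⁻ z in univ ×ˢ Ioo t₃ T, ‖(deriv (truncPow m m' q τ) (u z) * χ z.1) • G z +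
        truncPow m m' q τ (u z) • gradient χ z.1‖ₑ ^ (2 - g.a) ≤
      ENNReal.ofReal (gradConst g lam l m m' γ q (transitionBound / (t₃ - t₂)) Λx Λ *
        ∫ z in V ×ˢ Ioo t₁ T, levelPow u l (γ + lam) z) := by
  have ha0 := g.a_pos
  have ha1 := g.a_lt_one
  have hp0 : 0 < 2 - g.a := by linarith
  have hm : 0 < m := hl.trans hlm
  have hm' : 0 < m' := hm.trans hmm'
  have hL := one_le_transitionBound
  have hcoer := g.coercConst_pos
  have hq0 : 0 ≤ q := by
    by_contra hcon
    have : q * (2 - g.a) < 0 := mul_neg_of_neg_of_pos (not_le.1 hcon) hp0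
    linarith
  have hΛ0 : 0 ≤ Λ := (norm_nonneg _).trans (hΛ 0)
  have hmd : 0 < m' - m := by linarith
  set E₀ := energyConst g lam l m γ (transitionBound / (t₃ - t₂)) Λx with hE₀
  set A := ∫ z in V ×ˢ Ioo t₁ T, levelPow u l (γ + lam) z with hA
  have hE₀0 : 0 ≤ E₀ := energyConst_nonneg hl hlm (by linarith)
    (div_nonneg (by linarith) (by linarith)) ((norm_nonneg _).trans (hΛx 0))
  have hA0 : 0 ≤ A := integral_nonneg fun z => levelPow_nonneg h.nonneg _ _ _
  set c₁ := (transitionBound / (m' - m) * m' + q) ^ (2 - g.a) with hc₁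
  set c₂ := m ^ (-(lam - 1 + g.a)) * Λ ^ (2 - g.a) with hc₂
  have hc₁0 : 0 ≤ c₁ := by positivity
  have hc₂0 : 0 ≤ c₂ := by positivity
  have hpt : ∀ z, ‖(deriv (truncPow m m' q τ) (u z) * χ z.1) • G z +
        truncPow m m' q τ (u z) • gradient χ z.1‖ₑ ^ (2 - g.a) ≤
      ENNReal.ofReal (4 * c₁ * (2 / g.coercConst)) * ENNReal.ofReal (g.coercConst / 2 *
          (levelPow u m (γ - 1) z * ‖G z‖ ^ (2 - g.a) * ζ z.1 ^ 2)) +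
        ENNReal.ofReal (4 * c₂) * (tsupport χ).indicator
          (fun _ => ENNReal.ofReal (levelPow u l (γ + lam) z)) z.1 := by
    intro z
    have h1 := norm_grad_truncPow_rpow_le (G := G) h.nonneg (p := 2 - g.a) (D := lam - 1 + g.a)
      (α := γ + lam) (by linarith) (by linarith) hγ hq hm hmm' hτ (by linarith) (by ring) hχ0 hχ1
      hΛ hζχ z
    have hl1 := levelPow_nonneg h.nonneg m (γ - 1) z
    have hl2 := levelPow_nonneg h.nonneg l (γ + lam) z
    have h2 : (tsupport χ).indicator (fun _ => levelPow u m (γ + lam) z) z.1 ≤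
        (tsupport χ).indicator (fun _ => levelPow u l (γ + lam) z) z.1 :=
      indicator_le_indicator (levelPow_anti h.nonneg hlm.le _ z)
    have h3 : (tsupport χ).indicator (fun _ => ENNReal.ofReal (levelPow u l (γ + lam) z)) z.1 =
        ENNReal.ofReal ((tsupport χ).indicator (fun _ => levelPow u l (γ + lam) z) z.1) := by
      by_cases hz : z.1 ∈ tsupport χ
      · rw [indicator_of_mem hz, indicator_of_mem hz]
      · rw [indicator_of_notMem hz, indicator_of_notMem hz, ENNReal.ofReal_zero]
    have h4 : 0 ≤ (tsupport χ).indicator (fun _ => levelPow u l (γ + lam) z) z.1 :=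
      indicator_nonneg (fun _ _ => hl2) _
    rw [h3, ← ENNReal.ofReal_mul (by positivity), ← ENNReal.ofReal_mul (by positivity),
      ← ENNReal.ofReal_add (by positivity) (by positivity), ← ofReal_norm,
      ENNReal.ofReal_rpow_of_nonneg (norm_nonneg _) hp0.le]
    refine ENNReal.ofReal_le_ofReal (h1.trans ?_)
    have h5 : c₂ * (tsupport χ).indicator (fun _ => levelPow u m (γ + lam) z) z.1 ≤
        c₂ * (tsupport χ).indicator (fun _ => levelPow u l (γ + lam) z) z.1 :=
      mul_le_mul_of_nonneg_left h2 hc₂0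
    have h6 : 4 * c₁ * (2 / g.coercConst) * (g.coercConst / 2 *
        (levelPow u m (γ - 1) z * ‖G z‖ ^ (2 - g.a) * ζ z.1 ^ 2)) =
        4 * (c₁ * (levelPow u m (γ - 1) z * ‖G z‖ ^ (2 - g.a) * ζ z.1 ^ 2)) := by
      field_simp
    rw [h6]
    linarith
  have hsec : ∫⁻ z in univ ×ˢ Ioo t₃ T, (tsupport χ).indicator
      (fun _ => ENNReal.ofReal (levelPow u l (γ + lam) z)) z.1 ≤ ENNReal.ofReal A := by
    rw [hA, ofReal_integral_eq_lintegral_ofReal hN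
      (Eventually.of_forall fun z => levelPow_nonneg h.nonneg _ _ _),
      ← lintegral_indicator (MeasurableSet.univ.prod measurableSet_Ioo),
      ← lintegral_indicator (hV.prod measurableSet_Ioo)]
    refine lintegral_mono fun z => ?_
    by_cases hzJ : z ∈ univ ×ˢ Ioo t₃ T
    · rw [indicator_of_mem hzJ]
      by_cases hz : z.1 ∈ tsupport χ
      · have hzζ : z.1 ∈ V := hζV (subset_tsupport _ (by
          rw [Function.mem_support, hζχ _ hz]; exact one_ne_zero))
        have : z ∈ V ×ˢ Ioo t₁ T := ⟨hzζ, by linarith [hzJ.2.1], hzJ.2.2⟩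
        rw [indicator_of_mem hz, indicator_of_mem this]
      · rw [indicator_of_notMem hz]; exact zero_le
    · rw [indicator_of_notMem hzJ]; exact zero_le
  have hGm : Measurable fun z => ENNReal.ofReal (g.coercConst / 2 *
      (levelPow u m (γ - 1) z * ‖G z‖ ^ (2 - g.a) * ζ z.1 ^ 2)) := by
    refine Measurable.ennreal_ofReal (measurable_const.mul (((measurable_levelPow h.measurable
      _ _).mul (h.measurable_grad.norm.pow_const _)).mul (Measurable.pow_const ?_ _)))
    exact hζ.continuous.measurable.comp measurable_fst
  have hGm' : Measurable fun z => ENNReal.ofReal (4 * c₁ * (2 / g.coercConst)) *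
      ENNReal.ofReal (g.coercConst / 2 *
      (levelPow u m (γ - 1) z * ‖G z‖ ^ (2 - g.a) * ζ z.1 ^ 2)) := measurable_const.mul hGm
  refine (lintegral_mono hpt).trans ?_
  rw [lintegral_add_left hGm', lintegral_const_mul _ hGm,
    lintegral_const_mul' _ _ ENNReal.ofReal_ne_top]
  refine (add_le_add (mul_le_mul_right (energy_grad h hlam ha hl hlm hγ hζ hζ0 hζ1 hV hζc hζV
    hVU hΛx h0 h12 h23 hN) _) (mul_le_mul_right hsec _)).trans ?_
  rw [← hE₀, ← hA, ← ENNReal.ofReal_mul (by positivity), ← ENNReal.ofReal_mul (by positivity),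
    ← ENNReal.ofReal_add (by positivity) (by positivity)]
  refine ENNReal.ofReal_le_ofReal (le_of_eq ?_)
  rw [gradConst, ← hE₀, ← hc₁, ← hc₂]
  ring

theorem ae_lintegral_levelPow_le (h : IsMeasurableWeakSolution g lam (cylinder U T) u G)
    (hlam : lam ∈ Ioc (0 : ℝ) 1) (ha : 1 - lam < g.a) {l m m' γ : ℝ} (hl : 0 < l) (hlm : l < m)
    (hmm' : m < m') (hγ : 1 ≤ γ)
    {ζ : Space n → ℝ} (hζ : ContDiff ℝ ((⊤ : ℕ∞) : WithTop ℕ∞) ζ) (hζ0 : ∀ x, 0 ≤ ζ x)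
    (hζ1 : ∀ x, ζ x ≤ 1) {V : Set (Space n)} (hV : MeasurableSet V)
    (hζc : HasCompactSupport ζ) (hζV : tsupport ζ ⊆ V) (hVU : V ⊆ (U : Set (Space n)))
    {Λx : ℝ} (hΛx : ∀ x, ‖gradient ζ x‖ ≤ Λx)
    {t₁ t₂ t₃ : ℝ} (h0 : 0 ≤ t₁) (h12 : t₁ < t₂) (h23 : t₂ < t₃)
    (hN : IntegrableOn (levelPow u l (γ + lam)) (V ×ˢ Ioo t₁ T)) :
    ∀ᵐ t ∂volume.restrict (Ioo t₃ T),
      ∫⁻ x, ENNReal.ofReal (levelPow u m' (γ + lam) (x, t) * ζ x ^ 2) ≤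
      ENNReal.ofReal (supConst g lam l m m' γ (transitionBound / (t₃ - t₂)) Λx *
        ∫ z in V ×ˢ Ioo t₁ T, levelPow u l (γ + lam) z) := by
  have hm : 0 < m := hl.trans hlm
  have hm' : 0 < m' := hm.trans hmm'
  have hlam0 := hlam.1
  have hc : 0 < lam * (1 - m / m') * (m / m') ^ γ := by
    have : 0 < 1 - m / m' := by rw [sub_pos, div_lt_one hm']; exact hmm'
    positivity
  filter_upwards [energy_sup h hlam ha hl hlm hmm' hγ hζ hζ0 hζ1 hV hζc hζV hVU hΛx h0 h12 h23 hN]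
    with t ht
  set c := lam * (1 - m / m') * (m / m') ^ γ with hcdef
  simp only [ENNReal.ofReal_mul hc.le] at ht
  rw [lintegral_const_mul' _ _ ENNReal.ofReal_ne_top] at ht
  calc _ = ENNReal.ofReal c⁻¹ * (ENNReal.ofReal c *
        ∫⁻ x, ENNReal.ofReal (levelPow u m' (γ + lam) (x, t) * ζ x ^ 2)) := by
        rw [← mul_assoc, ← ENNReal.ofReal_mul (by positivity), inv_mul_cancel₀ hc.ne',
          ENNReal.ofReal_one, one_mul]
    _ ≤ ENNReal.ofReal c⁻¹ * ENNReal.ofReal _ := mul_le_mul_right ht _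
    _ = _ := by
        rw [← ENNReal.ofReal_mul (by positivity), supConst, ← hcdef, ← mul_assoc]
        congr 2
        exact inv_mul_eq_div _ _

/-- The parabolic Sobolev inequality is applied to a truncated `u ^ q χ` with weight `u ^ α ζ²`
above the level `m'`, where `α = γ + lam`. The slice estimate bounds the weight, the gradient
estimate the right side. The constant depends on neither `γ` nor the levels or cylinders. -/
theorem exists_gain_const (hn : 2 ≤ n) (g : GenPoly) : ∃ C : ℝ≥0,
    ∀ {lam : ℝ} {U : Opens (Space n)} {T : ℝ} {u : Space n × ℝ → ℝ} {G : Space n × ℝ → Space n}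
      (_ : IsMeasurableWeakSolution g lam (cylinder U T) u G)
      (_ : lam ∈ Ioc (0 : ℝ) 1) (_ : 1 - lam < g.a) {l m m' γ q : ℝ} (_ : 0 < l) (_ : l < m)
      (_ : m < m') (_ : 1 ≤ γ) (_ : q * (2 - g.a) = γ - 1 + (2 - g.a))
      {ζ : Space n → ℝ} (_ : ContDiff ℝ ((⊤ : ℕ∞) : WithTop ℕ∞) ζ) (_ : ∀ x, 0 ≤ ζ x)
      (_ : ∀ x, ζ x ≤ 1) {V : Set (Space n)} (_ : MeasurableSet V)
      (_ : HasCompactSupport ζ) (_ : tsupport ζ ⊆ V) (_ : V ⊆ (U : Set (Space n)))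
      {Λx : ℝ} (_ : ∀ x, ‖gradient ζ x‖ ≤ Λx)
      {χ : Space n → ℝ} (_ : ContDiff ℝ ((⊤ : ℕ∞) : WithTop ℕ∞) χ) (_ : ∀ x, 0 ≤ χ x)
      (_ : ∀ x, χ x ≤ 1) (_ : HasCompactSupport χ) {Λ : ℝ}
      (_ : ∀ x, ‖gradient χ x‖ ≤ Λ) (_ : ∀ x ∈ tsupport χ, ζ x = 1)
      {t₁ t₂ t₃ : ℝ} (_ : 0 ≤ t₁) (_ : t₁ < t₂) (_ : t₂ < t₃)
      (_ : IntegrableOn (levelPow u l (γ + lam)) (V ×ˢ Ioo t₁ T)),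
      ∫⁻ z in univ ×ˢ Ioo t₃ T, ENNReal.ofReal (levelPow u m' (γ + lam + ((γ + lam) *
          ((2 - g.a) / n) - (lam - 1 + g.a))) z * χ z.1 ^ (2 - g.a)) ≤
        C * ENNReal.ofReal (supConst g lam l m m' γ (transitionBound / (t₃ - t₂)) Λx *
          ∫ z in V ×ˢ Ioo t₁ T, levelPow u l (γ + lam) z) ^ ((2 - g.a) / n) *
        ENNReal.ofReal (gradConst g lam l m m' γ q (transitionBound / (t₃ - t₂)) Λx Λ *
          ∫ z in V ×ˢ Ioo t₁ T, levelPow u l (γ + lam) z) := by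
  have ha0 := g.a_pos
  have ha1 := g.a_lt_one
  have hp0 : 0 < 2 - g.a := by linarith
  have hn0 : (0 : ℝ) < n := by exact_mod_cast (by omega : 0 < n)
  obtain ⟨C, hC⟩ := exists_parabolic_sobolev_comp_const hn (p := 2 - g.a) (by linarith)
    (by linarith)
  refine ⟨C, ?_⟩
  intro lam U T u G h hlam ha l m m' γ q hl hlm hmm' hγ hq ζ hζ hζ0 hζ1 V hV hζc hζV hVU Λx hΛx
    χ hχ hχ0 hχ1 hχc Λ hΛ hζχ t₁ t₂ t₃ h0 h12 h23 hN
  have hm : 0 < m := hl.trans hlm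
  have hm' : 0 < m' := hm.trans hmm'
  set E := ENNReal.ofReal (supConst g lam l m m' γ (transitionBound / (t₃ - t₂)) Λx *
          ∫ z in V ×ˢ Ioo t₁ T, levelPow u l (γ + lam) z) with hE
  set τ : ℕ → ℝ := fun i => ((i : ℝ) + 1)⁻¹ with hτdef
  have hτ : ∀ i, 0 < τ i := fun i => by positivity
  have hτ0 : Tendsto τ atTop (𝓝 0) := by
    simpa [one_div] using tendsto_one_div_add_atTop_nhds_zero_nat (𝕜 := ℝ)
  have hq1 : 1 ≤ q := by
    by_contra hcon
    have h1 : q * (2 - g.a) < 1 * (2 - g.a) := mul_lt_mul_of_pos_right (not_le.1 hcon) hp0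
    linarith
  set M : Space n × ℝ → ℝ≥0∞ := fun z =>
    ENNReal.ofReal (levelPow u m' (γ + lam) z * ζ z.1 ^ 2) with hM
  have hMm : Measurable M := Measurable.ennreal_ofReal ((measurable_levelPow h.measurable _ _).mul
    ((hζ.continuous.measurable.comp measurable_fst).pow_const 2))
  have hχU : tsupport χ ⊆ (U : Set (Space n)) := fun x hx => hVU (hζV (subset_tsupport _ (by
    rw [Function.mem_support, hζχ _ hx]; exact one_ne_zero)))
  have hsup := ae_lintegral_levelPow_le h hlam ha hl hlm hmm' hγ hζ hζ0 hζ1 hV hζc hζV hVU hΛx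
    h0 h12 h23 hN
  have hχm : Measurable fun z : Space n × ℝ => χ z.1 :=
    hχ.continuous.measurable.comp measurable_fst
  -- The Sobolev step needs a final time strictly before `T`, so the cylinder is exhausted by times
  -- below `T - τ i` while the truncation is removed.
  refine lintegral_le_of_tendsto (F := fun i z => if z.2 < T - τ i then ENNReal.ofReal
    ((if m' < u z then ((u z / (1 + τ i * u z)) ^ q) ^ (2 - g.a) *
      (u z ^ (γ + lam)) ^ ((2 - g.a) / n) else 0) * χ z.1 ^ (2 - g.a)) else 0)
    (fun i => ?_) ?_ fun i => ?_
  · refine Measurable.ite (measurableSet_lt measurable_snd measurable_const)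
      (Measurable.ennreal_ofReal (Measurable.mul (Measurable.ite
        (measurableSet_lt measurable_const h.measurable) ?_ measurable_const)
        (hχm.pow_const _))) measurable_const
    exact (((h.measurable.div (measurable_const.add
      (measurable_const.mul h.measurable))).pow_const _).pow_const _).mul
      ((h.measurable.pow_const _).pow_const _)
  · filter_upwards [ae_restrict_mem (MeasurableSet.univ.prod measurableSet_Ioo)] with z hz
    have hzT : z.2 < T := hz.2.2
    have hev : ∀ᶠ i in atTop, z.2 < T - τ i := by
      filter_upwards [hτ0.eventually (gt_mem_nhds (sub_pos.2 hzT))] with i hi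
      linarith
    refine Tendsto.congr' (hev.mono fun i hi => (if_pos hi).symm) ?_
    refine (ENNReal.continuous_ofReal.tendsto _).comp (Tendsto.mul_const _ ?_)
    unfold levelPow
    split_ifs with hx
    · have hu0 : 0 < u z := hm'.trans hx
      -- The exponents add up as `q p + α p / n` with `q p = α - D`.
      have e : u z ^ (γ + lam + ((γ + lam) * ((2 - g.a) / n) - (lam - 1 + g.a))) =
          (u z ^ q) ^ (2 - g.a) * (u z ^ (γ + lam)) ^ ((2 - g.a) / n) := by
        rw [← Real.rpow_mul hu0.le, ← Real.rpow_mul hu0.le, ← Real.rpow_add hu0, hq]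
        congr 1; ring
      rw [e]
      exact ((tendsto_div_one_add_inv_mul_rpow hu0 q).rpow_const (Or.inr hp0.le)).mul_const _
    · exact tendsto_const_nhds
  · obtain ⟨B, hB, hB'⟩ := exists_nnnorm_truncPow_le hm hmm' (hτ i) hq1
    have hT : T - τ i < T := by linarith [hτ i]
    have hsub : Ioo t₃ (T - τ i) ⊆ Ioo t₃ T := Ioo_subset_Ioo_right hT.le
    have hmain := hC U T u G h.measurable h.measurable_grad h.locallyIntegrableOn
      h.locallyIntegrableOn_grad h.locallyIntegrableOn_rpow h.isWeakSpaceGrad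
      (truncPow m m' q (τ i)) B χ t₃ (T - τ i) M E
      ((contDiff_truncPow hm hmm' (hτ i)).of_le (by simp)) hB hB' hχ hχc hχU (by linarith) hT hMm
      (fun z => ENNReal.ofReal_ne_top) ENNReal.ofReal_ne_top
      (ae_mono (Measure.restrict_mono_set _ hsub) hsup)
    have hgrad := lintegral_grad_truncPow_le h hlam ha hl hlm hmm' hγ hq (hτ i) hζ hζ0 hζ1 hV hζc
      hζV hVU hΛx hχ0 hχ1 hΛ hζχ h0 h12 h23 hN
    have hJ : (univ : Set (Space n)) ×ˢ Ioo t₃ (T - τ i) ⊆ univ ×ˢ Ioo t₃ T :=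
      prod_mono Subset.rfl hsub
    refine le_trans ?_ (hmain.trans (mul_le_mul_right ((lintegral_mono_set hJ).trans hgrad) _))
    rw [← lintegral_indicator (MeasurableSet.univ.prod measurableSet_Ioo),
      ← lintegral_indicator (MeasurableSet.univ.prod measurableSet_Ioo)]
    refine lintegral_mono fun z => ?_
    by_cases hz : z ∈ (univ : Set (Space n)) ×ˢ Ioo t₃ (T - τ i)
    · rw [indicator_of_mem hz, indicator_of_mem (hJ hz)]
      dsimp only
      rw [if_pos hz.2.2]
      by_cases hzχ : z.1 ∈ tsupport χ
      · split_ifs with hx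
        · have hu0 : 0 < u z := hm'.trans hx
          have h1 := hχ0 z.1
          have hτi := hτ i
          have hf0 := truncPow_nonneg (γ := q) hm hmm' (hτ i) (u z)
          rw [hM]
          dsimp only
          rw [hζχ _ hzχ, one_pow, mul_one, levelPow, if_pos hx, truncPow_of_ge hmm' hx.le,
            Real.enorm_of_nonneg (by positivity),
            ENNReal.ofReal_rpow_of_nonneg (by positivity) hp0.le,
            ENNReal.ofReal_rpow_of_nonneg (by positivity) (by positivity),
            ← ENNReal.ofReal_mul (by positivity)]
          refine ENNReal.ofReal_le_ofReal (le_of_eq ?_)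
          rw [Real.mul_rpow (by positivity) h1]
          ring
        · simp
      · rw [image_eq_zero_of_notMem_tsupport hzχ, Real.zero_rpow hp0.ne', mul_zero,
          ENNReal.ofReal_zero]
        exact zero_le
    · rw [indicator_of_notMem hz]
      by_cases hzJ : z ∈ (univ : Set (Space n)) ×ˢ Ioo t₃ T
      · rw [indicator_of_mem hzJ]
        dsimp only
        rw [if_neg fun h' => hz ⟨hzJ.1, hzJ.2.1, h'⟩]
      · rw [indicator_of_notMem hzJ]

end Gain

/-! ### Cut-off functions for balls -/

section Cutoff

variable {n : ℕ}

/-- A step is composed with the squared distance, which is smooth at the centre. With `s` the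
midpoint of the radii, the gradient is at most `2 s / (s² - r²)` times the step bound, and `s² - r²
= (s - r)(s + r)`. -/
theorem exists_cutoff (x₀ : Space n) {r ρ : ℝ} (hr : 0 < r) (hrρ : r < ρ) :
    ∃ ζ : Space n → ℝ, ContDiff ℝ ((⊤ : ℕ∞) : WithTop ℕ∞) ζ ∧ (∀ x, 0 ≤ ζ x) ∧ (∀ x, ζ x ≤ 1) ∧
      HasCompactSupport ζ ∧ tsupport ζ ⊆ Metric.ball x₀ ρ ∧
      (∀ x ∈ Metric.closedBall x₀ r, ζ x = 1) ∧
      ∀ x, ‖gradient ζ x‖ ≤ 4 * transitionBound / (ρ - r) := by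
  have hL := one_le_transitionBound
  set s := (r + ρ) / 2 with hs
  have hrs : r < s := by rw [hs]; linarith
  have hsρ : s < ρ := by rw [hs]; linarith
  have hsq : r ^ 2 < s ^ 2 := by gcongr
  set ψ : Space n → ℝ := fun x => ‖x - x₀‖ ^ 2 with hψ
  have hψs : ContDiff ℝ ((⊤ : ℕ∞) : WithTop ℕ∞) ψ := (contDiff_id.sub contDiff_const).norm_sq ℝ
  have hψd : ∀ x, HasFDerivAt ψ (2 • innerSL ℝ (x - x₀)) x := fun x => by
    have := (hasStrictFDerivAt_norm_sq (x - x₀)).hasFDerivAt.comp x ((hasFDerivAt_id x).sub_const x₀)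
    rw [ContinuousLinearMap.comp_id] at this
    exact this
  set ζ : Space n → ℝ := fun x => 1 - stepFn (r ^ 2) (s ^ 2) (ψ x) with hζ
  have hζs : ContDiff ℝ ((⊤ : ℕ∞) : WithTop ℕ∞) ζ := contDiff_const.sub (contDiff_stepFn.comp hψs)
  have hsupp : Function.support ζ ⊆ Metric.closedBall x₀ s := by
    intro x hx
    by_contra hcon
    rw [Metric.mem_closedBall, dist_eq_norm, not_le] at hcon
    refine hx ?_
    have : s ^ 2 ≤ ψ x := by rw [hψ]; dsimp only; gcongr; linarith
    rw [hζ]; dsimp only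
    rw [stepFn_eq_one hsq this, sub_self]
  have hts : tsupport ζ ⊆ Metric.closedBall x₀ s :=
    closure_minimal hsupp Metric.isClosed_closedBall
  refine ⟨ζ, hζs, fun x => sub_nonneg.2 (stepFn_le_one _), fun x => sub_le_self _ (stepFn_nonneg _),
    HasCompactSupport.of_support_subset_isCompact (isCompact_closedBall _ _) hsupp,
    hts.trans (Metric.closedBall_subset_ball hsρ), fun x hx => ?_, fun x => ?_⟩
  · rw [Metric.mem_closedBall, dist_eq_norm] at hx
    have : ψ x ≤ r ^ 2 := by rw [hψ]; dsimp only; gcongr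
    rw [hζ]; dsimp only
    rw [stepFn_eq_zero hsq this, sub_zero]
  · rw [norm_gradient_eq]
    by_cases hx : x ∈ tsupport ζ
    · have hxs : ‖x - x₀‖ ≤ s := by simpa [dist_eq_norm] using hts hx
      have hd : HasFDerivAt ζ (-(deriv (stepFn (r ^ 2) (s ^ 2)) (ψ x) •
          (2 • innerSL ℝ (x - x₀)))) x :=
        ((differentiable_stepFn (ψ x)).hasDerivAt.comp_hasFDerivAt x (hψd x)).const_sub 1
      rw [hd.fderiv, norm_neg, norm_smul, ← Nat.cast_smul_eq_nsmul ℝ, norm_smul,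
        innerSL_apply_norm]
      have h1 : ‖deriv (stepFn (r ^ 2) (s ^ 2)) (ψ x)‖ ≤ transitionBound / (s ^ 2 - r ^ 2) :=
        abs_deriv_stepFn_le hsq _
      have h2 : 0 < s ^ 2 - r ^ 2 := by linarith
      calc _ ≤ transitionBound / (s ^ 2 - r ^ 2) * (‖((2 : ℕ) : ℝ)‖ * s) := by gcongr
        _ ≤ 4 * transitionBound / (ρ - r) := by
          have h3 : ρ - r = 2 * (s - r) := by rw [hs]; ring
          have h4 : 0 < s - r := by linarith
          rw [h3, div_mul_eq_mul_div, div_le_div_iff₀ h2 (by linarith)]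
          have h5 : ‖((2 : ℕ) : ℝ)‖ = 2 := by norm_num
          rw [h5]
          have h6 : 0 ≤ transitionBound * (s - r) := by positivity
          nlinarith
    · rw [fderiv_of_notMem_tsupport ℝ hx, norm_zero]
      have : 0 < ρ - r := by linarith
      positivity

end Cutoff

/-- Fast geometric convergence: with `x = B ^ (-1 / β)` the bound `A j ≤ A 0 * x ^ j` reproduces
itself, as `(x ^ j) ^ β` cancels `B ^ j` and smallness of `A 0` yields one more factor `x`. -/
theorem tendsto_zero_of_le_mul_rpow {A : ℕ → ℝ} {K B β : ℝ} (hA : ∀ j, 0 ≤ A j) (hK : 0 ≤ K)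
    (hB : 1 < B) (hβ : 0 < β) (hstep : ∀ j, A (j + 1) ≤ K * B ^ j * A j ^ (1 + β))
    (h0 : K * A 0 ^ β * B ^ (1 / β) ≤ 1) : Tendsto A atTop (𝓝 0) := by
  have hB0 : 0 < B := by linarith
  set x := B ^ (-(1 / β)) with hx
  have hx0 : 0 < x := by positivity
  have hx1 : x < 1 := Real.rpow_lt_one_of_one_lt_of_neg hB (by simp [hβ])
  have hxβ : x ^ β = B⁻¹ := by
    rw [hx, ← Real.rpow_mul hB0.le, neg_mul, one_div_mul_cancel hβ.ne', Real.rpow_neg_one]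
  have hKA : K * A 0 ^ β ≤ x := by
    rw [hx, Real.rpow_neg hB0.le, ← one_div, le_div_iff₀ (by positivity)]
    exact h0
  have key : ∀ j, A j ≤ A 0 * x ^ j := by
    intro j
    induction j with
    | zero => simp
    | succ j ih =>
      calc A (j + 1) ≤ K * B ^ j * A j ^ (1 + β) := hstep j
        _ ≤ K * B ^ j * (A 0 * x ^ j) ^ (1 + β) := by
          have := hA j
          gcongr
        _ = (K * A 0 ^ β) * (A 0 * x ^ j) * (B ^ j * (x ^ j) ^ β) := by
          rw [Real.rpow_one_add' (mul_nonneg (hA 0) (by positivity)) (by linarith),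
            Real.mul_rpow (hA 0) (by positivity)]
          ring
        _ = (K * A 0 ^ β) * (A 0 * x ^ j) := by
          rw [← Real.rpow_natCast x j, ← Real.rpow_mul hx0.le, mul_comm (j : ℝ) β,
            Real.rpow_mul hx0.le, hxβ, Real.rpow_natCast B⁻¹ j, ← mul_pow,
            mul_inv_cancel₀ hB0.ne', one_pow, mul_one]
        _ ≤ x * (A 0 * x ^ j) := by
          have := hA 0
          gcongr
        _ = A 0 * x ^ (j + 1) := by ring
  refine squeeze_zero hA key ?_
  simpa using (tendsto_pow_atTop_nhds_zero_of_lt_one hx0.le hx1).const_mul (A 0)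

/-! ### Tracking the constants of one iteration step -/

section Constants

variable {g : GenPoly} {lam γ : ℝ}

/-- The scaling quantity controlling the constants of the iteration at level `k`. -/
noncomputable def scaleFactor (g : GenPoly) (lam b R k : ℝ) : ℝ :=
  (1 + 1 / b + 1 / R ^ (2 - g.a)) * (1 + k ^ (-(1 + lam)))

/-- All negative powers of the level are absorbed into the single expression `1 + k ^ (-S)`, whether
`k` is large or small. -/
theorem rpow_neg_le_one_add {k e S : ℝ} (hk : 0 < k) (he : 0 ≤ e) (heS : e ≤ S) :
    k ^ (-e) ≤ 1 + k ^ (-S) := by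
  rcases le_or_gt 1 k with h | h
  · have h1 : k ^ (-e) ≤ 1 := Real.rpow_le_one_of_one_le_of_nonpos h (by linarith)
    have : 0 ≤ k ^ (-S) := by positivity
    linarith
  · have : k ^ (-e) ≤ k ^ (-S) := Real.rpow_le_rpow_of_exponent_ge hk h.le (by linarith)
    linarith

theorem half_rpow_neg_le {k l e : ℝ} (hk : 0 < k) (hl : k / 2 ≤ l) (he0 : 0 ≤ e) (he : e ≤ 2) :
    l ^ (-e) ≤ 4 * k ^ (-e) := by
  calc l ^ (-e) ≤ (k / 2) ^ (-e) :=
        Real.rpow_le_rpow_of_nonpos (by positivity) hl (by linarith)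
    _ = 2 ^ e * k ^ (-e) := by
        rw [Real.div_rpow hk.le (by norm_num), Real.rpow_neg (by norm_num : (0 : ℝ) ≤ 2), div_inv_eq_mul,
          mul_comm]
    _ ≤ 2 ^ (2 : ℝ) * k ^ (-e) := by
        gcongr
        norm_num
    _ = 4 * k ^ (-e) := by norm_num

theorem div_rpow_le_div_sq {c θ R p : ℝ} (hc : 1 ≤ c) (hθ : 0 < θ) (hθ1 : θ ≤ 1) (hR : 0 < R)
    (hp2 : p ≤ 2) : (c / (θ * R)) ^ p ≤ c ^ 2 / θ ^ 2 * (1 / R ^ p) := by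
  have hc0 : 0 < c := by linarith
  rw [Real.div_rpow hc0.le (by positivity), Real.mul_rpow hθ.le hR.le, div_mul_div_comm, mul_one]
  have h1 : c ^ p ≤ c ^ 2 := by
    rw [← Real.rpow_natCast]; exact Real.rpow_le_rpow_of_exponent_le hc (by exact_mod_cast hp2)
  have h2 : θ ^ 2 ≤ θ ^ p := by
    rw [← Real.rpow_natCast]
    exact Real.rpow_le_rpow_of_exponent_ge hθ hθ1 (by exact_mod_cast hp2)
  gcongr

theorem one_le_scaleFactor {b R k : ℝ} (hb : 0 < b) (hR : 0 < R) (hk : 0 < k) :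
    1 ≤ scaleFactor g lam b R k := by
  have h1 : 0 ≤ 1 / b := by positivity
  have h2 : 0 ≤ 1 / R ^ (2 - g.a) := by positivity
  have h3 : 0 ≤ k ^ (-(1 + lam)) := by positivity
  unfold scaleFactor
  nlinarith [mul_nonneg (add_nonneg h1 h2) h3]

/-- Bound for the energy constant in terms of `scaleFactor`. -/
noncomputable def energyBound (g : GenPoly) (γ : ℝ) : ℝ :=
  2 * transitionBound + 4 * ((∑ i, g.coeff i) * (2 * transitionBound + γ)) +
    256 * (g.youngConst * transitionBound ^ 2)

theorem energyBound_pos (hγ : 0 ≤ γ) : 0 < energyBound g γ := by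
  have hL := one_le_transitionBound
  have h1 := g.sum_coeff_pos
  have h2 := g.youngConst_pos
  unfold energyBound
  positivity

/-- Of the factor `256`, `4` is the price of replacing the level `l ≥ k / 2` by `k`, and `8 ^ 2`
comes from the cut-off slope. -/
theorem cutoff_term_le (ha : 1 - lam < g.a) (hlam : lam ∈ Ioc (0 : ℝ) 1) {b R k θ l Λ : ℝ}
    (hb : 0 < b) (hR : 0 < R) (hk : 0 < k) (hθ : 0 < θ) (hθ1 : θ ≤ 1) (hl : k / 2 ≤ l)
    (hΛ0 : 0 ≤ Λ) (hΛ : Λ ≤ 8 * transitionBound / (θ * R)) :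
    l ^ (-(lam - 1 + g.a)) * Λ ^ (2 - g.a) ≤
      256 * transitionBound ^ 2 * (scaleFactor g lam b R k / θ ^ 2) := by
  have hL := one_le_transitionBound
  have ha0 := g.a_pos
  have ha1 := g.a_lt_one
  have hl0 : 0 < l := by linarith
  have hlam1 := hlam.2
  have h2 : Λ ^ (2 - g.a) ≤ (8 * transitionBound) ^ 2 / θ ^ 2 * (1 / R ^ (2 - g.a)) :=
    (Real.rpow_le_rpow hΛ0 hΛ (by linarith)).trans
      (div_rpow_le_div_sq (by linarith) hθ hθ1 hR (by linarith))
  have h1 : l ^ (-(lam - 1 + g.a)) ≤ 4 * (1 + k ^ (-(1 + lam))) :=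
    (half_rpow_neg_le hk hl (by linarith) (by linarith)).trans
      (mul_le_mul_of_nonneg_left (rpow_neg_le_one_add hk (by linarith) (by linarith))
        (by norm_num))
  have h3 : 0 ≤ k ^ (-(1 + lam)) := by positivity
  have h4 : 0 ≤ 1 / b := by positivity
  calc _ ≤ 4 * (1 + k ^ (-(1 + lam))) *
        ((8 * transitionBound) ^ 2 / θ ^ 2 * (1 / R ^ (2 - g.a))) := by gcongr
    _ = 256 * transitionBound ^ 2 *
        ((1 / R ^ (2 - g.a)) * (1 + k ^ (-(1 + lam))) / θ ^ 2) := by ring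
    _ ≤ _ := by
        unfold scaleFactor
        gcongr
        linarith

theorem energyConst_le (hlam : lam ∈ Ioc (0 : ℝ) 1) (ha : 1 - lam < g.a) (hγ : 1 ≤ γ)
    {b R k θ l m Λt Λ : ℝ} (hb : 0 < b) (hR : 0 < R) (hk : 0 < k) (hθ : 0 < θ) (hθ1 : θ ≤ 1)
    (hl : k / 2 ≤ l) (hlm : k * θ / 2 ≤ m - l) (hmk : m ≤ k) (hΛ0 : 0 ≤ Λ)
    (hΛt : Λt ≤ 2 * transitionBound / (θ * b)) (hΛ : Λ ≤ 8 * transitionBound / (θ * R)) :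
    energyConst g lam l m γ Λt Λ ≤ energyBound g γ * (scaleFactor g lam b R k / θ ^ 2) := by
  have hL := one_le_transitionBound
  have hl0 : 0 < l := by linarith
  have hs := g.sum_coeff_pos
  have hy := g.youngConst_pos
  have h3 : 0 ≤ k ^ (-(1 + lam)) := by positivity
  have h4 : 0 ≤ 1 / b := by positivity
  have h5 : 0 ≤ 1 / R ^ (2 - g.a) := by positivity
  have hθ2 : θ ^ 2 ≤ θ := by nlinarith
  have hkθ : 0 < k * θ := by positivity
  have hml : 0 < m - l := by linarith
  have hm0 : 0 < m := by linarith
  have hsf := one_le_scaleFactor (g := g) (lam := lam) hb hR hk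
  have e1 : Λt ≤ 2 * transitionBound * (scaleFactor g lam b R k / θ ^ 2) := by
    calc Λt ≤ 2 * transitionBound / (θ * b) := hΛt
      _ = 2 * transitionBound * ((1 / b) / θ) := by field_simp
      _ ≤ _ := by
        have h6 : 1 / b ≤ scaleFactor g lam b R k := by
          unfold scaleFactor
          nlinarith [mul_nonneg (add_nonneg h4 h5) h3]
        gcongr
  have e2 : (transitionBound / (m - l) * m + γ) * l ^ (-(1 + lam)) ≤
      4 * (2 * transitionBound + γ) * (scaleFactor g lam b R k / θ ^ 2) := by
    have h6 : transitionBound / (m - l) * m + γ ≤ (2 * transitionBound + γ) / θ := by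
      have : transitionBound / (m - l) * m ≤ 2 * transitionBound / θ := by
        calc transitionBound / (m - l) * m ≤ transitionBound / (k * θ / 2) * k := by gcongr
          _ = _ := by field_simp
      have h7 : γ ≤ γ / θ := le_div_self (by linarith) hθ hθ1
      rw [add_div]
      linarith
    have h7 : l ^ (-(1 + lam)) ≤ 4 * k ^ (-(1 + lam)) :=
      half_rpow_neg_le hk hl (by linarith [hlam.1]) (by linarith [hlam.2])
    have h8 : k ^ (-(1 + lam)) ≤ scaleFactor g lam b R k := by
      unfold scaleFactor
      nlinarith [mul_nonneg (add_nonneg h4 h5) h3]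
    calc _ ≤ (2 * transitionBound + γ) / θ * (4 * k ^ (-(1 + lam))) := by gcongr
      _ = 4 * (2 * transitionBound + γ) * (k ^ (-(1 + lam)) / θ) := by ring
      _ ≤ _ := by gcongr
  have e3 := cutoff_term_le ha hlam hb hR hk hθ hθ1 hl hΛ0 hΛ
  unfold energyConst energyBound
  calc _ ≤ 2 * transitionBound * (scaleFactor g lam b R k / θ ^ 2) + (∑ i, g.coeff i) *
        (4 * (2 * transitionBound + γ) * (scaleFactor g lam b R k / θ ^ 2)) +
        g.youngConst * (256 * transitionBound ^ 2 * (scaleFactor g lam b R k / θ ^ 2)) := by gcongr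
    _ = _ := by ring

/-- All levels lie in `[k / 2, k]` with gaps at least `k θ / 2`, so `m / m' ≥ 1 / 2` and `1 - m / m'
≥ θ / 2`; the latter costs the third power of `1 / θ`. -/
theorem supConst_le (hlam : lam ∈ Ioc (0 : ℝ) 1) (ha : 1 - lam < g.a) (hγ : 1 ≤ γ)
    {b R k θ l m m' Λt Λ : ℝ} (hb : 0 < b) (hR : 0 < R) (hk : 0 < k) (hθ : 0 < θ) (hθ1 : θ ≤ 1)
    (hl : k / 2 ≤ l) (hlm : k * θ / 2 ≤ m - l) (hmm' : k * θ / 2 ≤ m' - m) (hm'k : m' ≤ k)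
    (hΛ0 : 0 ≤ Λ) (hΛt : Λt ≤ 2 * transitionBound / (θ * b))
    (hΛ : Λ ≤ 8 * transitionBound / (θ * R)) :
    supConst g lam l m m' γ Λt Λ ≤
      2 * 2 ^ γ / lam * energyBound g γ * (scaleFactor g lam b R k / θ ^ 3) := by
  have hkθ : 0 < k * θ := by positivity
  have hm0 : 0 < m := by linarith
  have hm'0 : 0 < m' := by linarith
  have hE := energyConst_le hlam ha hγ hb hR hk hθ hθ1 hl hlm (by linarith) hΛ0 hΛt hΛ
  have hEB := energyBound_pos (g := g) (γ := γ) (by linarith)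
  have hsf := one_le_scaleFactor (g := g) (lam := lam) hb hR hk
  have hlam0 := hlam.1
  have h1 : θ / 2 ≤ 1 - m / m' := by
    rw [one_sub_div hm'0.ne', le_div_iff₀ hm'0]
    nlinarith
  have h2 : (1 / 2 : ℝ) ^ γ ≤ (m / m') ^ γ := by
    refine Real.rpow_le_rpow (by norm_num) ?_ (by linarith)
    rw [le_div_iff₀ hm'0]; linarith
  have h3 : lam * (θ / 2) * (1 / 2 : ℝ) ^ γ ≤ lam * (1 - m / m') * (m / m') ^ γ := by
    gcongr
    exact mul_nonneg hlam0.le ((by positivity : 0 ≤ θ / 2).trans h1)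
  unfold supConst
  calc _ ≤ energyBound g γ * (scaleFactor g lam b R k / θ ^ 2) /
        (lam * (θ / 2) * (1 / 2 : ℝ) ^ γ) := by gcongr
    _ = _ := by
        rw [Real.div_rpow zero_le_one (by norm_num), Real.one_rpow]
        field_simp

/-- Bound for the gradient constant in terms of `scaleFactor`. -/
noncomputable def gradBound (g : GenPoly) (γ q : ℝ) : ℝ :=
  4 * ((2 * transitionBound + q) ^ 2 * (2 / g.coercConst * energyBound g γ) +
    256 * transitionBound ^ 2)

theorem gradConst_le (hlam : lam ∈ Ioc (0 : ℝ) 1) (ha : 1 - lam < g.a) (hγ : 1 ≤ γ)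
    {b R k θ l m m' q Λt Λ : ℝ} (hq : 0 ≤ q) (hb : 0 < b) (hR : 0 < R) (hk : 0 < k) (hθ : 0 < θ)
    (hθ1 : θ ≤ 1)
    (hl : k / 2 ≤ l) (hlm : k * θ / 2 ≤ m - l) (hmm' : k * θ / 2 ≤ m' - m) (hm'k : m' ≤ k)
    (hΛ0 : 0 ≤ Λ) (hΛt : Λt ≤ 2 * transitionBound / (θ * b))
    (hΛ : Λ ≤ 8 * transitionBound / (θ * R)) :
    gradConst g lam l m m' γ q Λt Λ Λ ≤
      gradBound g γ q * (scaleFactor g lam b R k / θ ^ 4) := by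
  have hL := one_le_transitionBound
  have ha0 := g.a_pos
  have ha1 := g.a_lt_one
  have hkθ : 0 < k * θ := by positivity
  have hm0 : 0 < m := by linarith
  have hm'0 : 0 < m' := by linarith
  have hmm0 : 0 < m' - m := by linarith
  have hc := g.coercConst_pos
  have hE := energyConst_le hlam ha hγ hb hR hk hθ hθ1 hl hlm (by linarith) hΛ0 hΛt hΛ
  have hEB := energyBound_pos (g := g) (γ := γ) (by linarith)
  have hsf := one_le_scaleFactor (g := g) (lam := lam) hb hR hk
  have e3 := cutoff_term_le ha hlam hb hR hk hθ hθ1 (l := m) (by linarith) hΛ0 hΛ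
  have h6 : transitionBound / (m' - m) * m' + q ≤ (2 * transitionBound + q) / (θ * 1) := by
    have : transitionBound / (m' - m) * m' ≤ 2 * transitionBound / θ := by
      calc transitionBound / (m' - m) * m' ≤ transitionBound / (k * θ / 2) * k := by gcongr
        _ = _ := by field_simp
    have h7 : q ≤ q / θ := le_div_self hq hθ hθ1
    rw [mul_one, add_div]
    linarith
  have h7 : (transitionBound / (m' - m) * m' + q) ^ (2 - g.a) ≤
      (2 * transitionBound + q) ^ 2 / θ ^ 2 := by
    refine (Real.rpow_le_rpow (by positivity) h6 (by linarith)).trans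
      ((div_rpow_le_div_sq (by linarith) hθ hθ1 one_pos (by linarith)).trans (le_of_eq ?_))
    rw [Real.one_rpow, div_one, mul_one]
  have h8 : scaleFactor g lam b R k / θ ^ 2 ≤ scaleFactor g lam b R k / θ ^ 4 :=
    div_le_div_of_nonneg_left (by linarith) (by positivity)
      (pow_le_pow_of_le_one hθ.le hθ1 (by norm_num))
  have hE0 : 0 ≤ energyBound g γ * (scaleFactor g lam b R k / θ ^ 2) := by positivity
  unfold gradConst gradBound
  calc _ ≤ 4 * ((2 * transitionBound + q) ^ 2 / θ ^ 2 * (2 / g.coercConst *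
        (energyBound g γ * (scaleFactor g lam b R k / θ ^ 2))) +
        256 * transitionBound ^ 2 * (scaleFactor g lam b R k / θ ^ 2)) :=
        mul_le_mul_of_nonneg_left (add_le_add (mul_le_mul_of_nonneg h7
          (mul_le_mul_of_nonneg_left hE (by positivity)) (by positivity) (by positivity)) e3)
          (by norm_num)
    _ = 4 * ((2 * transitionBound + q) ^ 2 * (2 / g.coercConst * energyBound g γ) *
        (scaleFactor g lam b R k / θ ^ 4) +
        256 * transitionBound ^ 2 * (scaleFactor g lam b R k / θ ^ 2)) := by
        field_simp
    _ ≤ 4 * ((2 * transitionBound + q) ^ 2 * (2 / g.coercConst * energyBound g γ) *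
        (scaleFactor g lam b R k / θ ^ 4) +
        256 * transitionBound ^ 2 * (scaleFactor g lam b R k / θ ^ 4)) := by gcongr
    _ = _ := by ring

end Constants

/-! ### De Giorgi iteration over levels and cylinders -/

section Step

variable {n : ℕ} {g : GenPoly} {lam γ : ℝ}

set_option maxHeartbeats 1000000 in
-- The gain estimate controls `u ^ (α + e)` with `α = γ + lam`; above a level at least `k / 2` the
-- factor `u ^ e` is at least `(k / 2) ^ e`, which can be divided out since `e ≥ 0`. The seven
-- powers of `1 / θ` are four from the gradient constant and at most three from the slice constant.
theorem exists_step_const (hn : 2 ≤ n) (hlam : lam ∈ Ioc (0 : ℝ) 1) (ha : 1 - lam < g.a)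
    (hγ : 1 ≤ γ) {β e : ℝ} (hβ : β = (2 - g.a) / n)
    (he : e = (γ + lam) * β - (lam - 1 + g.a)) (he0 : 0 ≤ e) :
    ∃ C : ℝ, 0 ≤ C ∧ ∀ {U : Opens (Space n)} {T : ℝ} {u : Space n × ℝ → ℝ}
      {G : Space n × ℝ → Space n} (_ : IsMeasurableWeakSolution g lam (cylinder U T) u G)
      {x₀ : Space n} {R b k θ l l' r ρ t t' : ℝ} (_ : 0 < R) (_ : 0 < b) (_ : 0 < k) (_ : 0 < θ)
      (_ : θ ≤ 1) (_ : k / 2 ≤ l) (_ : l + k * θ ≤ l') (_ : l' ≤ k) (_ : 0 < r)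
      (_ : r + θ * R ≤ ρ) (_ : Metric.ball x₀ ρ ⊆ (U : Set (Space n))) (_ : 0 ≤ t)
      (_ : t + θ * b ≤ t')
      (_ : IntegrableOn (levelPow u l (γ + lam)) (Metric.ball x₀ ρ ×ˢ Ioo t T)),
      ∫ z in Metric.ball x₀ r ×ˢ Ioo t' T, levelPow u l' (γ + lam) z ≤
        C * scaleFactor g lam b R k ^ (1 + β) * k ^ (-e) * (1 / θ ^ 7) *
          (∫ z in Metric.ball x₀ ρ ×ˢ Ioo t T, levelPow u l (γ + lam) z) ^ (1 + β) := by
  have hL := one_le_transitionBound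
  have ha0 := g.a_pos
  have ha1 := g.a_lt_one
  have hp0 : 0 < 2 - g.a := by linarith
  have hn2 : (2 : ℝ) ≤ n := by exact_mod_cast hn
  have hβ0 : 0 < β := by rw [hβ]; exact div_pos hp0 (by linarith)
  have hβ1 : β ≤ 1 := by rw [hβ, div_le_one (by linarith)]; linarith
  have hlam0 := hlam.1
  obtain ⟨C₀, hC₀⟩ := exists_gain_const hn g
  set q := (γ - 1 + (2 - g.a)) / (2 - g.a) with hq
  have hqp : q * (2 - g.a) = γ - 1 + (2 - g.a) := by rw [hq]; field_simp
  have hq0 : 0 ≤ q := div_nonneg (by linarith) hp0.le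
  have hEB := energyBound_pos (g := g) (γ := γ) (by linarith)
  set c₂ := 2 * 2 ^ γ / lam * energyBound g γ with hc₂
  set c₃ := gradBound g γ q with hc₃
  have hc₂0 : 0 ≤ c₂ := by positivity
  have hc₃0 : 0 ≤ c₃ := by
    have := g.coercConst_pos
    rw [hc₃, gradBound]; positivity
  refine ⟨C₀ * c₂ ^ β * c₃ * 2 ^ e, by positivity, ?_⟩
  intro U T u G h x₀ R b k θ l l' r ρ t t' hR hb hk hθ hθ1 hl hll' hl'k hr hrρ hU ht htt' hN
  have hkθ : 0 < k * θ := by positivity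
  have hθR : 0 < θ * R := by positivity
  have hθb : 0 < θ * b := by positivity
  have hl0 : 0 < l := by linarith
  have hl'0 : 0 < l' := by linarith
  -- Two nested cut-offs meeting at the midpoint radius: the energy estimate with `ζ` on the larger
  -- ball, the Sobolev inequality with `χ` where `ζ = 1`.
  obtain ⟨ζ, hζ, hζ0, hζ1, hζc, hζV, hζe, hζg⟩ := exists_cutoff x₀ (r := (r + ρ) / 2) (ρ := ρ)
    (by linarith) (by linarith)
  obtain ⟨χ, hχ, hχ0, hχ1, hχc, hχV, hχe, hχg⟩ := exists_cutoff x₀ (r := r) (ρ := (r + ρ) / 2)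
    hr (by linarith)
  have hg1 : 4 * transitionBound / (ρ - (r + ρ) / 2) = 8 * transitionBound / (ρ - r) := by
    rw [div_eq_div_iff (by linarith) (by linarith)]; ring
  have hg2 : 4 * transitionBound / ((r + ρ) / 2 - r) = 8 * transitionBound / (ρ - r) := by
    rw [div_eq_div_iff (by linarith) (by linarith)]; ring
  rw [hg1] at hζg
  rw [hg2] at hχg
  set Λ := 8 * transitionBound / (ρ - r) with hΛ
  have hΛ0 : 0 ≤ Λ := div_nonneg (by linarith) (by linarith)
  have hΛle : Λ ≤ 8 * transitionBound / (θ * R) :=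
    div_le_div_of_nonneg_left (by linarith) hθR (by linarith)
  have hΛt : transitionBound / (t' - (t + t') / 2) ≤ 2 * transitionBound / (θ * b) := by
    rw [div_le_div_iff₀ (by linarith) hθb]
    nlinarith
  set A := ∫ z in Metric.ball x₀ ρ ×ˢ Ioo t T, levelPow u l (γ + lam) z with hA
  have hA0 : 0 ≤ A := integral_nonneg fun z => levelPow_nonneg h.nonneg _ _ _
  set s := scaleFactor g lam b R k with hs
  have hs1 : 1 ≤ s := one_le_scaleFactor hb hR hk
  have hmain := hC₀ h hlam ha hl0 (m := (l + l') / 2) (m' := l') (by linarith) (by linarith) hγ hqp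
    hζ hζ0 hζ1 Metric.isOpen_ball.measurableSet hζc hζV hU hζg hχ hχ0 hχ1 hχc hχg
    (fun x hx => hζe x (Metric.ball_subset_closedBall (hχV hx))) ht (t₂ := (t + t') / 2)
    (t₃ := t') (by linarith) (by linarith) hN
  have hsup := supConst_le hlam ha hγ hb hR hk hθ hθ1 hl (m := (l + l') / 2) (m' := l')
    (by linarith) (by linarith) hl'k hΛ0 hΛt hΛle
  have hgr := gradConst_le hlam ha hγ hq0 hb hR hk hθ hθ1 hl (m := (l + l') / 2) (m' := l')
    (by linarith) (by linarith) hl'k hΛ0 hΛt hΛle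
  rw [← hA, ← hβ, ← he] at hmain
  set S := Metric.ball x₀ r ×ˢ Ioo t' T with hS
  have hSm : MeasurableSet S := Metric.isOpen_ball.measurableSet.prod measurableSet_Ioo
  have hNS : IntegrableOn (levelPow u l' (γ + lam)) S := by
    have h1 : IntegrableOn (levelPow u l (γ + lam)) S := hN.mono_set
      (prod_mono (Metric.ball_subset_ball (by linarith)) (Ioo_subset_Ioo_left (by linarith)))
    refine h1.mono' (measurable_levelPow h.measurable _ _).aestronglyMeasurable
      (Eventually.of_forall fun z => ?_)
    rw [Real.norm_of_nonneg (levelPow_nonneg h.nonneg _ _ _)]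
    exact levelPow_anti h.nonneg (by linarith) _ z
  have hlow : ENNReal.ofReal ((k / 2) ^ e * ∫ z in S, levelPow u l' (γ + lam) z) ≤
      ∫⁻ z in univ ×ˢ Ioo t' T, ENNReal.ofReal (levelPow u l' (γ + lam + e) z *
        χ z.1 ^ (2 - g.a)) := by
    rw [← integral_const_mul, ofReal_integral_eq_lintegral_ofReal (hNS.const_mul _)
      (Eventually.of_forall fun z => mul_nonneg (by positivity) (levelPow_nonneg h.nonneg _ _ _))]
    refine le_trans (setLIntegral_mono_ae' hSm (Eventually.of_forall fun z hz => ?_))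
      (lintegral_mono_set (prod_mono (subset_univ _) Subset.rfl))
    refine ENNReal.ofReal_le_ofReal ?_
    rw [hχe _ (Metric.ball_subset_closedBall hz.1), Real.one_rpow, mul_one]
    unfold levelPow
    split_ifs with hx
    · have hu0 : 0 < u z := hl'0.trans hx
      rw [Real.rpow_add hu0 (γ + lam) e, mul_comm ((k / 2) ^ e)]
      have : (k / 2) ^ e ≤ u z ^ e := Real.rpow_le_rpow (by positivity) (by linarith) he0
      exact mul_le_mul_of_nonneg_left this (by positivity)
    · rw [mul_zero]
  have hchain := hlow.trans (hmain.trans (mul_le_mul' (mul_le_mul' le_rfl (ENNReal.rpow_le_rpow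
    (ENNReal.ofReal_le_ofReal (mul_le_mul_of_nonneg_right hsup hA0)) hβ0.le))
    (ENNReal.ofReal_le_ofReal (mul_le_mul_of_nonneg_right hgr hA0))))
  rw [ENNReal.ofReal_rpow_of_nonneg (by positivity) hβ0.le, ← ENNReal.ofReal_coe_nnreal,
    ← ENNReal.ofReal_mul (by positivity), ← ENNReal.ofReal_mul (by positivity),
    ENNReal.ofReal_le_ofReal_iff (by positivity)] at hchain
  have hθβ : (1 / θ ^ 3) ^ β ≤ 1 / θ ^ 3 := by
    have : 1 ≤ 1 / θ ^ 3 := (one_le_div (by positivity)).2 (pow_le_one₀ hθ.le hθ1)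
    calc (1 / θ ^ 3) ^ β ≤ (1 / θ ^ 3) ^ (1 : ℝ) := Real.rpow_le_rpow_of_exponent_le this hβ1
      _ = _ := Real.rpow_one _
  have hk2 : (k / 2) ^ e * (2 ^ e * k ^ (-e)) = 1 := by
    rw [← mul_assoc, ← Real.mul_rpow (by positivity) (by norm_num), div_mul_cancel₀ _ two_ne_zero,
      ← Real.rpow_add hk, add_neg_cancel, Real.rpow_zero]
  have hA' : 0 ≤ ∫ z in S, levelPow u l' (γ + lam) z :=
    integral_nonneg fun z => levelPow_nonneg h.nonneg _ _ _
  calc ∫ z in S, levelPow u l' (γ + lam) z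
      = (2 ^ e * k ^ (-e)) * ((k / 2) ^ e * ∫ z in S, levelPow u l' (γ + lam) z) := by
        rw [← mul_assoc, mul_comm (2 ^ e * k ^ (-e)), hk2, one_mul]
    _ ≤ (2 ^ e * k ^ (-e)) * (C₀ * (c₂ * (s / θ ^ 3) * A) ^ β * (c₃ * (s / θ ^ 4) * A)) := by
        gcongr
    _ = (2 ^ e * k ^ (-e)) * (C₀ * (c₂ ^ β * (s ^ β * (1 / θ ^ 3) ^ β) * A ^ β) *
        (c₃ * (s / θ ^ 4) * A)) := by
        rw [Real.mul_rpow (by positivity) hA0, Real.mul_rpow hc₂0 (by positivity),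
          div_eq_mul_one_div s (θ ^ 3), Real.mul_rpow (zero_le_one.trans hs1) (by positivity)]
    _ ≤ (2 ^ e * k ^ (-e)) * (C₀ * (c₂ ^ β * (s ^ β * (1 / θ ^ 3)) * A ^ β) *
        (c₃ * (s / θ ^ 4) * A)) := by gcongr
    _ = _ := by
        rw [Real.rpow_one_add' hA0 (by positivity),
          Real.rpow_one_add' (zero_le_one.trans hs1) (by positivity)]
        field_simp

theorem exists_level_const (hn : 2 ≤ n) (hlam : lam ∈ Ioc (0 : ℝ) 1) (ha : 1 - lam < g.a)
    (hγ : 1 ≤ γ) {β e : ℝ} (hβ : β = (2 - g.a) / n)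
    (he : e = (γ + lam) * β - (lam - 1 + g.a)) (he0 : 0 ≤ e) :
    ∃ C : ℝ, 0 ≤ C ∧ ∀ {U : Opens (Space n)} {T : ℝ} {u : Space n × ℝ → ℝ}
      {G : Space n × ℝ → Space n} (_ : IsMeasurableWeakSolution g lam (cylinder U T) u G)
      {x₀ : Space n} {R b k : ℝ} (_ : 0 < R) (_ : 0 < b) (_ : 0 < k)
      (_ : Metric.ball x₀ R ⊆ (U : Set (Space n)))
      (_ : IntegrableOn (levelPow u (k / 2) (γ + lam)) (Metric.ball x₀ R ×ˢ Ioo 0 T))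
      (_ : C * scaleFactor g lam b R k ^ (1 + β) * k ^ (-e) *
        (∫ z in Metric.ball x₀ R ×ˢ Ioo 0 T, levelPow u (k / 2) (γ + lam) z) ^ β ≤ 1),
      ∀ᵐ z ∂volume.restrict (Metric.ball x₀ (R / 2) ×ˢ Ioo b T), u z ≤ k := by
  have ha1 := g.a_lt_one
  have hn2 : (2 : ℝ) ≤ n := by exact_mod_cast hn
  have hβ0 : 0 < β := by rw [hβ]; exact div_pos (by linarith) (by linarith)
  obtain ⟨C, hC0, hC⟩ := exists_step_const hn hlam ha hγ hβ he he0
  -- With `θ = 2 ^ (-j) / 4` the factor `θ ^ (-7)` is `4 ^ 7 * 128 ^ j`; the power `128 ^ (1 / β)`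
  -- is the smallness threshold of the recursion.
  refine ⟨C * 4 ^ 7 * 128 ^ (1 / β), by positivity, ?_⟩
  intro U T u G h x₀ R b k hR hb hk hU hN hsmall
  -- Levels increase from `k / 2` to `k`, radii decrease from `R` to `R / 2`, initial times increase
  -- from `0` to `b`.
  set l : ℕ → ℝ := fun j => k * (1 - (1 / 2) ^ j / 2) with hl
  set r : ℕ → ℝ := fun j => R / 2 * (1 + (1 / 2) ^ j) with hr
  set t : ℕ → ℝ := fun j => b * (1 - (1 / 2) ^ j) with ht
  set S : ℕ → Set (Space n × ℝ) := fun j => Metric.ball x₀ (r j) ×ˢ Ioo (t j) T with hS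
  set A : ℕ → ℝ := fun j => ∫ z in S j, levelPow u (l j) (γ + lam) z with hA
  have hx0 : ∀ j : ℕ, (0 : ℝ) < (1 / 2) ^ j := fun j => by positivity
  have hx1 : ∀ j : ℕ, ((1 : ℝ) / 2) ^ j ≤ 1 := fun j => pow_le_one₀ (by norm_num) (by norm_num)
  have hl0 : l 0 = k / 2 := by simp [hl]; ring
  have hr0 : r 0 = R := by simp [hr]; ring
  have ht0 : t 0 = 0 := by simp [ht]
  have hlk : ∀ j, k / 2 ≤ l j := fun j => by simp only [hl]; nlinarith [hx1 j]
  have hlk' : ∀ j, l j ≤ k := fun j => by simp only [hl]; nlinarith [hx0 j]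
  have hrR : ∀ j, r j ≤ R := fun j => by simp only [hr]; nlinarith [hx1 j]
  have hrR' : ∀ j, R / 2 ≤ r j := fun j => by simp only [hr]; nlinarith [hx0 j]
  have ht00 : ∀ j, 0 ≤ t j := fun j => mul_nonneg hb.le (by linarith [hx1 j])
  have htb : ∀ j, t j ≤ b := fun j => by simp only [ht]; nlinarith [hx0 j]
  have hint : ∀ j l', k / 2 ≤ l' → IntegrableOn (levelPow u l' (γ + lam)) (S j) := by
    intro j l' hl'
    have h1 : IntegrableOn (levelPow u (k / 2) (γ + lam)) (S j) := hN.mono_set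
      (prod_mono (Metric.ball_subset_ball (hrR j)) (Ioo_subset_Ioo_left (ht00 j)))
    refine h1.mono' (measurable_levelPow h.measurable _ _).aestronglyMeasurable
      (Eventually.of_forall fun z => ?_)
    rw [Real.norm_of_nonneg (levelPow_nonneg h.nonneg _ _ _)]
    exact levelPow_anti h.nonneg hl' _ z
  have hstep : ∀ j, A (j + 1) ≤ C * 4 ^ 7 * scaleFactor g lam b R k ^ (1 + β) * k ^ (-e) *
      128 ^ j * A j ^ (1 + β) := by
    intro j
    have e1 : ((1 : ℝ) / 2) ^ (j + 1) = (1 / 2) ^ j / 2 := by ring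
    have h1 := hC h (x₀ := x₀) (R := R) (b := b) (k := k) (θ := (1 / 2) ^ j / 4) (l := l j)
      (l' := l (j + 1)) (r := r (j + 1)) (ρ := r j) (t := t j) (t' := t (j + 1)) hR hb hk
      (by linarith [hx0 j]) (by linarith [hx1 j]) (hlk j)
      (le_of_eq (by simp only [hl, e1]; ring)) (hlk' _) (by linarith [hrR' (j + 1)])
      (le_of_eq (by simp only [hr, e1]; ring)) ((Metric.ball_subset_ball (hrR j)).trans hU) (ht00 j)
      (by simp only [ht, e1]; nlinarith [hx0 j]) (hint j _ (hlk j))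
    refine h1.trans (le_of_eq ?_)
    have e2 : 1 / ((1 / 2 : ℝ) ^ j / 4) ^ 7 = 4 ^ 7 * 128 ^ j := by
      rw [div_pow, one_div_div, ← pow_mul, mul_comm j 7, pow_mul, one_div_pow 2 7, one_div_pow]
      norm_num
    rw [e2]
    ring
  have hlim : Tendsto A atTop (𝓝 0) := by
    have hs0 : 0 ≤ scaleFactor g lam b R k := zero_le_one.trans (one_le_scaleFactor hb hR hk)
    refine tendsto_zero_of_le_mul_rpow (β := β) (B := 128)
      (K := C * 4 ^ 7 * scaleFactor g lam b R k ^ (1 + β) * k ^ (-e))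
      (fun j => integral_nonneg fun z => levelPow_nonneg h.nonneg _ _ _) (by positivity)
      (by norm_num) hβ0 hstep ?_
    simp only [hA, hS, hl0, hr0, ht0]
    refine le_trans (le_of_eq ?_) hsmall
    ring
  set S' := Metric.ball x₀ (R / 2) ×ˢ Ioo b T with hS'
  have hsub : ∀ j, S' ⊆ S j := fun j =>
    prod_mono (Metric.ball_subset_ball (hrR' j)) (Ioo_subset_Ioo_left (htb j))
  have hle : ∀ j, ∫ z in S', levelPow u k (γ + lam) z ≤ A j := fun j => by
    refine (setIntegral_mono_set (hint j k (by linarith))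
      (Eventually.of_forall fun z => levelPow_nonneg h.nonneg _ _ _) (hsub j).eventuallyLE).trans ?_
    exact integral_mono (hint j k (by linarith)) (hint j _ (hlk j))
      fun z => levelPow_anti h.nonneg (hlk' j) _ z
  -- The limiting cylinder and level are contained in every stage, so their integral lies below all
  -- `A j`.
  have hzero : ∫ z in S', levelPow u k (γ + lam) z = 0 :=
    le_antisymm (ge_of_tendsto' hlim hle) (integral_nonneg fun z => levelPow_nonneg h.nonneg _ _ _)
  have hi : IntegrableOn (levelPow u k (γ + lam)) S' := (hint 0 k (by linarith)).mono_set (hsub 0)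
  rw [integral_eq_zero_iff_of_nonneg (fun z => levelPow_nonneg h.nonneg _ _ _) hi] at hzero
  filter_upwards [hzero] with z hz
  by_contra hcon
  rw [not_le] at hcon
  rw [levelPow, if_pos hcon] at hz
  exact (Real.rpow_pos_of_pos (hk.trans hcon) _).ne' hz

end Step

/-! ### The infinite products compared with geometric sums -/

section Products

theorem one_add_sum_le_prod_one_add {ι : Type*} (s : Finset ι) {t : ι → ℝ} (ht : ∀ i, 0 ≤ t i) :
    1 + ∑ i ∈ s, t i ≤ ∏ i ∈ s, (1 + t i) := by
  classical
  induction s using Finset.induction_on with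
  | empty => simp
  | insert i s hi ih =>
    rw [Finset.sum_insert hi, Finset.prod_insert hi]
    have h1 := Finset.sum_nonneg fun j (_ : j ∈ s) => ht j
    nlinarith [ht i, mul_nonneg (ht i) h1, mul_le_mul_of_nonneg_left ih (ht i)]

theorem hasSum_mul_inv_pow {κ : ℝ} (hκ : 1 < κ) (y : ℝ) :
    HasSum (fun j : ℕ => y / κ ^ j) (y * κ / (κ - 1)) := by
  have h := (hasSum_geometric_of_lt_one (r := κ⁻¹) (by positivity)
    (inv_lt_one_of_one_lt₀ hκ)).mul_left y
  have e : y * (1 - κ⁻¹)⁻¹ = y * κ / (κ - 1) := by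
    have h1 : κ - 1 ≠ 0 := by linarith
    have h2 : κ ≠ 0 := by linarith
    have h3 : 1 - κ⁻¹ = (κ - 1) / κ := by field_simp
    rw [h3, inv_div, mul_div_assoc]
  rw [e] at h
  refine h.congr_fun fun j => ?_
  rw [inv_pow, div_eq_mul_inv]

/-- Multiply by the product of `1 + y / κ ^ j`: every factor pair is `1 - (y / κ ^ j) ^ 2 ≤ 1`,
while the second product is at least one plus the geometric sum. The case `y = 1` is allowed and
gives a vanishing product. -/
theorem exists_hasProd_one_sub {κ y : ℝ} (hκ : 1 < κ) (hy0 : 0 ≤ y) (hy1 : y ≤ 1) :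
    ∃ μ : ℝ, HasProd (fun j : ℕ => 1 - y / κ ^ j) μ ∧ 0 ≤ μ ∧ μ * (1 + y * κ / (κ - 1)) ≤ 1 := by
  have hs := hasSum_mul_inv_pow hκ y
  have hm : Multipliable fun j : ℕ => 1 + -(y / κ ^ j) :=
    Real.multipliable_one_add_of_summable hs.summable.neg
  simp only [← sub_eq_add_neg] at hm
  have ht := hm.hasProd.tendsto_prod_nat
  have hpow : ∀ j : ℕ, 1 ≤ κ ^ j := fun j => one_le_pow₀ hκ.le
  have ht0 : ∀ j : ℕ, 0 ≤ y / κ ^ j := fun j => div_nonneg hy0 (by linarith [hpow j])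
  have ht1 : ∀ j : ℕ, y / κ ^ j ≤ 1 := fun j =>
    (div_le_one (by linarith [hpow j])).2 (hy1.trans (hpow j))
  refine ⟨_, hm.hasProd, ge_of_tendsto' ht fun N => Finset.prod_nonneg fun j _ =>
    sub_nonneg.2 (ht1 j), le_of_tendsto' (ht.mul (hs.tendsto_sum_nat.const_add 1)) fun N => ?_⟩
  calc (∏ j ∈ Finset.range N, (1 - y / κ ^ j)) * (1 + ∑ j ∈ Finset.range N, y / κ ^ j)
      ≤ (∏ j ∈ Finset.range N, (1 - y / κ ^ j)) * ∏ j ∈ Finset.range N, (1 + y / κ ^ j) :=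
        mul_le_mul_of_nonneg_left (one_add_sum_le_prod_one_add _ ht0)
          (Finset.prod_nonneg fun j _ => sub_nonneg.2 (ht1 j))
    _ = ∏ j ∈ Finset.range N, ((1 - y / κ ^ j) * (1 + y / κ ^ j)) := Finset.prod_mul_distrib.symm
    _ ≤ 1 := Finset.prod_le_one
        (fun j _ => mul_nonneg (sub_nonneg.2 (ht1 j)) (by linarith [ht0 j]))
        fun j _ => by nlinarith [ht0 j]

/-- Each factor is `1 + t / (1 - t)` with summable second term, and it is at least `1 + t`, where `t
= x / κ ^ j`. -/
theorem exists_hasProd_inv_one_sub {κ x : ℝ} (hκ : 1 < κ) (hx0 : 0 ≤ x) (hx1 : x < 1) :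
    ∃ ν : ℝ, HasProd (fun j : ℕ => (1 - x / κ ^ j)⁻¹) ν ∧ 1 + x * κ / (κ - 1) ≤ ν := by
  have hs := hasSum_mul_inv_pow hκ x
  have hpow : ∀ j : ℕ, 1 ≤ κ ^ j := fun j => one_le_pow₀ hκ.le
  have ht0 : ∀ j : ℕ, 0 ≤ x / κ ^ j := fun j => div_nonneg hx0 (by linarith [hpow j])
  have ht1 : ∀ j : ℕ, x / κ ^ j ≤ x := fun j => div_le_self hx0 (hpow j)
  have hpos : ∀ j : ℕ, 0 < 1 - x / κ ^ j := fun j => by linarith [ht1 j]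
  have he : ∀ j : ℕ, (1 - x / κ ^ j)⁻¹ = 1 + x / κ ^ j / (1 - x / κ ^ j) := fun j => by
    have := (hpos j).ne'
    generalize x / κ ^ j = t at *
    field_simp
    ring
  have hsum : Summable fun j : ℕ => x / κ ^ j / (1 - x / κ ^ j) := by
    refine Summable.of_nonneg_of_le (fun j => div_nonneg (ht0 j) (hpos j).le) (fun j => ?_)
      (hs.summable.mul_right (1 - x)⁻¹)
    rw [← div_eq_mul_inv]
    exact div_le_div_of_nonneg_left (ht0 j) (by linarith) (by linarith [ht1 j])
  have hm := Real.multipliable_one_add_of_summable hsum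
  simp only [← he] at hm
  refine ⟨_, hm.hasProd, le_of_tendsto_of_tendsto' (hs.tendsto_sum_nat.const_add 1)
    hm.hasProd.tendsto_prod_nat fun N => ?_⟩
  refine (one_add_sum_le_prod_one_add _ ht0).trans (Finset.prod_le_prod
    (fun j _ => by linarith [ht0 j]) fun j _ => ?_)
  rw [le_inv_comm₀ (by linarith [ht0 j]) (hpos j), le_inv_comm₀ (hpos j) (by linarith [ht0 j]),
    ← one_div, le_div_iff₀ (hpos j)]
  nlinarith [ht0 j]

theorem exists_hasProd_muFactor {n : ℕ} {a δ α : ℝ} (hα : 0 < α) (hδ : δ ≤ 2) (hδα : 2 - δ ≤ α)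
    (hκ : 1 < kappa n a δ α) :
    ∃ μ : ℝ, HasProd (muFactor n a δ α) μ ∧ 0 ≤ μ ∧
      μ * (1 + (2 - δ) / α * kappa n a δ α / (kappa n a δ α - 1)) ≤ 1 := by
  obtain ⟨μ, h, h'⟩ := exists_hasProd_one_sub hκ (y := (2 - δ) / α)
    (div_nonneg (by linarith) hα.le) ((div_le_one hα).2 hδα)
  refine ⟨μ, h.congr_fun fun j => ?_, h'⟩
  have : kappa n a δ α ^ j ≠ 0 := pow_ne_zero _ (by linarith)
  unfold muFactor
  field_simp
  ring

theorem exists_hasProd_nuFactor {n : ℕ} {a δ α : ℝ} (hα : 0 < α) (hδ : δ ≤ a) (hδα : a - δ < α)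
    (hκ : 1 < kappa n a δ α) :
    ∃ ν : ℝ, HasProd (nuFactor n a δ α) ν ∧
      1 + (a - δ) / α * kappa n a δ α / (kappa n a δ α - 1) ≤ ν := by
  obtain ⟨ν, h, h'⟩ := exists_hasProd_inv_one_sub hκ (x := (a - δ) / α)
    (div_nonneg (by linarith) hα.le) ((div_lt_one hα).2 hδα)
  refine ⟨ν, h.congr_fun fun j => ?_, h'⟩
  have : kappa n a δ α ^ j ≠ 0 := pow_ne_zero _ (by linarith)
  unfold nuFactor
  generalize kappa n a δ α ^ j = X at *
  have e : 1 - (a - δ) / α / X = (α * X + δ - a) / (α * X) := by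
    field_simp
    ring
  rw [e, inv_div]

end Products

/-! ### Borel representatives of weak solutions -/

section Representative

variable {n : ℕ} {g : GenPoly} {lam : ℝ}

theorem IsWeakSolution.exists_isMeasurableWeakSolution {Q : Opens (Space n × ℝ)}
    {u : Space n × ℝ → ℝ} (h : IsWeakSolution g lam Q u) :
    ∃ v G, IsMeasurableWeakSolution g lam Q v G ∧
      u =ᵐ[volume.restrict (Q : Set (Space n × ℝ))] v := by
  obtain ⟨h0, hu, G, hG, hGp, hw, heq⟩ := h
  have hum := hu.aestronglyMeasurable
  have hGm := hG.aestronglyMeasurable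
  set v : Space n × ℝ → ℝ := fun z => max (hum.mk u z) 0 with hv
  have huv : u =ᵐ[volume.restrict (Q : Set (Space n × ℝ))] v := by
    filter_upwards [hum.ae_eq_mk, h0] with z hz hz0
    rw [hv]; dsimp only
    rw [← hz, max_eq_left hz0]
  have hGG := hGm.ae_eq_mk
  refine ⟨v, hGm.mk G, ⟨hum.stronglyMeasurable_mk.measurable.max measurable_const,
    fun z => le_max_right _ _, hu.congr huv, hGm.stronglyMeasurable_mk.measurable, hG.congr hGG,
    hGp.congr (hGG.mono fun z hz => by simp only [hz]), fun φ => ?_, fun φ => ?_⟩, huv⟩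
  · rw [integral_congr_ae (g := fun z => u z • spaceGrad φ z)
        (huv.mono fun z hz => by simp only [hz]), hw φ]
    congr 1
    exact integral_congr_ae (hGG.mono fun z hz => by simp only [hz])
  · rw [integral_congr_ae (g := fun z => u z ^ lam * timeDeriv φ z)
        (huv.mono fun z hz => by simp only [hz]), heq φ]
    exact integral_congr_ae (hGG.mono fun z hz => by simp only [hz])

end Representative

/-! ### Choosing the level from the `L^α` norm -/

theorem le_rpow_of_le_mul_max {Z Bs y μ ν e x k E : ℝ} (hBs1 : 1 ≤ Bs) (hBs : Z ≤ Bs ^ e)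
    (hy : 0 < y) (hν0 : 0 ≤ ν) (he : 0 < e) (hx : e ≤ x) (hμ : x * μ ≤ E) (hν : E ≤ e * ν)
    (hk : Bs * max (y ^ μ) (y ^ ν) ≤ k) : Z * y ^ E ≤ k ^ x := by
  have hBs0 : 0 < Bs := by linarith
  have hx0 : 0 < x := he.trans_le hx
  have h1 : Z ≤ Bs ^ x := hBs.trans (Real.rpow_le_rpow_of_exponent_le hBs1 hx)
  have h2 : y ^ E ≤ max (y ^ μ) (y ^ ν) ^ x := by
    rcases le_total y 1 with h | h
    · calc y ^ E ≤ y ^ (μ * x) := Real.rpow_le_rpow_of_exponent_ge hy h (by linarith)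
        _ = (y ^ μ) ^ x := Real.rpow_mul hy.le _ _
        _ ≤ _ := Real.rpow_le_rpow (by positivity) (le_max_left _ _) hx0.le
    · have h3 : e * ν ≤ x * ν := mul_le_mul_of_nonneg_right hx hν0
      calc y ^ E ≤ y ^ (ν * x) := Real.rpow_le_rpow_of_exponent_le h (by linarith)
        _ = (y ^ ν) ^ x := Real.rpow_mul hy.le _ _
        _ ≤ _ := Real.rpow_le_rpow (by positivity) (le_max_right _ _) hx0.le
  have h4 : 0 ≤ max (y ^ μ) (y ^ ν) := le_max_of_le_left (by positivity)
  calc Z * y ^ E ≤ Bs ^ x * max (y ^ μ) (y ^ ν) ^ x := by gcongr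
    _ = (Bs * max (y ^ μ) (y ^ ν)) ^ x := (Real.mul_rpow hBs0.le h4).symm
    _ ≤ k ^ x := Real.rpow_le_rpow (by positivity) hk hx0.le

/-- For `k ≥ 1` the factor `1 + k ^ (-S)` is at most `2` and `k ^ e` must win; for `k ≤ 1` it is at
most `2 k ^ (-S)` and the larger power `e + S (1 + β)` of `k` must win. The hypotheses on `μ` and
`ν` cover both cases for small and large `y`. -/
theorem level_condition {C Θ Bs y μ ν e S β α k : ℝ} (hC : 0 ≤ C) (hΘ : 1 ≤ Θ) (hBs1 : 1 ≤ Bs)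
    (hBs : C * (2 * Θ) ^ (1 + β) ≤ Bs ^ e) (hy : 0 < y) (hμ0 : 0 ≤ μ) (hν0 : 0 ≤ ν)
    (hμ : (e + S * (1 + β)) * μ ≤ α * β) (hν : α * β ≤ e * ν) (he : 0 < e) (hS : 0 ≤ S)
    (hβ : 0 ≤ β) (hk : Bs * max (y ^ μ) (y ^ ν) ≤ k) :
    C * (Θ * (1 + k ^ (-S))) ^ (1 + β) * k ^ (-e) * (y ^ α) ^ β ≤ 1 := by
  have hmax : 0 < max (y ^ μ) (y ^ ν) := lt_max_of_lt_left (by positivity)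
  have hk0 : 0 < k := (by positivity : 0 < Bs * max (y ^ μ) (y ^ ν)).trans_le hk
  have hSβ : 0 ≤ S * (1 + β) := by positivity
  rw [← Real.rpow_mul hy.le]
  rcases le_total 1 k with h | h
  · have h1 := le_rpow_of_le_mul_max hBs1 hBs hy hν0 he le_rfl (E := α * β)
      (by nlinarith [mul_nonneg hSβ hμ0]) hν hk
    have h2 : k ^ (-S) ≤ 1 := Real.rpow_le_one_of_one_le_of_nonpos h (by linarith)
    have h3 : 0 ≤ k ^ (-S) := by positivity
    have h4 : (Θ * (1 + k ^ (-S))) ^ (1 + β) ≤ (2 * Θ) ^ (1 + β) :=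
      Real.rpow_le_rpow (by positivity) (by nlinarith) (by positivity)
    calc _ ≤ C * (2 * Θ) ^ (1 + β) * k ^ (-e) * y ^ (α * β) := by gcongr
      _ = (C * (2 * Θ) ^ (1 + β) * y ^ (α * β)) * k ^ (-e) := by ring
      _ ≤ k ^ e * k ^ (-e) := by gcongr
      _ = 1 := by rw [← Real.rpow_add hk0, add_neg_cancel, Real.rpow_zero]
  · have h1 := le_rpow_of_le_mul_max hBs1 hBs hy hν0 he (x := e + S * (1 + β)) (by linarith)
      hμ hν hk
    have h2 : 1 ≤ k ^ (-S) := Real.one_le_rpow_of_pos_of_le_one_of_nonpos hk0 h (by linarith)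
    have h4 : (Θ * (1 + k ^ (-S))) ^ (1 + β) ≤ (2 * Θ * k ^ (-S)) ^ (1 + β) :=
      Real.rpow_le_rpow (by positivity) (by nlinarith) (by positivity)
    calc _ ≤ C * (2 * Θ * k ^ (-S)) ^ (1 + β) * k ^ (-e) * y ^ (α * β) := by gcongr
      _ = (C * (2 * Θ) ^ (1 + β) * y ^ (α * β)) * k ^ (-(e + S * (1 + β))) := by
          rw [Real.mul_rpow (by positivity) (by positivity), ← Real.rpow_mul hk0.le, neg_add,
            Real.rpow_add hk0, neg_mul]
          ring
      _ ≤ k ^ (e + S * (1 + β)) * k ^ (-(e + S * (1 + β))) := by gcongr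
      _ = 1 := by rw [← Real.rpow_add hk0, add_neg_cancel, Real.rpow_zero]

theorem integrable_levelPow {X : Type*} [MeasurableSpace X] {ρ : Measure X} {v : X → ℝ}
    (hv : Measurable v) (hv0 : ∀ z, 0 ≤ v z) {l α : ℝ} (hα : 0 < α)
    (hfin : eLpNorm v (ENNReal.ofReal α) ρ ≠ ⊤) :
    Integrable (levelPow v l α) ρ ∧
      ∫ z, levelPow v l α z ∂ρ ≤ (eLpNorm v (ENNReal.ofReal α) ρ).toReal ^ α := by
  have hle : ∫⁻ z, ENNReal.ofReal (levelPow v l α z) ∂ρ ≤ eLpNorm v (ENNReal.ofReal α) ρ ^ α := by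
    rw [eLpNorm_ofReal_rpow hα]
    refine lintegral_mono fun z => ?_
    rw [Real.enorm_of_nonneg (hv0 z), ENNReal.ofReal_rpow_of_nonneg (hv0 z) hα.le]
    refine ENNReal.ofReal_le_ofReal ?_
    unfold levelPow
    split_ifs
    · exact le_rfl
    · exact Real.rpow_nonneg (hv0 z) _
  have hfin' := ENNReal.rpow_ne_top_of_nonneg hα.le hfin
  have hm := (measurable_levelPow hv l α).aestronglyMeasurable (μ := ρ)
  have h0 : 0 ≤ᵐ[ρ] levelPow v l α := Eventually.of_forall fun z => levelPow_nonneg hv0 _ _ _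
  refine ⟨⟨hm, (hasFiniteIntegral_iff_ofReal h0).2 (hle.trans_lt hfin'.lt_top)⟩, ?_⟩
  rw [integral_eq_lintegral_of_nonneg_ae h0 hm, ENNReal.toReal_rpow]
  exact ENNReal.toReal_mono hfin' hle

/-! ### Comparison of `μ` and `ν` with the De Giorgi exponents -/

section Exponents

variable {n : ℕ} {a δ α : ℝ}

theorem kappa_sub_one_eq (hα : 0 < α) :
    kappa n a δ α - 1 = (α * ((2 - a) / n) - (a - δ)) / α := by
  unfold kappa
  field_simp
  ring

/-- With `κ_* = 1 + e / α` the product bound reads `μ ≤ α e / (α e + S (α + e))`. Substituting `α β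
= e + D`, its cross-multiplied difference from the required exponent is `D α (e + S) ≥ 0`. -/
theorem mu_exponent_le {μ e S β D : ℝ} (hα : 0 < α) (he : 0 < e) (hS : 0 < S) (hD : 0 ≤ D)
    (heD : α * β = e + D)
    (hμ : μ * (1 + S / α * (1 + e / α) / (e / α)) ≤ 1) :
    (e + S * (1 + β)) * μ ≤ α * β := by
  have hX : 0 < α * e + S * (α + e) := by positivity
  have h1 : μ * (α * e + S * (α + e)) ≤ α * e := by
    have e1 : 1 + S / α * (1 + e / α) / (e / α) = (α * e + S * (α + e)) / (α * e) := by
      field_simp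
    rw [e1, ← mul_div_assoc, div_le_one (by positivity)] at hμ
    exact hμ
  have h2 : (e + S * (1 + β)) * (α * e) ≤ α * β * (α * e + S * (α + e)) := by
    have e2 : α * β * (α * e + S * (α + e)) - (e + S * (1 + β)) * (α * e) =
        D * α * e + D * S * α := by
      have e3 : (e + S * (1 + β)) * (α * e) = (e + S) * (α * e) + S * e * (α * β) := by ring
      rw [e3, heD]
      ring
    have : 0 ≤ D * α * e + D * S * α := by positivity
    linarith
  have h3 : 0 < e + S * (1 + β) := by
    have : 0 ≤ β := by
      by_contra hcon
      nlinarith [mul_neg_of_pos_of_neg hα (not_le.1 hcon)]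
    positivity
  refine le_of_mul_le_mul_right ?_ hX
  calc (e + S * (1 + β)) * μ * (α * e + S * (α + e))
      = (e + S * (1 + β)) * (μ * (α * e + S * (α + e))) := by ring
    _ ≤ (e + S * (1 + β)) * (α * e) := by gcongr
    _ ≤ _ := h2

theorem le_nu_exponent {ν e β D : ℝ} (hα : 0 < α) (he : 0 < e) (hD : 0 ≤ D)
    (heD : α * β = e + D) (hν : 1 + D / α * (1 + e / α) / (e / α) ≤ ν) :
    α * β ≤ e * ν := by
  have h1 : e * (1 + D / α * (1 + e / α) / (e / α)) = e + D + D * e / α := by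
    field_simp
    ring
  have h2 := mul_le_mul_of_nonneg_left hν he.le
  have h3 : 0 ≤ D * e / α := by positivity
  linarith

end Exponents

/-- The base of `Chat` dominates `2 Θ` and hence `2`, so a sufficiently high power of it exceeds any
constant `C`. The remaining factors of the base are at least `1` and are not needed. -/
theorem exists_Chat_exponent {n : ℕ} {a : ℝ} (ha : a < 1) {C β e : ℝ} (hβ : 0 ≤ β) (he : 0 < e) :
    ∃ ω : ℝ, 0 < ω ∧ ∀ {α R T σ : ℝ} (_ : 1 ≤ α) (_ : 0 < R) (_ : 0 < T) (_ : 0 < σ),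
      1 ≤ Chat n a 1 α ω R T σ ∧
      C * (2 * (1 + 1 / (σ * T) + 1 / R ^ (2 - a))) ^ (1 + β) ≤ Chat n a 1 α ω R T σ ^ e := by
  obtain ⟨N, hN⟩ := exists_nat_ge C
  -- After raising to the power `e`, the part `1 + β` pays for `(2 Θ) ^ (1 + β)` and the part `N`
  -- for `C ≤ N ≤ 2 ^ N`.
  refine ⟨(1 + β + N) / e, by positivity, fun {α R T σ} hα hR hT hσ => ?_⟩
  set Θ := 1 + 1 / (σ * T) + 1 / R ^ (2 - a) with hΘ
  have hΘ1 : 1 ≤ Θ := by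
    have h1 : 0 < 1 / (σ * T) := by positivity
    have h2 : 0 < 1 / R ^ (2 - a) := by positivity
    rw [hΘ]; linarith
  set base := 2 ^ 11 * 1 * α ^ (6 - a) * (1 + R⁻¹) ^ 2
    * (1 + volume.real (Metric.ball (0 : Space n) R) * T) ^ 3 * Θ ^ 2 with hbase
  have hb : 2 * Θ ≤ base := by
    have h1 : 1 ≤ α ^ (6 - a) := Real.one_le_rpow hα (by linarith)
    have h2 : 1 ≤ (1 + R⁻¹) ^ 2 := one_le_pow₀ (by
      have : 0 < R⁻¹ := by positivity
      linarith)
    have h3 : 1 ≤ (1 + volume.real (Metric.ball (0 : Space n) R) * T) ^ 3 := one_le_pow₀ (by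
      have : 0 ≤ volume.real (Metric.ball (0 : Space n) R) * T := by positivity
      linarith)
    calc 2 * Θ ≤ 2 ^ 11 * 1 * 1 * 1 * 1 * Θ ^ 2 := by nlinarith
      _ ≤ base := by rw [hbase]; gcongr
  have hb1 : 2 ≤ base := by linarith
  have hb0 : 0 < base := by linarith
  have hch : Chat n a 1 α ((1 + β + N) / e) R T σ = base ^ ((1 + β + N) / e) := rfl
  rw [hch]
  refine ⟨Real.one_le_rpow (by linarith) (by positivity), ?_⟩
  rw [← Real.rpow_mul hb0.le, div_mul_cancel₀ _ he.ne', Real.rpow_add hb0, mul_comm]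
  have h1 : C ≤ base ^ (N : ℝ) := by
    have h2 : (N : ℝ) ≤ 2 ^ N := by exact_mod_cast Nat.lt_two_pow_self.le
    calc C ≤ N := hN
      _ ≤ 2 ^ N := h2
      _ ≤ base ^ N := by gcongr
      _ = base ^ (N : ℝ) := (Real.rpow_natCast _ _).symm
  have h3 : (2 * Θ) ^ (1 + β) ≤ base ^ (1 + β) :=
    Real.rpow_le_rpow (by linarith) hb (by linarith)
  have h4 : 0 ≤ base ^ (N : ℝ) := by positivity
  calc (2 * Θ) ^ (1 + β) * C ≤ (2 * Θ) ^ (1 + β) * base ^ (N : ℝ) :=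
        mul_le_mul_of_nonneg_left h1 (by positivity)
    _ ≤ _ := mul_le_mul_of_nonneg_right h3 h4

theorem exists_eLpNorm_top_le {n : ℕ} (hn : 2 ≤ n) {g : GenPoly} {lam : ℝ}
    (hlam : lam ∈ Ioc (0 : ℝ) 1) (ha : 1 - lam < g.a) {α e : ℝ} (hα : 1 + lam ≤ α)
    (he : e = α * ((2 - g.a) / n) - (lam - 1 + g.a)) (he0 : 0 < e) :
    ∃ ω : ℝ, 0 < ω ∧ ∀ {μ ν : ℝ} (_ : 0 ≤ μ) (_ : 0 < ν)
      (_ : (e + (1 + lam) * (1 + (2 - g.a) / n)) * μ ≤ α * ((2 - g.a) / n))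
      (_ : α * ((2 - g.a) / n) ≤ e * ν)
      (U : Opens (Space n)) (T σ : ℝ), 0 < T → σ ∈ Ioo (0 : ℝ) 1 → ∀ u : Space n × ℝ → ℝ,
      IsWeakSolution g lam (cylinder U T) u → ∀ (x₀ : Space n) (R : ℝ), 0 < R →
      Metric.closedBall x₀ R ⊆ (U : Set (Space n)) →
      eLpNorm u ∞ (volume.restrict (Metric.ball x₀ (R / 2) ×ˢ Ioo (σ * T) T)) ≤
        ENNReal.ofReal (Chat n g.a 1 α ω R T σ) * max
          (eLpNorm u (ENNReal.ofReal α) (volume.restrict (Metric.ball x₀ R ×ˢ Ioo 0 T)) ^ μ)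
          (eLpNorm u (ENNReal.ofReal α) (volume.restrict (Metric.ball x₀ R ×ˢ Ioo 0 T)) ^ ν) := by
  have ha1 := g.a_lt_one
  have hlam0 := hlam.1
  have hn2 : (2 : ℝ) ≤ n := by exact_mod_cast hn
  have hα0 : 0 < α := by linarith
  set β := (2 - g.a) / n with hβ
  have hβ0 : 0 < β := by rw [hβ]; exact div_pos (by linarith) (by linarith)
  -- The condition `α₀ ≥ 2 - δ` is exactly `γ = α - lam ≥ 1`, which the truncated powers require.
  obtain ⟨C, hC0, hC⟩ := exists_level_const hn hlam ha (γ := α - lam) (by linarith) hβ (e := e)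
    (by rw [sub_add_cancel]; exact he) he0.le
  simp only [sub_add_cancel] at hC
  obtain ⟨ω, hω, hωC⟩ := exists_Chat_exponent (n := n) ha1 (C := C) hβ0.le he0
  refine ⟨ω, hω, fun {μ ν} hμ0 hν0 hμ hν U T σ hT hσ u hu x₀ R hR hBU => ?_⟩
  obtain ⟨v, G, hv, huv⟩ := hu.exists_isMeasurableWeakSolution
  obtain ⟨hCh1, hCh⟩ := hωC (α := α) (by linarith) hR hT hσ.1
  set Bs := Chat n g.a 1 α ω R T σ with hBs
  have hσT : 0 < σ * T := mul_pos hσ.1 hT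
  set S := Metric.ball x₀ R ×ˢ Ioo 0 T with hS
  set S' := Metric.ball x₀ (R / 2) ×ˢ Ioo (σ * T) T with hS'
  have hBU' : Metric.ball x₀ R ⊆ (U : Set (Space n)) := Metric.ball_subset_closedBall.trans hBU
  have hSQ : S ⊆ (cylinder U T : Set (Space n × ℝ)) := prod_mono hBU' Subset.rfl
  have hS'S : S' ⊆ S := prod_mono (Metric.ball_subset_ball (by linarith))
    (Ioo_subset_Ioo_left hσT.le)
  have huS : u =ᵐ[volume.restrict S] v := ae_mono (Measure.restrict_mono_set _ hSQ) huv
  have huS' : u =ᵐ[volume.restrict S'] v := ae_mono (Measure.restrict_mono_set _ hS'S) huS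
  rw [eLpNorm_congr_ae huS, eLpNorm_congr_ae huS']
  set Y := eLpNorm v (ENNReal.ofReal α) (volume.restrict S) with hY
  have hBs0 : 0 < Bs := by linarith
  rcases eq_or_ne Y ⊤ with hYt | hYt
  -- Positivity of `ν` makes the right-hand side infinite even if `μ = 0`.
  · rw [hYt, ENNReal.top_rpow_of_pos hν0, max_eq_right le_top, ENNReal.mul_top]
    · exact le_top
    · exact (ENNReal.ofReal_pos.2 hBs0).ne'
  rcases eq_or_ne Y 0 with hY0 | hY0
  · have hv0 : v =ᵐ[volume.restrict S] 0 := (eLpNorm_eq_zero_iff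
      hv.measurable.aestronglyMeasurable (ENNReal.ofReal_pos.2 hα0).ne').1 hY0
    rw [eLpNorm_congr_ae (ae_mono (Measure.restrict_mono_set _ hS'S) hv0), eLpNorm_zero]
    exact zero_le
  set y := Y.toReal with hy
  have hy0 : 0 < y := ENNReal.toReal_pos hY0 hYt
  have hYy : Y = ENNReal.ofReal y := (ENNReal.ofReal_toReal hYt).symm
  set k := Bs * max (y ^ μ) (y ^ ν) with hk
  have hmax : 0 < max (y ^ μ) (y ^ ν) := lt_max_of_lt_left (by positivity)
  have hk0 : 0 < k := by positivity
  obtain ⟨hint, hA⟩ := integrable_levelPow hv.measurable hv.nonneg (l := k / 2) hα0 hYt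
  have hs0 : 0 ≤ scaleFactor g lam (σ * T) R k :=
    zero_le_one.trans (one_le_scaleFactor hσT hR hk0)
  have hΘ : 1 ≤ 1 + 1 / (σ * T) + 1 / R ^ (2 - g.a) := by
    have h1 : 0 < 1 / (σ * T) := by positivity
    have h2 : 0 < 1 / R ^ (2 - g.a) := by positivity
    linarith
  have hcond := level_condition (k := k) hC0 hΘ hCh1 hCh hy0 hμ0 hν0.le hμ hν he0
    (by linarith : 0 ≤ 1 + lam) hβ0.le le_rfl
  have hvk := hC hv hR hσT hk0 hBU' hint (by
    refine le_trans ?_ hcond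
    rw [scaleFactor] at hs0 ⊢
    have : 0 ≤ ∫ z in S, levelPow v (k / 2) α z :=
      integral_nonneg fun z => levelPow_nonneg hv.nonneg _ _ _
    gcongr)
  have hbd : eLpNorm v ∞ (volume.restrict S') ≤ ENNReal.ofReal k := by
    rw [eLpNorm_exponent_top]
    refine eLpNormEssSup_le_of_ae_bound (hvk.mono fun z hz => ?_)
    rwa [Real.norm_of_nonneg (hv.nonneg z)]
  refine hbd.trans (le_of_eq ?_)
  rw [hYy, ENNReal.ofReal_rpow_of_pos hy0, ENNReal.ofReal_rpow_of_pos hy0,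
    ← ENNReal.ofReal_max, ← ENNReal.ofReal_mul hBs0.le]

end Forchheimer

theorem theorem4p4 (n : ℕ) (hn : 2 ≤ n) (g : Forchheimer.GenPoly)
    (lam : ℝ) (hlam : lam ∈ Set.Ioc (0 : ℝ) 1)
    (δ : ℝ) (hδ : δ = 1 - lam) (hsuper : δ < g.a) :
    ∃ c₁₀ : ℝ, 1 ≤ c₁₀ ∧
      ∀ α₀ : ℝ, 2 - δ ≤ α₀ → Forchheimer.alphaStar n g.a δ < α₀ →
      ∃ μ ν ω : ℝ,
        HasProd (Forchheimer.muFactor n g.a δ α₀) μ ∧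
        HasProd (Forchheimer.nuFactor n g.a δ α₀) ν ∧
        0 < ω ∧
        ∀ (U : Opens (Forchheimer.Space n)) (T σ : ℝ), 0 < T → σ ∈ Set.Ioo (0 : ℝ) 1 →
        ∀ u : Forchheimer.Space n × ℝ → ℝ,
          Forchheimer.IsWeakSolution g lam (Forchheimer.cylinder U T) u →
        ∀ (x₀ : Forchheimer.Space n) (R : ℝ), 0 < R →
          Metric.closedBall x₀ R ⊆ (U : Set (Forchheimer.Space n)) →
          eLpNorm u ∞ (volume.restrict (Metric.ball x₀ (R / 2) ×ˢ Set.Ioo (σ * T) T))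
            ≤ ENNReal.ofReal (Forchheimer.Chat n g.a c₁₀ α₀ ω R T σ) *
              max
                (eLpNorm u (ENNReal.ofReal α₀)
                  (volume.restrict (Metric.ball x₀ R ×ˢ Set.Ioo 0 T)) ^ μ)
                (eLpNorm u (ENNReal.ofReal α₀)
                  (volume.restrict (Metric.ball x₀ R ×ˢ Set.Ioo 0 T)) ^ ν) := by
  subst hδ
  have ha0 := g.a_pos
  have ha1 := g.a_lt_one
  have hlam0 := hlam.1
  have hn0 : (0 : ℝ) < n := by exact_mod_cast (by omega : 0 < n)
  -- The constant can be `1`, because `ω` may depend on `α₀` and absorbs everything else.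
  refine ⟨1, le_rfl, fun α hα hαs => ?_⟩
  have hα1 : 1 + lam ≤ α := by linarith
  have hα0 : 0 < α := by linarith
  set e := α * ((2 - g.a) / n) - (lam - 1 + g.a) with he
  have he0 : 0 < e := by
    rw [Forchheimer.alphaStar, div_lt_iff₀ (by linarith)] at hαs
    rw [he, sub_pos, ← mul_div_assoc, lt_div_iff₀ hn0]
    linarith
  -- The same `e` governs the growth of the exponents in the products and the gain in the iteration;
  -- this links the two.
  have hκe : Forchheimer.kappa n g.a (1 - lam) α - 1 = e / α := by
    rw [Forchheimer.kappa_sub_one_eq hα0, he]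
    ring
  have hκ : Forchheimer.kappa n g.a (1 - lam) α = 1 + e / α := by linarith
  have hκ1 : 1 < Forchheimer.kappa n g.a (1 - lam) α := by
    have : 0 < e / α := by positivity
    linarith
  obtain ⟨μ, hμP, hμ0, hμ⟩ := Forchheimer.exists_hasProd_muFactor (n := n) (a := g.a)
    (δ := 1 - lam) hα0 (by linarith) hα hκ1
  obtain ⟨ν, hνP, hν⟩ := Forchheimer.exists_hasProd_nuFactor (n := n) (a := g.a)
    (δ := 1 - lam) hα0 hsuper.le (by linarith [hlam.2]) hκ1
  obtain ⟨ω, hω, hmain⟩ := Forchheimer.exists_eLpNorm_top_le hn hlam hsuper hα1 he he0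
  rw [hκe, hκ, show 2 - (1 - lam) = 1 + lam by ring] at hμ
  rw [hκe, hκ, show g.a - (1 - lam) = lam - 1 + g.a by ring] at hν
  have heD : α * ((2 - g.a) / n) = e + (lam - 1 + g.a) := by rw [he]; ring
  have hν1 : 0 < ν := by
    refine lt_of_lt_of_le ?_ hν
    have : 0 < lam - 1 + g.a := by linarith
    positivity
  exact ⟨μ, ν, ω, hμP, hνP, hω, hmain hμ0 hν1
    (Forchheimer.mu_exponent_le hα0 he0 (by linarith) (by linarith) heD hμ)
    (Forchheimer.le_nu_exponent hα0 he0 (by linarith) heD hν)⟩
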